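/- Let $(\mathcal M,g)$ be a strongly causal space-time: a smooth four-manifold (Hausdorff, second countable) with a smooth Lorentz metric and a time orientation, such that every neighbourhood $U$ of every point contains a neighbourhood $V$ of that point for which every future-pointing causal curve with both end points in $V$ stays in $U$. On the cotangent bundle $T^*\mathcal M$, with local coordinates $(x^a,p_a)$, let $\theta=p_a\,dx^a$, $\omega=d\theta$, $H=\tfrac12 g^{ab}p_ap_b$, let $\Delta=p_a\,\partial/\partial p_a$, and let $X_G$ be the geodesic spray, defined by $X_G\lrcorner\,\omega+dH=0$. Let $N'\mathcal M\subset\{H=0\}$ be the set of non-zero null covectors with $p^a$ future pointing, and let $\mathcal N$ be the space of null geodesics: the quotient of $N'\mathcal M$ by the leaves of the distribution spanned by $\Delta$ and $X_G$. It is a (not necessarily Hausdorff) five-manifold whose charts are the local homeomorphisms $e$ from $\mathcal N$ to $\mathbb R^5$ such that $N'\mathcal M\to\mathcal N$ followed by $e$ is a smooth submersion. The contact plane at $\gamma\in\mathcal N$ is the image in $T_\gamma\mathcal N$ of the kernel of $\theta$ on $T(N'\mathcal M)$. Let $S$ be a smooth two-manifold and let $\sigma:S\to\mathcal N$ be a smooth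 map, that is, a smooth two-parameter family of null geodesics. Then the following are equivalent. (i) $\sigma$ is an (immersed) Legendre submanifold of $\mathcal N$: it is an immersion, and $d\sigma(T_sS)$ lies in the contact plane at $\sigma(s)$ for every $s\in S$. (ii) The family forms a wave-front: every $s_0\in S$ has an open neighbourhood $U\subseteq S$ over which the family is one of the two (outgoing or ingoing) null congruences of a smooth spacelike two-surface. That is, there are a smooth immersion $f:U\to\mathcal M$ with positive definite induced metric and a smooth choice of a future-pointing null covector $k(u)$ at $f(u)$, with $k(u)^\sharp$ orthogonal to $df(T_uU)$, such that $\sigma(u)$ is the null geodesic through $f(u)$ with cotangent $k(u)$, for all $u\in U$. -/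

import Mathlib

open Set Filter Topology Bundle Manifold
open scoped ContDiff

noncomputable section

/-- The model space of a four-dimensional manifold. -/
abbrev E4 : Type := EuclideanSpace ℝ (Fin 4)

/-- The model space of the (five-dimensional) space of null geodesics. -/
abbrev E5 : Type := EuclideanSpace ℝ (Fin 5)

/-- The cotangent bundle `T*M` of a four-manifold, with its standard bundle topology and charts. -/
abbrev CotangentBundle (M : Type*) [TopologicalSpace M] [ChartedSpace E4 M]
    [IsManifold 𝓘(ℝ, E4) ∞ M] : Type _ :=
  TotalSpace (E4 →L[ℝ] ℝ) (fun x : M => TangentSpace 𝓘(ℝ, E4) x →L[ℝ] Bundle.Trivial M ℝ x)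

/-- The model with corners of `T*M`: coordinates `(x, p)` in `ℝ⁴ × (ℝ⁴)*`. -/
abbrev cotangentModel : ModelWithCorners ℝ (E4 × (E4 →L[ℝ] ℝ)) (ModelProd E4 (E4 →L[ℝ] ℝ)) :=
  𝓘(ℝ, E4).prod 𝓘(ℝ, E4 →L[ℝ] ℝ)

/-- A smooth Lorentz metric (signature `(-,+,+,+)`) on a four-manifold together with a time
orientation, given by a continuous timelike vector field. -/
structure SpaceTime (M : Type*) [TopologicalSpace M] [ChartedSpace E4 M]
    [IsManifold 𝓘(ℝ, E4) ∞ M] where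
  /-- the metric tensor -/
  g : (x : M) → TangentSpace 𝓘(ℝ, E4) x →L[ℝ] TangentSpace 𝓘(ℝ, E4) x →L[ℝ] ℝ
  smooth : ContMDiff 𝓘(ℝ, E4) (𝓘(ℝ, E4).prod 𝓘(ℝ, E4 →L[ℝ] E4 →L[ℝ] ℝ)) ∞
    (fun x => TotalSpace.mk' (E4 →L[ℝ] E4 →L[ℝ] ℝ)
      (E := fun x : M => TangentSpace 𝓘(ℝ, E4) x →L[ℝ] TangentSpace 𝓘(ℝ, E4) x →L[ℝ] ℝ) x (g x))
  symm : ∀ x v w, g x v w = g x w v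
  /-- the vector field that gives the time orientation -/
  T : (x : M) → TangentSpace 𝓘(ℝ, E4) x
  continuous_T : Continuous (fun x => (⟨x, T x⟩ : TangentBundle 𝓘(ℝ, E4) M))
  timelike_T : ∀ x, g x (T x) (T x) < 0
  lorentzian : ∀ x v, g x (T x) v = 0 → v ≠ 0 → 0 < g x v v

namespace SpaceTime

variable {M : Type*} [TopologicalSpace M] [ChartedSpace E4 M] [IsManifold 𝓘(ℝ, E4) ∞ M]
  (𝓜 : SpaceTime M)

/-! ### Causality -/

/-- `v` is a future-pointing causal (timelike or null) tangent vector. -/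
def FutureCausal (x : M) (v : TangentSpace 𝓘(ℝ, E4) x) : Prop :=
  𝓜.g x v v ≤ 0 ∧ 𝓜.g x v (𝓜.T x) < 0

/-- `x` and `y` are joined by a `C¹` future-pointing causal curve. -/
def CausalArc (x y : M) : Prop :=
  ∃ (c : ℝ → M) (a b : ℝ), a < b ∧ c a = x ∧ c b = y ∧
    ContMDiffOn 𝓘(ℝ, ℝ) 𝓘(ℝ, E4) 1 c (Icc a b) ∧
    ∀ t ∈ Icc a b,
      𝓜.FutureCausal (c t) (mfderivWithin 𝓘(ℝ, ℝ) 𝓘(ℝ, E4) c (Icc a b) t (1 : ℝ))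

/-- `x ≤ y`: either `x = y` or there is a piecewise `C¹` future-pointing causal curve
from `x` to `y`. -/
def CausallyPrecedes : M → M → Prop := Relation.ReflTransGen 𝓜.CausalArc

/-- Strong causality: every neighbourhood `U` of a point contains a neighbourhood `V` of it such
that causal curves which start and end in `V` stay in `U`. (The points `z` on piecewise `C¹` causal
curves from `x` to `y` are exactly those with `x ≤ z ≤ y`.) -/
def StronglyCausal : Prop :=
  ∀ q : M, ∀ U ∈ 𝓝 q, ∃ V ∈ 𝓝 q, V ⊆ U ∧
    ∀ x ∈ V, ∀ y ∈ V, ∀ z, 𝓜.CausallyPrecedes x z → 𝓜.CausallyPrecedes z y → z ∈ U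

/-! ### The geometry of the cotangent bundle -/

/-- The vector `p^a = g^{ab} p_b`: the image of `p` under the inverse of the linear map
`v ↦ g(v, ·)`, which is invertible (`g_sharp` below). -/
def sharp (x : M) (p : TangentSpace 𝓘(ℝ, E4) x →L[ℝ] ℝ) : TangentSpace 𝓘(ℝ, E4) x :=
  ContinuousLinearMap.inverse (𝓜.g x) p

/-- `g(p^♯, v) = p(v)`. -/
theorem g_sharp (x : M) (p : TangentSpace 𝓘(ℝ, E4) x →L[ℝ] ℝ) : 𝓜.g x (𝓜.sharp x p) = p := by
  have hinj : ∀ v : TangentSpace 𝓘(ℝ, E4) x, 𝓜.g x v = 0 → v = 0 := by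
    intro v hv
    by_contra hne
    have h1 : 𝓜.g x (𝓜.T x) v = 0 := by
      rw [𝓜.symm, hv]; rfl
    have h2 := 𝓜.lorentzian x v h1 hne
    rw [hv] at h2
    exact lt_irrefl _ h2
  let A : E4 →L[ℝ] (E4 →L[ℝ] ℝ) := 𝓜.g x
  have hA : Function.Injective A.toLinearMap :=
    (injective_iff_map_eq_zero A.toLinearMap).2 hinj
  have hdim : Module.finrank ℝ E4 = Module.finrank ℝ (E4 →L[ℝ] ℝ) := by
    rw [← (LinearMap.toContinuousLinearMap (𝕜 := ℝ) (E := E4) (F' := ℝ)).finrank_eq]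
    exact Subspace.dual_finrank_eq.symm
  let B : E4 ≃L[ℝ] (E4 →L[ℝ] ℝ) :=
    (LinearEquiv.ofInjectiveOfFinrankEq A.toLinearMap hA hdim).toContinuousLinearEquiv
  have hB : (B : E4 →L[ℝ] (E4 →L[ℝ] ℝ)) = A := by
    ext v; rfl
  change A (ContinuousLinearMap.inverse A p) = p
  rw [← hB, ContinuousLinearMap.inverse_equiv]
  exact B.apply_symm_apply p

/-- The Hamiltonian `H(x, p) = ½ g^{ab} p_a p_b = ½ p^a p_a`. -/
def hamiltonian (ξ : CotangentBundle M) : ℝ := (1 / 2) * ξ.2 (𝓜.sharp ξ.1 ξ.2)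

/-- The differential `dH`. -/
def dH (ξ : CotangentBundle M) : TangentSpace cotangentModel ξ →L[ℝ] ℝ :=
  mfderiv cotangentModel 𝓘(ℝ, ℝ) 𝓜.hamiltonian ξ

/-- The canonical one-form `θ = p_a dx^a`, i.e. `θ_ξ(X) = ξ(dπ X)` with `π : T*M → M`. -/
def canonicalForm (ξ : CotangentBundle M) (X : TangentSpace cotangentModel ξ) : ℝ :=
  ξ.2 (mfderiv cotangentModel 𝓘(ℝ, E4)
    (fun η : CotangentBundle M => η.1) ξ X)

/-- In the chart centred at `ξ = (x, p)`, `θ_ξ(ẋ, ṗ) = p(ẋ)`. -/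
theorem canonicalForm_apply (ξ : CotangentBundle M) (u : E4) (α : E4 →L[ℝ] ℝ) :
    canonicalForm ξ (show E4 × (E4 →L[ℝ] ℝ) from (u, α)) = ξ.2 u := by
  have h : HasMFDerivAt cotangentModel 𝓘(ℝ, E4) (fun η : CotangentBundle M => η.1) ξ
      (ContinuousLinearMap.fst ℝ E4 (E4 →L[ℝ] ℝ)) := by
    refine ⟨(FiberBundle.continuous_proj _ _).continuousAt, ?_⟩
    have h := (hasFDerivAt_fst (𝕜 := ℝ) (p := extChartAt cotangentModel ξ ξ)).hasFDerivWithinAt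
      (s := range cotangentModel)
    have h3 : ∀ η : CotangentBundle M,
        (extChartAt cotangentModel ξ η).1 = extChartAt 𝓘(ℝ, E4) ξ.1 η.1 := by
      intro η; simp [extChartAt, hom_chart]
    have h4 : ∀ y ∈ (extChartAt cotangentModel ξ).target,
        writtenInExtChartAt cotangentModel 𝓘(ℝ, E4) ξ (fun η : CotangentBundle M => η.1) y
          = y.1 := by
      intro y hy
      have h2 := (extChartAt cotangentModel ξ).right_inv hy
      simp only [writtenInExtChartAt, Function.comp]
      rw [← h3, h2]
    refine h.congr_of_eventuallyEq ?_ (h4 _ (mem_extChartAt_target ξ))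
    filter_upwards [extChartAt_target_mem_nhdsWithin (I := cotangentModel) ξ] with y hy
    exact h4 y hy
  unfold canonicalForm
  rw [h.mfderiv]
  rfl

/-- The symplectic form `ω = dθ = dp_a ∧ dx^a`. A tangent vector `X` at `ξ` is given by its
components `(X.1, X.2) = (ẋ, ṗ)` in the chart of `T*M` centred at `ξ`, which is the canonical chart
`(x^a, p_a)` induced by a chart of `M`. -/
def symplecticForm (ξ : CotangentBundle M) (X Y : TangentSpace cotangentModel ξ) : ℝ :=
  letI X' : E4 × (E4 →L[ℝ] ℝ) := X
  letI Y' : E4 × (E4 →L[ℝ] ℝ) := Y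
  X'.2 Y'.1 - Y'.2 X'.1

/-- The geodesic spray `X_G = ∂H/∂p_a ∂/∂x^a - ∂H/∂x^a ∂/∂p_a`, in the components of the chart of
`T*M` centred at `ξ`. It is the solution of `X_G ⌟ ω + dH = 0` (`geodesicSpray_spec` below). -/
def geodesicSpray (ξ : CotangentBundle M) : TangentSpace cotangentModel ξ :=
  letI D : E4 × (E4 →L[ℝ] ℝ) →L[ℝ] ℝ := 𝓜.dH ξ
  letI X : E4 × (E4 →L[ℝ] ℝ) :=
    (∑ a, D (0, EuclideanSpace.proj a) • EuclideanSpace.single a (1 : ℝ),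
      -(D.comp (ContinuousLinearMap.inl ℝ E4 (E4 →L[ℝ] ℝ))))
  X

/-- `X_G ⌟ ω + dH = 0`. -/
theorem geodesicSpray_spec (ξ : CotangentBundle M) (Y : TangentSpace cotangentModel ξ) :
    symplecticForm ξ (𝓜.geodesicSpray ξ) Y + 𝓜.dH ξ Y = 0 := by
  obtain ⟨v, β⟩ : E4 × (E4 →L[ℝ] ℝ) := Y
  have key : ∀ D : E4 × (E4 →L[ℝ] ℝ) →L[ℝ] ℝ,
      (-(D.comp (ContinuousLinearMap.inl ℝ E4 (E4 →L[ℝ] ℝ)))) v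
        - β (∑ a, D (0, EuclideanSpace.proj a) • EuclideanSpace.single a (1 : ℝ)) + D (v, β) = 0 := by
    intro D
    have hβ : β = ∑ a, β (EuclideanSpace.single a (1 : ℝ)) •
        (EuclideanSpace.proj a : E4 →L[ℝ] ℝ) := by
      ext w
      have hw : w = ∑ a, w a • EuclideanSpace.single a (1 : ℝ) := by
        ext i
        simp [Finset.sum_apply, Pi.single_apply]
      conv_lhs => rw [hw]
      simp [mul_comm]
    have h2 : D (v, β) = D (v, 0) + D (0, β) := by
      rw [← map_add]; simp
    have h3 : D (0, β) = ∑ a, β (EuclideanSpace.single a (1 : ℝ)) *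
        D (0, EuclideanSpace.proj a) := by
      have : ((0 : E4), β) = ∑ a, β (EuclideanSpace.single a (1 : ℝ)) •
          ((0 : E4), (EuclideanSpace.proj a : E4 →L[ℝ] ℝ)) := by
        refine Prod.ext ?_ ?_
        · simp [Prod.fst_sum]
        · simpa [Prod.snd_sum] using hβ
      rw [this, map_sum]
      exact Finset.sum_congr rfl fun a _ => by rw [map_smul, smul_eq_mul]
    rw [h2, h3]
    simp [mul_comm]
  exact key (𝓜.dH ξ)

/-! ### The space of null geodesics -/

/-- `N'M`: the set of future-pointing null covectors. -/
def nullBundle : Set (CotangentBundle M) :=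
  {ξ | 𝓜.hamiltonian ξ = 0 ∧ 𝓜.FutureCausal ξ.1 (𝓜.sharp ξ.1 ξ.2)}

/-- Two elements of `N'M` are joined by an orbit of the flow of the Euler field
`Δ = p_a ∂/∂p_a` (i.e. by a positive rescaling in the fibre), or by an integral curve of the
geodesic spray. -/
def JoinedByFlow (ξ η : 𝓜.nullBundle) : Prop :=
  (∃ c : ℝ, 0 < c ∧ (η : CotangentBundle M) = ⟨ξ.1.1, c • ξ.1.2⟩) ∨
  ∃ (γ : ℝ → CotangentBundle M) (a b : ℝ), a ≤ b ∧ γ a = ξ ∧ γ b = η ∧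
    IsMIntegralCurveOn (I := cotangentModel) γ 𝓜.geodesicSpray (Icc a b)

/-- The space `𝒩` of (unscaled) null geodesics: the quotient of `N'M` by the leaves of the
distribution spanned by the Euler field and the geodesic spray. -/
def NullGeodesics : Type _ := Quot 𝓜.JoinedByFlow

/-- `𝒩` carries the quotient topology. -/
instance : TopologicalSpace 𝓜.NullGeodesics :=
  inferInstanceAs (TopologicalSpace (Quot 𝓜.JoinedByFlow))

/-- The null geodesic with given initial covector: the projection `N'M → 𝒩`. -/
def toGeodesic (ξ : 𝓜.nullBundle) : 𝓜.NullGeodesics := Quot.mk _ ξ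

/-- The function `F` on `T*M` is smooth near `ξ` and represents there the map from `N'M` given by
the projection `N'M → 𝒩` followed by `e`. -/
def IsLocalRep (e : OpenPartialHomeomorph 𝓜.NullGeodesics E5) (ξ : 𝓜.nullBundle)
    (F : CotangentBundle M → E5) : Prop :=
  ∃ W : Set (CotangentBundle M), IsOpen W ∧ (ξ : CotangentBundle M) ∈ W ∧
    ContMDiffOn cotangentModel 𝓘(ℝ, E5) ∞ F W ∧
    ∀ η : 𝓜.nullBundle, (η : CotangentBundle M) ∈ W → F η = e (𝓜.toGeodesic η)

/-- The (maximal) smooth atlas of the quotient manifold `𝒩`: its charts are the local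
homeomorphisms `e` from `𝒩` to `ℝ⁵` for which `N'M → 𝒩` followed by `e` is a smooth submersion.
The tangent space of the hypersurface `N'M = {H = 0}` is the kernel of `dH`. -/
def atlas : Set (OpenPartialHomeomorph 𝓜.NullGeodesics E5) :=
  {e | ∀ ξ : 𝓜.nullBundle, 𝓜.toGeodesic ξ ∈ e.source →
    ∃ F : CotangentBundle M → E5, 𝓜.IsLocalRep e ξ F ∧
      ∀ w : E5, ∃ X : TangentSpace cotangentModel (ξ : CotangentBundle M),
        𝓜.dH ξ X = 0 ∧ mfderiv cotangentModel 𝓘(ℝ, E5) F ξ X = w}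

/-- The contact plane of `𝒩` at `γ`, read in the chart `e`: the projection to `T_γ 𝒩` of the
kernel of `θ` on `T(N'M)`, i.e. the plane on which `[θ]` vanishes. -/
def contactPlane (e : OpenPartialHomeomorph 𝓜.NullGeodesics E5) (γ : 𝓜.NullGeodesics) : Set E5 :=
  {w | ∃ (ξ : 𝓜.nullBundle) (F : CotangentBundle M → E5)
      (X : TangentSpace cotangentModel (ξ : CotangentBundle M)),
    𝓜.toGeodesic ξ = γ ∧ 𝓜.IsLocalRep e ξ F ∧ 𝓜.dH ξ X = 0 ∧
      canonicalForm (ξ : CotangentBundle M) X = 0 ∧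
      mfderiv cotangentModel 𝓘(ℝ, E5) F ξ X = w}

/-! ### Two-parameter families of null geodesics -/

variable {S : Type*} [TopologicalSpace S] [ChartedSpace (EuclideanSpace ℝ (Fin 2)) S]

/-- `σ : S → 𝒩` is a smooth map from the two-manifold `S` to the manifold `𝒩`. -/
def IsSmoothFamily (σ : S → 𝓜.NullGeodesics) : Prop :=
  Continuous σ ∧ ∀ s : S, ∃ e ∈ 𝓜.atlas, σ s ∈ e.source ∧
    ContMDiffAt (𝓡 2) 𝓘(ℝ, E5) ∞ (fun s' => e (σ s')) s

/-- `σ : S → 𝒩` is an immersed Legendre submanifold: a smooth immersion of a two-manifold in the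
five-dimensional `𝒩` whose tangent planes lie in the contact planes. -/
def IsLegendre (σ : S → 𝓜.NullGeodesics) : Prop :=
  𝓜.IsSmoothFamily σ ∧ ∀ s : S, ∀ e ∈ 𝓜.atlas, σ s ∈ e.source →
    Function.Injective (mfderiv (𝓡 2) 𝓘(ℝ, E5) (fun s' => e (σ s')) s) ∧
    ∀ v : TangentSpace (𝓡 2) s,
      mfderiv (𝓡 2) 𝓘(ℝ, E5) (fun s' => e (σ s')) s v ∈ 𝓜.contactPlane e (σ s)

/-- Over the open set `U ⊆ S`, the family `σ` is one of the two null congruences of a spacelike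
two-surface: `k` is a smooth future-pointing null covector field along the surface
`f = (u ↦ (k u).1) : U → M`, the surface is spacelike (the induced metric is positive definite, so
that `f` is an immersion), the null vector `k^♯` is normal to it, and `σ u` is the null geodesic
through `f u` with cotangent `k u`. -/
def IsNullCongruenceOn (σ : S → 𝓜.NullGeodesics) (U : Set S) (k : S → CotangentBundle M) : Prop :=
  ContMDiffOn (𝓡 2) cotangentModel ∞ k U ∧
  ∀ u ∈ U,
    (∀ v : TangentSpace (𝓡 2) u, v ≠ 0 →
      0 < 𝓜.g (k u).1 (mfderiv (𝓡 2) 𝓘(ℝ, E4) (fun u' => (k u').1) u v)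
        (mfderiv (𝓡 2) 𝓘(ℝ, E4) (fun u' => (k u').1) u v)) ∧
    (∀ v : TangentSpace (𝓡 2) u,
      𝓜.g (k u).1 (𝓜.sharp (k u).1 (k u).2)
        (mfderiv (𝓡 2) 𝓘(ℝ, E4) (fun u' => (k u').1) u v) = 0) ∧
    ∃ hu : k u ∈ 𝓜.nullBundle, 𝓜.toGeodesic ⟨k u, hu⟩ = σ u

/-- The family `σ` forms a wave-front: every member of the family has a neighbourhood in the family
which is one of the two null congruences orthogonal to some smooth spacelike two-surface. -/
def IsWaveFront (σ : S → 𝓜.NullGeodesics) : Prop :=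
  ∀ s : S, ∃ U : Set S, IsOpen U ∧ s ∈ U ∧
    ∃ k : S → CotangentBundle M, 𝓜.IsNullCongruenceOn σ U k

end SpaceTime

end

/-! The equivalence is local and symplectic. On `{H = 0}` the form `θ` kills the spray `X_G` and the
Euler field `Δ`, and `ω(a X_G + b Δ, ·) = b θ` on vectors tangent to `{H = 0}`. Hence along a leaf
`θ` only changes by a factor, and its kernel descends to a well-defined contact plane
(`LeafChart.fderiv_canonical`, `canonicalForm_eq_zero_of_mem_contactPlane`). If `k` lifts the family
to `N'M` and `f` is its projection to spacetime, then `θ(dk v) = g(k^♯, df v)`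
(`canonicalForm_mfderiv`), so being tangent to the contact planes means exactly that `k^♯` is normal
to `df`.

From a wave-front to a Legendre map, only the immersion property needs an argument. If `dσ v = 0`,
then `dk v` is a combination of `X_G` and `Δ` (`exists_mfderiv_proj_eq`), so `df v` is a multiple of
the null vector `k^♯`; a positive definite induced metric then forces `v = 0`.

Conversely, a Legendre family is lifted to covectors `q(v, t)`, where `t` moves the point along the
geodesics (`LeafChart.sweep`). At each fixed `t` the projected map has image orthogonal to the null
vector, so the induced metric is positive semidefinite, and it degenerates only where `df v = c
k^♯`, at a focal point. Such points can occur at `t = 0`, for instance when all the geodesics pass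
through one event, but they are isolated (`IsNullModel.eventually_nonfocal`). Suppose they
accumulate at `t = 0`. A limit of unit vectors gives `v ≠ 0` with `dq v - c X_G = (0, β)` vertical.
Isotropy of the family makes `β` vanish on the image of `df`, and tangency to `{H = 0}` makes it
vanish on `k^♯`. Differentiating the focal relation in `t` then gives `g^{-1}(β, β) = 0`. A null
covector orthogonal to the null covector `p` is a multiple of `p`, so `dq v` lies along the leaf,
which contradicts the immersion. Non-focality is an open condition, so one small `t ≠ 0` serves a
whole neighbourhood in the family. -/

noncomputable section

/-! ### Local symplectic geometry of `E × E*` -/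

section PhaseSpace

variable {E V W N : Type*} [NormedAddCommGroup E] [NormedSpace ℝ E]
  [NormedAddCommGroup V] [NormedSpace ℝ V] [NormedAddCommGroup W] [NormedSpace ℝ W]
  [NormedAddCommGroup N] [NormedSpace ℝ N]

/-- The standard symplectic form on `E × E*`. -/
def phaseForm (X Y : E × (E →L[ℝ] ℝ)) : ℝ := X.2 Y.1 - Y.2 X.1

set_option synthInstance.maxHeartbeats 200000 in
-- The product rule for the pull-back of `θ` along `Q`. The second-derivative term is symmetric in
-- `X` and `Y`, so antisymmetrizing leaves the pull-back of `ω`.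
theorem hasFDerivAt_canonical {Q : V → E × (E →L[ℝ] ℝ)} {z : V} (hQ : ContDiffAt ℝ 2 Q z) (Y : V) :
    ∃ L : V →L[ℝ] ℝ, HasFDerivAt (fun z => (Q z).2 (fderiv ℝ Q z Y).1) L z ∧
      ∀ X, L X = (fderiv ℝ Q z X).2 (fderiv ℝ Q z Y).1
        + (Q z).2 (fderiv ℝ (fderiv ℝ Q) z X Y).1 := by
  have h1 : HasFDerivAt Q (fderiv ℝ Q z) z :=
    (hQ.differentiableAt (by norm_num)).hasFDerivAt
  have h2 : HasFDerivAt (fderiv ℝ Q) (fderiv ℝ (fderiv ℝ Q) z) z :=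
    ((hQ.fderiv_right (m := 1) (by norm_num)).differentiableAt (by norm_num)).hasFDerivAt
  have h3 := h1.snd.clm_apply (h2.clm_apply (hasFDerivAt_const Y z)).fst
  refine ⟨_, h3, fun X => ?_⟩
  simp [add_comm]

/-- The pull-back of `dθ = ω`, evaluated on constant vector fields. -/
theorem fderiv_canonical_sub {Q : V → E × (E →L[ℝ] ℝ)} {z : V} (hQ : ContDiffAt ℝ 2 Q z) (X Y : V) :
    fderiv ℝ (fun z => (Q z).2 (fderiv ℝ Q z Y).1) z X
      - fderiv ℝ (fun z => (Q z).2 (fderiv ℝ Q z X).1) z Y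
      = phaseForm (fderiv ℝ Q z X) (fderiv ℝ Q z Y) := by
  obtain ⟨L, hL, hL'⟩ := hasFDerivAt_canonical hQ Y
  obtain ⟨L2, hL2, hL2'⟩ := hasFDerivAt_canonical hQ X
  have hs := (hQ.isSymmSndFDerivAt (by simp)).eq X Y
  rw [hL.fderiv, hL2.fderiv, hL', hL2', hs, phaseForm]
  ring

/-- A map that preserves the canonical one-form is symplectic. -/
theorem phaseForm_fderiv_of_canonical {τ : E × (E →L[ℝ] ℝ) → E × (E →L[ℝ] ℝ)}
    {y : E × (E →L[ℝ] ℝ)} (hτ : ContDiffAt ℝ 2 τ y)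
    (h : ∀ᶠ z in 𝓝 y, ∀ Z, (τ z).2 (fderiv ℝ τ z Z).1 = z.2 Z.1) (X Y : E × (E →L[ℝ] ℝ)) :
    phaseForm (fderiv ℝ τ y X) (fderiv ℝ τ y Y) = phaseForm X Y := by
  have key : ∀ Z X : E × (E →L[ℝ] ℝ),
      fderiv ℝ (fun z => (τ z).2 (fderiv ℝ τ z Z).1) y X = X.2 Z.1 := by
    intro Z X
    have h1 : (fun z => (τ z).2 (fderiv ℝ τ z Z).1) =ᶠ[𝓝 y] fun z => z.2 Z.1 := by
      filter_upwards [h] with z hz using hz Z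
    rw [h1.fderiv_eq]
    have h2 : HasFDerivAt (fun z : E × (E →L[ℝ] ℝ) => z.2 Z.1) _ y :=
      hasFDerivAt_snd.clm_apply (hasFDerivAt_const Z.1 y)
    rw [h2.fderiv]; simp
  rw [← fderiv_canonical_sub hτ, key, key, phaseForm]

theorem phaseForm_injective {X X' : E × (E →L[ℝ] ℝ)} (h : ∀ Y, phaseForm X Y = phaseForm X' Y)
    : X = X' := by
  have h1 : X.2 = X'.2 := by
    ext v; simpa [phaseForm] using h (v, 0)
  refine Prod.ext ?_ h1
  by_contra hne
  obtain ⟨β, hβ⟩ := SeparatingDual.exists_ne_zero (R := ℝ) (sub_ne_zero.2 hne)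
  have := h (0, β)
  simp only [phaseForm, map_zero, zero_sub, neg_inj] at this
  exact hβ (by rw [map_sub, this, sub_self])

/-! ### Straightening a submersion -/

/-- The inverse function theorem applied to `Γ` completed by a projection onto the kernel of its
derivative at `y₀`. The complementary coordinate is linear, so its derivative is itself. -/
theorem exists_straightening [FiniteDimensional ℝ V] [FiniteDimensional ℝ N] {Γ : V → N}
    {Ω : Set V} (hΩ : IsOpen Ω) (hΓ : ContDiffOn ℝ ∞ Γ Ω) {y₀ : V} (hy₀ : y₀ ∈ Ω)
    (hsurj : Function.Surjective (fderiv ℝ Γ y₀)) :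
    ∃ (K : Submodule ℝ V) (pr : V →L[ℝ] K) (R : OpenPartialHomeomorph V (N × K)),
      y₀ ∈ R.source ∧ R.source ⊆ Ω ∧ (∀ y, R y = (Γ y, pr y)) ∧
      ContDiffOn ℝ ∞ R.symm R.target := by
  have : CompleteSpace V := FiniteDimensional.complete ℝ V
  set L := fderiv ℝ Γ y₀ with hL
  obtain ⟨pr, hpr⟩ := Submodule.ClosedComplemented.of_finiteDimensional L.ker
  let K := L.ker
  have : CompleteSpace (N × K) := FiniteDimensional.complete ℝ _
  let R₀ : V → N × K := fun y => (Γ y, pr y)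
  have hR₀ : ContDiffOn ℝ ∞ R₀ Ω := hΓ.prodMk pr.contDiff.contDiffOn
  have hder : ∀ y ∈ Ω, HasFDerivAt R₀ ((fderiv ℝ Γ y).prod pr) y := fun y hy =>
    ((hΓ.contDiffAt (hΩ.mem_nhds hy)).differentiableAt (by simp)).hasFDerivAt.prodMk
      pr.hasFDerivAt
  have hprs : Function.Surjective pr := fun k => ⟨k, hpr k⟩
  let f' : V ≃L[ℝ] N × K := L.equivProdOfSurjectiveOfIsCompl pr
    (LinearMap.range_eq_top.2 hsurj) (LinearMap.range_eq_top.2 hprs)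
    (by
      have := LinearMap.isCompl_of_proj (f := (pr : V →ₗ[ℝ] K)) hpr
      exact this)
  have hf' : (f' : V →L[ℝ] N × K) = L.prod pr := by ext v <;> rfl
  have hat : ContDiffAt ℝ ∞ R₀ y₀ := hR₀.contDiffAt (hΩ.mem_nhds hy₀)
  have hf'd : HasFDerivAt R₀ (f' : V →L[ℝ] N × K) y₀ := by rw [hf']; exact hder y₀ hy₀
  let R₁ := hat.toOpenPartialHomeomorph R₀ hf'd (by simp)
  have hcont : ContinuousAt (fun y => (fderiv ℝ Γ y).prod pr) y₀ := by
    have h1 : ContinuousAt (fderiv ℝ R₀) y₀ :=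
      (hR₀.continuousOn_fderiv_of_isOpen hΩ (by simp)).continuousAt (hΩ.mem_nhds hy₀)
    refine h1.congr ?_
    filter_upwards [hΩ.mem_nhds hy₀] with y hy using (hder y hy).fderiv
  -- The inverse is smooth wherever the derivative is invertible. This is an open condition, so
  -- shrinking the source makes the inverse smooth on the whole target.
  have hev : ∀ᶠ y in 𝓝 y₀, y ∈ Ω ∧ (fderiv ℝ Γ y).prod pr ∈
      range (ContinuousLinearEquiv.toContinuousLinearMap : (V ≃L[ℝ] N × K) → _) := by
    refine Filter.Eventually.and (hΩ.mem_nhds hy₀) (hcont ?_)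
    have := f'.nhds
    rwa [hf'] at this
  obtain ⟨O, hO, hOo, hyO⟩ := mem_nhds_iff.1 hev
  refine ⟨K, pr, R₁.restrOpen O hOo, ⟨hat.mem_toOpenPartialHomeomorph_source hf'd (by simp), hyO⟩,
    fun y hy => (hO hy.2).1, fun y => rfl, fun z hz => ?_⟩
  have hz' : (R₁.restrOpen O hOo).symm z ∈ (R₁.restrOpen O hOo).source :=
    (R₁.restrOpen O hOo).map_target hz
  obtain ⟨hΩz, g, hg⟩ := hO hz'.2
  refine (OpenPartialHomeomorph.contDiffAt_symm _ (f₀' := g) hz ?_ ?_).contDiffWithinAt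
  · have h := hder _ hΩz
    rw [← hg] at h
    exact h
  · exact hR₀.contDiffAt (hΩ.mem_nhds hΩz)

/-- The consequences of a straightening for derivatives. -/
theorem fderiv_straightening {Γ : V → N} {K : Submodule ℝ V} {pr : V →L[ℝ] K}
    {R : OpenPartialHomeomorph V (N × K)} (hR : ∀ y, R y = (Γ y, pr y))
    (hs : ContDiffOn ℝ ∞ R.symm R.target) {y : V} (hy : y ∈ R.source)
    (hΓ : DifferentiableAt ℝ Γ y) :
    (∀ n, fderiv ℝ Γ y (fderiv ℝ R.symm (R y) n) = n.1) ∧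
    (∀ n, pr (fderiv ℝ R.symm (R y) n) = n.2) ∧
    (∀ Y, fderiv ℝ R.symm (R y) (fderiv ℝ Γ y Y, pr Y) = Y) := by
  have hRy : R y ∈ R.target := R.map_source hy
  have hQ : HasFDerivAt R.symm (fderiv ℝ R.symm (R y)) (R y) :=
    ((hs.contDiffAt (R.open_target.mem_nhds hRy)).differentiableAt (by simp)).hasFDerivAt
  have hRd : HasFDerivAt R ((fderiv ℝ Γ y).prod pr) y := by
    have : (R : V → N × K) = fun y => (Γ y, pr y) := funext hR
    rw [this]
    exact hΓ.hasFDerivAt.prodMk pr.hasFDerivAt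
  have h1 : HasFDerivAt (fun z => R (R.symm z))
      (((fderiv ℝ Γ y).prod pr).comp (fderiv ℝ R.symm (R y))) (R y) := by
    refine HasFDerivAt.comp (R y) ?_ hQ
    rwa [R.left_inv hy]
  have h2 := h1.unique ((hasFDerivAt_id (R y)).congr_of_eventuallyEq
    (by filter_upwards [R.open_target.mem_nhds hRy] with z hz using R.right_inv hz))
  have h3 : HasFDerivAt (fun z => R.symm (R z)) _ y := hQ.comp y hRd
  have h4 := h3.unique ((hasFDerivAt_id y).congr_of_eventuallyEq
    (by filter_upwards [R.open_source.mem_nhds hy] with z hz using R.left_inv hz))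
  refine ⟨fun n => ?_, fun n => ?_, fun Y => ?_⟩
  · exact congrArg Prod.fst (DFunLike.congr_fun h2 n)
  · exact congrArg Prod.snd (DFunLike.congr_fun h2 n)
  · exact DFunLike.congr_fun h4 Y

end PhaseSpace

/-! ### Null Hamiltonian models -/

section NullModel

variable {E V W : Type*} [NormedAddCommGroup E] [NormedSpace ℝ E]
  [NormedAddCommGroup V] [NormedSpace ℝ V] [NormedAddCommGroup W] [NormedSpace ℝ W]

/-- The Hamiltonian vector field of `H`, when `P = ∂H/∂p`. -/
def phaseSpray (H : E × (E →L[ℝ] ℝ) → ℝ) (P : E × (E →L[ℝ] ℝ) → E) (y : E × (E →L[ℝ] ℝ)) :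
    E × (E →L[ℝ] ℝ) :=
  (P y, -((fderiv ℝ H y).comp (ContinuousLinearMap.inl ℝ E (E →L[ℝ] ℝ))))

/-- The Euler field on `E × E*`. -/
def phaseEuler (y : E × (E →L[ℝ] ℝ)) : E × (E →L[ℝ] ℝ) := (0, y.2)

/-- A Hamiltonian `H` on an open subset `Ω` of `E × E*`, with fibre derivative `P`, that has the
properties of the Hamiltonian of a Lorentz metric away from the zero section. -/
structure IsNullModel (Ω : Set (E × (E →L[ℝ] ℝ))) (H : E × (E →L[ℝ] ℝ) → ℝ)
    (P : E × (E →L[ℝ] ℝ) → E) : Prop where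
  isOpen : IsOpen Ω
  smooth_H : ContDiffOn ℝ ∞ H Ω
  smooth_P : ContDiffOn ℝ ∞ P Ω
  fderiv_vert : ∀ y ∈ Ω, ∀ β, fderiv ℝ H y (0, β) = β (P y)
  apply_P : ∀ y ∈ Ω, H y = 0 → y.2 (P y) = 0
  P_ne : ∀ y ∈ Ω, H y = 0 → P y ≠ 0
  snd_ne : ∀ y ∈ Ω, H y = 0 → y.2 ≠ 0
  vert : ∀ y ∈ Ω, H y = 0 → ∀ β : E →L[ℝ] ℝ, β (P y) = 0 → β (fderiv ℝ P y (0, β)) = 0 →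
    ∃ μ : ℝ, β = μ • y.2

/-- `F` is smooth and constant along the Euler and Hamiltonian fields on `{H = 0}`. -/
structure IsLeafFunction (Ω : Set (E × (E →L[ℝ] ℝ))) (H : E × (E →L[ℝ] ℝ) → ℝ)
    (P : E × (E →L[ℝ] ℝ) → E) (F : E × (E →L[ℝ] ℝ) → W) : Prop where
  smooth : ContDiffOn ℝ ∞ F Ω
  spray : ∀ y ∈ Ω, H y = 0 → fderiv ℝ F y (phaseSpray H P y) = 0
  euler : ∀ y ∈ Ω, H y = 0 → fderiv ℝ F y (phaseEuler y) = 0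

variable {Ω : Set (E × (E →L[ℝ] ℝ))} {H : E × (E →L[ℝ] ℝ) → ℝ} {P : E × (E →L[ℝ] ℝ) → E}
  {F : E × (E →L[ℝ] ℝ) → W} {y : E × (E →L[ℝ] ℝ)}

theorem phaseForm_phaseSpray (h : ∀ β, fderiv ℝ H y (0, β) = β (P y)) (Y : E × (E →L[ℝ] ℝ)) :
    phaseForm (phaseSpray H P y) Y = -fderiv ℝ H y Y := by
  have h1 : fderiv ℝ H y Y = fderiv ℝ H y (Y.1, 0) + fderiv ℝ H y (0, Y.2) := by
    rw [← map_add]; simp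
  rw [h1, h]
  simp [phaseForm, phaseSpray]
  ring

namespace IsNullModel

theorem mono (hM : IsNullModel Ω H P) {Ω' : Set (E × (E →L[ℝ] ℝ))} (h : Ω' ⊆ Ω)
    (ho : IsOpen Ω') : IsNullModel Ω' H P :=
  ⟨ho, hM.smooth_H.mono h, hM.smooth_P.mono h, fun y hy => hM.fderiv_vert y (h hy),
    fun y hy => hM.apply_P y (h hy), fun y hy => hM.P_ne y (h hy), fun y hy => hM.snd_ne y (h hy),
    fun y hy => hM.vert y (h hy)⟩

theorem differentiableAt_H (hM : IsNullModel Ω H P) (hy : y ∈ Ω) : DifferentiableAt ℝ H y :=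
  (hM.smooth_H.contDiffAt (hM.isOpen.mem_nhds hy)).differentiableAt (by simp)

theorem phaseForm_spray (hM : IsNullModel Ω H P) (hy : y ∈ Ω) (Y : E × (E →L[ℝ] ℝ)) :
    phaseForm (phaseSpray H P y) Y = -fderiv ℝ H y Y :=
  phaseForm_phaseSpray (hM.fderiv_vert y hy) Y

theorem phaseForm_euler (Y : E × (E →L[ℝ] ℝ)) : phaseForm (phaseEuler y) Y = y.2 Y.1 := by
  simp [phaseForm, phaseEuler]

theorem fderiv_spray (hM : IsNullModel Ω H P) (hy : y ∈ Ω) :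
    fderiv ℝ H y (phaseSpray H P y) = 0 := by
  have := hM.phaseForm_spray hy (phaseSpray H P y)
  rw [phaseForm, sub_self] at this
  linarith

theorem fderiv_euler (hM : IsNullModel Ω H P) (hy : y ∈ Ω) (h0 : H y = 0) :
    fderiv ℝ H y (phaseEuler y) = 0 := by
  rw [phaseEuler, hM.fderiv_vert y hy, hM.apply_P y hy h0]

theorem exists_fderiv_eq_one (hM : IsNullModel Ω H P) (hy : y ∈ Ω) (h0 : H y = 0) :
    ∃ β : E →L[ℝ] ℝ, fderiv ℝ H y (0, β) = 1 := by
  obtain ⟨β, hβ⟩ := SeparatingDual.exists_eq_one (R := ℝ) (hM.P_ne y hy h0)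
  exact ⟨β, by rw [hM.fderiv_vert y hy, hβ]⟩

/-- `θ` does not see vertical vectors, so a vector on which it is non-zero can be made tangent to
`{H = 0}` by a vertical correction. -/
theorem exists_canonical_ne_zero (hM : IsNullModel Ω H P) (hy : y ∈ Ω) (h0 : H y = 0) :
    ∃ Y, fderiv ℝ H y Y = 0 ∧ y.2 Y.1 ≠ 0 := by
  obtain ⟨β, hβ⟩ := hM.exists_fderiv_eq_one hy h0
  obtain ⟨u, hu⟩ := DFunLike.ne_iff.1 (hM.snd_ne y hy h0)
  refine ⟨(u, 0) - fderiv ℝ H y (u, 0) • (0, β), ?_, ?_⟩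
  · rw [map_sub, map_smul, hβ]; simp
  · simpa using hu

theorem surjective_prod (hM : IsNullModel Ω H P) (hy : y ∈ Ω) (h0 : H y = 0)
    {A : E × (E →L[ℝ] ℝ) →L[ℝ] W} (hs : ∀ w, ∃ X, fderiv ℝ H y X = 0 ∧ A X = w) :
    Function.Surjective (A.prod (fderiv ℝ H y)) := by
  rintro ⟨w, s⟩
  obtain ⟨β, hβ⟩ := hM.exists_fderiv_eq_one hy h0
  obtain ⟨X, hX, hX'⟩ := hs (w - s • A (0, β))
  refine ⟨X + s • (0, β), ?_⟩
  simp only [ContinuousLinearMap.prod_apply, map_add, map_smul, hX, hX', hβ]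
  simp

variable [FiniteDimensional ℝ E] [FiniteDimensional ℝ W]

/-- The kernel of the differential of a leaf function is spanned by the Euler and Hamiltonian
fields. -/
theorem exists_eq_add (hM : IsNullModel Ω H P) (hF : IsLeafFunction Ω H P F)
    (hdim : Module.finrank ℝ W + 3 = 2 * Module.finrank ℝ E) (hy : y ∈ Ω) (h0 : H y = 0)
    (hs : Function.Surjective ((fderiv ℝ F y).prod (fderiv ℝ H y))) {Y : E × (E →L[ℝ] ℝ)}
    (hFY : fderiv ℝ F y Y = 0) (hHY : fderiv ℝ H y Y = 0) :
    ∃ a b : ℝ, Y = a • phaseSpray H P y + b • phaseEuler y := by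
  set A := (fderiv ℝ F y).prod (fderiv ℝ H y) with hA
  have hE : Module.finrank ℝ (E →L[ℝ] ℝ) = Module.finrank ℝ E := by
    rw [← (LinearMap.toContinuousLinearMap (𝕜 := ℝ) (E := E) (F' := ℝ)).finrank_eq]
    exact Subspace.dual_finrank_eq
  have h1 := LinearMap.finrank_range_add_finrank_ker (A : E × (E →L[ℝ] ℝ) →ₗ[ℝ] W × ℝ)
  have hr : LinearMap.range (A : E × (E →L[ℝ] ℝ) →ₗ[ℝ] W × ℝ) = ⊤ := LinearMap.range_eq_top.2 hs
  rw [hr, finrank_top, Module.finrank_prod, Module.finrank_prod, hE, Module.finrank_self] at h1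
  -- `A` is onto a space of dimension `dim W + 1 = 2 dim E - 2`, so its kernel is a plane; the two
  -- independent leaf fields lie in it and hence span it.
  have hk : Module.finrank ℝ (LinearMap.ker (A : E × (E →L[ℝ] ℝ) →ₗ[ℝ] W × ℝ)) = 2 := by omega
  have hli : LinearIndependent ℝ ![phaseSpray H P y, phaseEuler y] := by
    rw [LinearIndependent.pair_iff]
    intro s t hst
    have hs0 : s = 0 := by
      have := congrArg Prod.fst hst
      simpa [phaseSpray, phaseEuler, hM.P_ne y hy h0] using this
    have := congrArg Prod.snd hst
    refine ⟨hs0, ?_⟩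
    simpa [hs0, phaseEuler, hM.snd_ne y hy h0] using this
  have hle : Submodule.span ℝ (range ![phaseSpray H P y, phaseEuler y])
      ≤ LinearMap.ker (A : E × (E →L[ℝ] ℝ) →ₗ[ℝ] W × ℝ) := by
    rw [Submodule.span_le]
    rintro _ ⟨i, rfl⟩
    fin_cases i
    · simp [hA, hF.spray y hy h0, hM.fderiv_spray hy]
    · simp [hA, hF.euler y hy h0, hM.fderiv_euler hy h0]
  have heq := Submodule.eq_of_le_of_finrank_eq hle (by
    rw [hk, finrank_span_eq_card hli]; simp)
  have hY : Y ∈ LinearMap.ker (A : E × (E →L[ℝ] ℝ) →ₗ[ℝ] W × ℝ) := by simp [hA, hFY, hHY]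
  rw [← heq, Matrix.range_cons, Matrix.range_cons, Matrix.range_empty, union_empty,
    singleton_union, Submodule.mem_span_pair] at hY
  obtain ⟨a, b, h⟩ := hY
  exact ⟨a, b, h.symm⟩

end IsNullModel

/-- Two functions that agree on `{H = 0}` have the same derivative along it. -/
theorem fderiv_eq_of_eq_on_level [FiniteDimensional ℝ V] {H : V → ℝ} {f g : V → W} {y : V}
    (hH : ContDiffAt ℝ ∞ H y) (hf : ContDiffAt ℝ ∞ f y) (hg : ContDiffAt ℝ ∞ g y) (h0 : H y = 0)
    (hne : fderiv ℝ H y ≠ 0) (hfg : ∀ᶠ z in 𝓝 y, H z = 0 → f z = g z) {Y : V}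
    (hY : fderiv ℝ H y Y = 0) : fderiv ℝ f y Y = fderiv ℝ g y Y := by
  have : CompleteSpace V := FiniteDimensional.complete ℝ V
  rw [← sub_eq_zero]
  by_contra hne'
  obtain ⟨ℓ, hℓ⟩ := SeparatingDual.exists_ne_zero (R := ℝ) hne'
  let φ : V → ℝ := fun z => ℓ (f z - g z)
  have hφ : HasStrictFDerivAt φ (ℓ.comp (fderiv ℝ f y - fderiv ℝ g y)) y :=
    ℓ.hasStrictFDerivAt.comp y
      ((hf.hasStrictFDerivAt (by simp)).sub (hg.hasStrictFDerivAt (by simp)))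
  -- The difference is zero on the level set, so `y` is trivially an extremum there, and Lagrange
  -- multipliers make its differential proportional to `dH`.
  have hext : IsLocalExtrOn φ {z | H z = H y} y := by
    refine Or.inl ?_
    refine eventually_nhdsWithin_iff.2 ?_
    have hy0 : φ y = 0 := by simp [φ, hfg.self_of_nhds h0]
    filter_upwards [hfg] with z hz hzy
    have : φ z = 0 := by simp [φ, hz (hzy.trans h0)]
    rw [hy0, this]
  obtain ⟨a, b, hab, h⟩ := hext.exists_multipliers_of_hasStrictFDerivAt_1d
    (hH.hasStrictFDerivAt (by simp)) hφ
  have h1 : a * fderiv ℝ H y Y + b * ℓ ((fderiv ℝ f y - fderiv ℝ g y) Y) = 0 :=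
    DFunLike.congr_fun h Y
  rw [hY, mul_zero, zero_add, mul_eq_zero] at h1
  rcases h1 with hb | hb
  · rw [hb, zero_smul, add_zero, smul_eq_zero] at h
    rcases h with ha | ha
    · exact hab (by rw [ha, hb]; rfl)
    · exact hne ha
  · exact hℓ (by simpa using hb)

/-! ### Charts adapted to the leaves -/

/-- `Q` parametrizes `{H = 0}` near a point by the value of the leaf function `F` and a coordinate
`pr` along the leaves. -/
structure LeafChart (Ω : Set (E × (E →L[ℝ] ℝ))) (H : E × (E →L[ℝ] ℝ) → ℝ)
    (P : E × (E →L[ℝ] ℝ) → E) (F : E × (E →L[ℝ] ℝ) → W)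
    (K : Type*) [NormedAddCommGroup K] [NormedSpace ℝ K] where
  pr : E × (E →L[ℝ] ℝ) →L[ℝ] K
  Q : W × K → E × (E →L[ℝ] ℝ)
  O : Set (W × K)
  Ω' : Set (E × (E →L[ℝ] ℝ))
  isOpen_O : IsOpen O
  isOpen_Ω' : IsOpen Ω'
  subset : Ω' ⊆ Ω
  smooth : ContDiffOn ℝ ∞ Q O
  Q_mem : ∀ z ∈ O, Q z ∈ Ω'
  H_Q : ∀ z ∈ O, H (Q z) = 0
  F_Q : ∀ z ∈ O, F (Q z) = z.1
  mem_O : ∀ y ∈ Ω', H y = 0 → (F y, pr y) ∈ O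
  Q_eq : ∀ y ∈ Ω', H y = 0 → Q (F y, pr y) = y
  fderiv_H : ∀ z ∈ O, ∀ n, fderiv ℝ H (Q z) (fderiv ℝ Q z n) = 0
  fderiv_F : ∀ z ∈ O, ∀ n, fderiv ℝ F (Q z) (fderiv ℝ Q z n) = n.1
  fderiv_leaf : ∀ z ∈ O, ∀ ρ, ∃ a b : ℝ,
    fderiv ℝ Q z (0, ρ) = a • phaseSpray H P (Q z) + b • phaseEuler (Q z)
  fderiv_Q : ∀ y ∈ Ω', H y = 0 → ∀ Y, fderiv ℝ H y Y = 0 →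
    fderiv ℝ Q (F y, pr y) (fderiv ℝ F y Y, pr Y) = Y

/-- Straighten the submersion `(F, H)` and freeze the `H`-coordinate at zero; `J` is the
corresponding inclusion. What remains of the complementary coordinate parametrizes the leaves,
because its directions are killed by both `dF` and `dH`. -/
theorem exists_leafChart [FiniteDimensional ℝ E] [FiniteDimensional ℝ W]
    (hM : IsNullModel Ω H P) (hF : IsLeafFunction Ω H P F)
    (hdim : Module.finrank ℝ W + 3 = 2 * Module.finrank ℝ E) (hy : y ∈ Ω) (h0 : H y = 0)
    (hs : ∀ w, ∃ X, fderiv ℝ H y X = 0 ∧ fderiv ℝ F y X = w) :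
    ∃ (K : Submodule ℝ (E × (E →L[ℝ] ℝ))) (C : LeafChart Ω H P F K), y ∈ C.Ω' := by
  let Γ : E × (E →L[ℝ] ℝ) → W × ℝ := fun y => (F y, H y)
  have hFd : ∀ z ∈ Ω, DifferentiableAt ℝ F z := fun z hz =>
    (hF.smooth.contDiffAt (hM.isOpen.mem_nhds hz)).differentiableAt (by simp)
  have hΓd : ∀ z ∈ Ω, HasFDerivAt Γ ((fderiv ℝ F z).prod (fderiv ℝ H z)) z := fun z hz =>
    (hFd z hz).hasFDerivAt.prodMk (hM.differentiableAt_H hz).hasFDerivAt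
  obtain ⟨K, pr, R, hyR, hRΩ, hR, hRs⟩ := exists_straightening (Γ := Γ) hM.isOpen
    (hF.smooth.prodMk hM.smooth_H) hy (by
      rw [(hΓd y hy).fderiv]; exact hM.surjective_prod hy h0 hs)
  let J : W × K →L[ℝ] (W × ℝ) × K :=
    (((ContinuousLinearMap.inl ℝ W ℝ).comp (ContinuousLinearMap.fst ℝ W K)).prod
      (ContinuousLinearMap.snd ℝ W K))
  have hJ : ∀ z, J z = ((z.1, 0), z.2) := fun z => rfl
  let O : Set (W × K) := J ⁻¹' R.target
  let Q : W × K → E × (E →L[ℝ] ℝ) := fun z => R.symm (J z)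
  have hQd : ∀ z ∈ O, ∀ n, fderiv ℝ Q z n = fderiv ℝ R.symm (J z) (J n) := by
    intro z hz n
    have h1 : HasFDerivAt R.symm (fderiv ℝ R.symm (J z)) (J z) :=
      ((hRs.contDiffAt (R.open_target.mem_nhds hz)).differentiableAt (by simp)).hasFDerivAt
    have h2 : HasFDerivAt Q _ z := h1.comp z J.hasFDerivAt
    rw [h2.fderiv]; rfl
  have hRQ : ∀ z ∈ O, ((F (Q z), H (Q z)), pr (Q z)) = ((z.1, (0:ℝ)), z.2) := by
    intro z hz
    rw [← hJ, ← R.right_inv hz]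
    exact (hR _).symm
  have hQsrc : ∀ z ∈ O, Q z ∈ R.source := fun z hz => R.map_target hz
  have hder : ∀ z ∈ O, (∀ n, fderiv ℝ Γ (Q z) (fderiv ℝ R.symm (J z) n) = n.1) := by
    intro z hz
    have := (fderiv_straightening hR hRs (hQsrc z hz)
      (hΓd _ (hRΩ (hQsrc z hz))).differentiableAt).1
    rwa [R.right_inv hz] at this
  have hJy : ∀ y ∈ R.source, H y = 0 → J (F y, pr y) = R y := by
    intro y _ h; rw [hR, hJ]; simp [Γ, h]
  have hFH : ∀ z ∈ O, ∀ n, fderiv ℝ F (Q z) (fderiv ℝ Q z n) = n.1 ∧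
      fderiv ℝ H (Q z) (fderiv ℝ Q z n) = 0 := by
    intro z hz n
    have h1 := hder z hz (J n)
    rw [(hΓd _ (hRΩ (hQsrc z hz))).fderiv, ← hQd z hz] at h1
    exact ⟨congrArg Prod.fst h1, congrArg Prod.snd h1⟩
  refine ⟨K, ⟨pr, Q, O, R.source, R.open_target.preimage J.continuous, R.open_source, hRΩ,
    hRs.comp J.contDiff.contDiffOn fun z hz => hz, hQsrc,
    fun z hz => congrArg (fun x => x.1.2) (hRQ z hz),
    fun z hz => congrArg (fun x => x.1.1) (hRQ z hz), ?_, ?_, fun z hz n => (hFH z hz n).2,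
    fun z hz n => (hFH z hz n).1, ?_, ?_⟩, hyR⟩
  · intro y hy h
    change J (F y, pr y) ∈ R.target
    rw [hJy y hy h]
    exact R.map_source hy
  · intro y hy h
    change R.symm (J (F y, pr y)) = y
    rw [hJy y hy h, R.left_inv hy]
  · intro z hz ρ
    refine hM.exists_eq_add hF hdim (hRΩ (hQsrc z hz)) (congrArg (fun x => x.1.2) (hRQ z hz)) ?_
      (hFH z hz _).1 (hFH z hz _).2
    intro n
    -- Surjectivity is assumed only at `y`; at the other points of the chart it is read off from the
    -- inverse of the straightening.
    refine ⟨fderiv ℝ R.symm (J z) (n, 0), ?_⟩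
    have h1 := hder z hz (n, 0)
    rwa [(hΓd _ (hRΩ (hQsrc z hz))).fderiv] at h1
  · intro y hy h Y hY
    have hO : (F y, pr y) ∈ O := by
      change J (F y, pr y) ∈ R.target
      rw [hJy y hy h]
      exact R.map_source hy
    rw [hQd _ hO, hJy y hy h]
    have h1 := (fderiv_straightening hR hRs hy (hΓd _ (hRΩ hy)).differentiableAt).2.2 Y
    rw [(hΓd _ (hRΩ hy)).fderiv] at h1
    have h2 : J (fderiv ℝ F y Y, pr Y) = (((fderiv ℝ F y).prod (fderiv ℝ H y)) Y, pr Y) := by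
      rw [hJ]; simp [hY]
    rw [h2, h1]

end NullModel

theorem two_le_smooth : (2 : WithTop ℕ∞) ≤ ∞ :=
  WithTop.coe_le_coe.2 (le_top : (2 : ℕ∞) ≤ ⊤)

/-! ### The canonical form along leaves, and the isolation of focal points -/

section Leaves

variable {E V W : Type*} [NormedAddCommGroup E] [NormedSpace ℝ E]
  [NormedAddCommGroup V] [NormedSpace ℝ V] [NormedAddCommGroup W] [NormedSpace ℝ W]
  {K : Type*} [NormedAddCommGroup K] [NormedSpace ℝ K]
  {Ω : Set (E × (E →L[ℝ] ℝ))} {H : E × (E →L[ℝ] ℝ) → ℝ} {P : E × (E →L[ℝ] ℝ) → E}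
  {F : E × (E →L[ℝ] ℝ) → W} {y : E × (E →L[ℝ] ℝ)}

theorem IsNullModel.canonical_leaf (hM : IsNullModel Ω H P) (hy : y ∈ Ω) (h0 : H y = 0) (a b : ℝ) :
    y.2 (a • phaseSpray H P y + b • phaseEuler y).1 = 0 := by
  simp [phaseSpray, phaseEuler, hM.apply_P y hy h0]

theorem IsNullModel.phaseForm_leaf (hM : IsNullModel Ω H P) (hy : y ∈ Ω) (a b : ℝ)
    {Y : E × (E →L[ℝ] ℝ)} (hY : fderiv ℝ H y Y = 0) :
    phaseForm (a • phaseSpray H P y + b • phaseEuler y) Y = b * y.2 Y.1 := by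
  have h1 := hM.phaseForm_spray hy Y
  have h2 := IsNullModel.phaseForm_euler (y := y) Y
  simp only [phaseForm] at h1 h2 ⊢
  simp only [Prod.snd_add, Prod.smul_snd, Prod.fst_add, Prod.smul_fst, add_apply, map_add,
    map_smul, smul_apply, smul_eq_mul]
  rw [hY] at h1
  linear_combination a * h1 + b * h2

/-- Along a leaf, the canonical form changes by a factor: its kernel, transported to the space of
leaves, is locally constant. -/
theorem LeafChart.fderiv_canonical (hM : IsNullModel Ω H P)
    (C : LeafChart Ω H P F K) {z : W × K} (hz : z ∈ C.O)
    (ρ : K) : ∃ b : ℝ, ∀ n : W,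
      fderiv ℝ (fun z => (C.Q z).2 (fderiv ℝ C.Q z (n, 0)).1) z (0, ρ)
        = b * (C.Q z).2 (fderiv ℝ C.Q z (n, 0)).1 := by
  obtain ⟨a, b, hab⟩ := C.fderiv_leaf z hz ρ
  have hΩ : ∀ z ∈ C.O, C.Q z ∈ Ω := fun z hz => C.subset (C.Q_mem z hz)
  refine ⟨b, fun n => ?_⟩
  have hQ : ContDiffAt ℝ 2 C.Q z :=
    (C.smooth.contDiffAt (C.isOpen_O.mem_nhds hz)).of_le two_le_smooth
  have h1 := fderiv_canonical_sub hQ (0, ρ) (n, 0)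
  -- `θ` vanishes identically on leaf directions, so one of the two terms of the exterior derivative
  -- drops out, and the contraction of `ω` with a leaf vector supplies the factor `b`.
  have h2 : (fun z => (C.Q z).2 (fderiv ℝ C.Q z (0, ρ)).1) =ᶠ[𝓝 z] fun _ => 0 := by
    filter_upwards [C.isOpen_O.mem_nhds hz] with z' hz'
    obtain ⟨a, b, hab⟩ := C.fderiv_leaf z' hz' ρ
    rw [hab, hM.canonical_leaf (hΩ z' hz') (C.H_Q z' hz')]
  rw [h2.fderiv_eq, hab, hM.phaseForm_leaf (hΩ z hz) a b (C.fderiv_H z hz _)] at h1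
  simpa using h1

/-- Along a leaf all the functions `lam n` satisfy the same linear equation, with a factor `b` that
does not depend on `n`. Their quotients by a non-vanishing `lam n₁` are therefore constant on a ball
in the leaf coordinate, and a zero of `θ` propagates. -/
theorem LeafChart.exists_nhds_canonical_eq_zero
    (hM : IsNullModel Ω H P) (hF : IsLeafFunction Ω H P F)
    (C : LeafChart Ω H P F K) (hyC : y ∈ C.Ω') (h0 : H y = 0) :
    ∃ U ∈ 𝓝 y, ∀ y₁ ∈ U, ∀ y₂ ∈ U, H y₁ = 0 → H y₂ = 0 → F y₁ = F y₂ →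
      ∀ Y₁ Y₂, fderiv ℝ H y₁ Y₁ = 0 → fderiv ℝ H y₂ Y₂ = 0 → fderiv ℝ F y₁ Y₁ = fderiv ℝ F y₂ Y₂ →
        y₁.2 Y₁.1 = 0 → y₂.2 Y₂.1 = 0 := by
  have hy : y ∈ Ω := C.subset hyC
  have hΩ : ∀ z ∈ C.O, C.Q z ∈ Ω := fun z hz => C.subset (C.Q_mem z hz)
  let lam : W → W × K → ℝ := fun n z => (C.Q z).2 (fderiv ℝ C.Q z (n, 0)).1
  have hlamd : ∀ n, ∀ z ∈ C.O, DifferentiableAt ℝ (lam n) z := by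
    intro n z hz
    obtain ⟨L, hL, -⟩ := hasFDerivAt_canonical (Q := C.Q) (z := z)
      ((C.smooth.contDiffAt (C.isOpen_O.mem_nhds hz)).of_le two_le_smooth) (n, 0)
    exact hL.differentiableAt
  -- the canonical form in terms of `lam`
  have hlam : ∀ y ∈ C.Ω', H y = 0 → ∀ Y, fderiv ℝ H y Y = 0 →
      y.2 Y.1 = lam (fderiv ℝ F y Y) (F y, C.pr y) := by
    intro y hy h Y hY
    have hO := C.mem_O y hy h
    have h1 := C.fderiv_Q y hy h Y hY
    have h2 : fderiv ℝ C.Q (F y, C.pr y) (fderiv ℝ F y Y, C.pr Y)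
        = fderiv ℝ C.Q (F y, C.pr y) (fderiv ℝ F y Y, 0)
          + fderiv ℝ C.Q (F y, C.pr y) (0, C.pr Y) := by
      rw [← map_add]; simp
    obtain ⟨a, b, hab⟩ := C.fderiv_leaf _ hO (C.pr Y)
    have h3 := hM.canonical_leaf (hΩ _ hO) (C.H_Q _ hO) a b
    rw [← hab] at h3
    conv_lhs => rw [← h1, h2]
    simp only [lam]
    rw [C.Q_eq y hy h] at h3 ⊢
    simp only [Prod.fst_add, map_add, h3, add_zero]
  -- A reference direction on which `θ` is non-zero; by continuity it remains a valid denominator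
  -- nearby.
  obtain ⟨Y₀, hY₀, hY₀'⟩ := hM.exists_canonical_ne_zero hy h0
  set n₁ := fderiv ℝ F y Y₀
  have hO := C.mem_O y hyC h0
  have hne : lam n₁ (F y, C.pr y) ≠ 0 := by rwa [← hlam y hyC h0 Y₀ hY₀]
  have hnhds : {z | z ∈ C.O ∧ lam n₁ z ≠ 0} ∈ 𝓝 (F y, C.pr y) :=
    Filter.Eventually.and (C.isOpen_O.mem_nhds hO)
      ((hlamd n₁ _ hO).continuousAt.eventually_ne hne)
  obtain ⟨ε, hε, hball⟩ := Metric.mem_nhds_iff.1 hnhds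
  have hcont : ContinuousAt (fun y => (F y, C.pr y)) y :=
    ((hF.smooth.contDiffAt (hM.isOpen.mem_nhds hy)).continuousAt).prodMk
      C.pr.continuous.continuousAt
  refine ⟨C.Ω' ∩ (fun y => (F y, C.pr y)) ⁻¹' Metric.ball (F y, C.pr y) ε,
    inter_mem (C.isOpen_Ω'.mem_nhds hyC) (hcont (Metric.ball_mem_nhds _ hε)), ?_⟩
  rintro y₁ ⟨hy₁, hb₁⟩ y₂ ⟨hy₂, hb₂⟩ h₁ h₂ hFy Y₁ Y₂ hY₁ hY₂ hFY hθ
  rw [hlam y₁ hy₁ h₁ Y₁ hY₁] at hθ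
  rw [hlam y₂ hy₂ h₂ Y₂ hY₂]
  rw [← ball_prod_same] at hb₁ hb₂ hball
  rw [← hFY, ← hFy]
  set n := fderiv ℝ F y₁ Y₁
  set w := F y₁
  let B := Metric.ball (C.pr y) ε
  have hB : ∀ r ∈ B, (w, r) ∈ C.O ∧ lam n₁ (w, r) ≠ 0 := fun r hr => hball ⟨hb₁.1, hr⟩
  have hd : ∀ r ∈ B, ∀ n, HasFDerivAt (fun r => lam n (w, r))
      ((fderiv ℝ (lam n) (w, r)).comp (ContinuousLinearMap.inr ℝ W K)) r := by
    intro r hr n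
    have h1 : HasFDerivAt (fun r : K => (w, r)) (ContinuousLinearMap.inr ℝ W K) r :=
      hasFDerivAt_prodMk_right (𝕜 := ℝ) w r
    exact (hlamd n _ (hB r hr).1).hasFDerivAt.comp r h1
  have hd2 : ∀ r ∈ B, HasFDerivAt (fun r => lam n (w, r) * (lam n₁ (w, r))⁻¹) (0 : K →L[ℝ] ℝ) r := by
    intro r hr
    have h1 := (hd r hr n).mul ((hasDerivAt_inv (hB r hr).2).comp_hasFDerivAt r (hd r hr n₁))
    refine h1.congr_fderiv (ContinuousLinearMap.ext fun ρ => ?_)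
    obtain ⟨b, hb⟩ := C.fderiv_canonical hM (hB r hr).1 ρ
    have e1 : fderiv ℝ (lam n) (w, r) (0, ρ) = b * lam n (w, r) := hb n
    have e2 : fderiv ℝ (lam n₁) (w, r) (0, ρ) = b * lam n₁ (w, r) := hb n₁
    have hne := (hB r hr).2
    simp only [zero_apply, add_apply, smul_apply, ContinuousLinearMap.comp_apply,
      ContinuousLinearMap.inr_apply, e1, e2, smul_eq_mul, Function.comp]
    field_simp
    ring
  have hconst : lam n (w, C.pr y₂) * (lam n₁ (w, C.pr y₂))⁻¹
      = lam n (w, C.pr y₁) * (lam n₁ (w, C.pr y₁))⁻¹ :=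
    (Metric.isOpen_ball (x := C.pr y) (ε := ε)).is_const_of_fderiv_eq_zero (𝕜 := ℝ)
      (f := fun r => lam n (w, r) * (lam n₁ (w, r))⁻¹) (convex_ball (C.pr y) ε).isPreconnected
      (fun r hr => (hd2 r hr).differentiableAt.differentiableWithinAt)
      (fun r hr => (hd2 r hr).fderiv) hb₂.2 hb₁.2
  have hzero : lam n (w, C.pr y₂) / lam n₁ (w, C.pr y₂) = 0 := by
    rw [div_eq_mul_inv, hconst, hθ, zero_mul]
  rcases div_eq_zero_iff.1 hzero with h | h
  · exact h
  · exact absurd h (hB _ hb₂.2).2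

set_option synthInstance.maxHeartbeats 200000 in
set_option maxHeartbeats 1000000 in
-- The base part of `∂_t q` is `a P(q)` with `a = 1` at `z₀`. Differentiating it in the direction
-- `v` and exchanging the derivatives gives the formula, with `μ` the derivative of `a`.
theorem IsNullModel.exists_mixed_deriv (hM : IsNullModel Ω H P)
    {q : V × ℝ → E × (E →L[ℝ] ℝ)} {z₀ : V × ℝ} (hq : ContDiffAt ℝ 2 q z₀)
    (hΩ₀ : q z₀ ∈ Ω) (hH₀ : H (q z₀) = 0)
    (hleaf : ∀ᶠ z in 𝓝 z₀, ∃ a b : ℝ,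
      fderiv ℝ q z (0, 1) = a • phaseSpray H P (q z) + b • phaseEuler (q z))
    (hspray : fderiv ℝ q z₀ (0, 1) = phaseSpray H P (q z₀)) (v : V) :
    ∃ μ : ℝ, (fderiv ℝ (fderiv ℝ q) z₀ (0, 1) (v, 0)).1
      = μ • P (q z₀) + fderiv ℝ P (q z₀) (fderiv ℝ q z₀ (v, 0)) := by
  have hqd : HasFDerivAt q (fderiv ℝ q z₀) z₀ := (hq.differentiableAt (by norm_num)).hasFDerivAt
  have hqdd : HasFDerivAt (fderiv ℝ q) (fderiv ℝ (fderiv ℝ q) z₀) z₀ :=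
    ((hq.fderiv_right (m := 1) (by norm_num)).differentiableAt (by norm_num)).hasFDerivAt
  have hPd : HasFDerivAt P (fderiv ℝ P (q z₀)) (q z₀) :=
    ((hM.smooth_P.contDiffAt (hM.isOpen.mem_nhds hΩ₀)).differentiableAt (by simp)).hasFDerivAt
  have hPq : HasFDerivAt (fun z => P (q z)) ((fderiv ℝ P (q z₀)).comp (fderiv ℝ q z₀)) z₀ :=
    hPd.comp z₀ hqd
  obtain ⟨ℓ, hℓ⟩ := SeparatingDual.exists_eq_one (R := ℝ) (hM.P_ne _ hΩ₀ hH₀)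
  have hs := (hq.isSymmSndFDerivAt (by simp)).eq ((0 : V), (1 : ℝ)) (v, 0)
  have h1 : HasFDerivAt (fun z => (fderiv ℝ q z (0, 1)).1) _ z₀ :=
    (hqdd.clm_apply (hasFDerivAt_const ((0 : V), (1 : ℝ)) z₀)).fst
  have h2 : HasFDerivAt (fun z => ℓ (fderiv ℝ q z (0, 1)).1 * (ℓ (P (q z)))⁻¹)
      (fderiv ℝ (fun z => ℓ (fderiv ℝ q z (0, 1)).1 * (ℓ (P (q z)))⁻¹) z₀) z₀ := by
    have h3 : DifferentiableAt ℝ (fun z => ℓ (fderiv ℝ q z (0, 1)).1) z₀ :=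
      ℓ.differentiableAt.comp z₀ h1.differentiableAt
    have h4 : DifferentiableAt ℝ (fun z => ℓ (P (q z))) z₀ :=
      ℓ.differentiableAt.comp z₀ hPq.differentiableAt
    refine DifferentiableAt.hasFDerivAt (h3.fun_mul (h4.fun_inv ?_))
    rw [hℓ]; exact one_ne_zero
  -- The coefficient `a` is only known to exist pointwise; testing with `ℓ` writes it as a quotient
  -- that is visibly differentiable.
  have h3 : (fun z => (fderiv ℝ q z (0, 1)).1) =ᶠ[𝓝 z₀]
      fun z => (ℓ (fderiv ℝ q z (0, 1)).1 * (ℓ (P (q z)))⁻¹) • P (q z) := by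
    have hne : ∀ᶠ z in 𝓝 z₀, ℓ (P (q z)) ≠ 0 := by
      refine (ℓ.continuous.continuousAt.comp hPq.continuousAt).eventually_ne ?_
      change ℓ (P (q z₀)) ≠ 0
      rw [hℓ]; exact one_ne_zero
    filter_upwards [hleaf, hne] with z hz hne
    obtain ⟨a, b, hab⟩ := hz
    have : (fderiv ℝ q z (0, 1)).1 = a • P (q z) := by
      rw [hab]; simp [phaseSpray, phaseEuler]
    rw [this, map_smul, smul_eq_mul, mul_assoc, mul_inv_cancel₀ hne, mul_one]
  have h4 := h1.unique ((h2.smul hPq).congr_of_eventuallyEq h3)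
  have h5 := DFunLike.congr_fun h4 (v, 0)
  have h6 : ℓ (fderiv ℝ q z₀ (0, 1)).1 * (ℓ (P (q z₀)))⁻¹ = 1 := by
    rw [hspray]
    simp [phaseSpray, hℓ]
  refine ⟨fderiv ℝ (fun z => ℓ (fderiv ℝ q z (0, 1)).1 * (ℓ (P (q z)))⁻¹) z₀ (v, 0), ?_⟩
  rw [hs]
  rw [h6] at h5
  simpa [add_comm] using h5

theorem tendsto_clm_apply {α X Z : Type*} [NormedAddCommGroup X] [NormedSpace ℝ X]
    [NormedAddCommGroup Z] [NormedSpace ℝ Z] {l : Filter α} {A : α → X →L[ℝ] Z} {A₀ : X →L[ℝ] Z}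
    {x : α → X} {x₀ : X} (hA : Tendsto A l (𝓝 A₀)) (hx : Tendsto x l (𝓝 x₀)) :
    Tendsto (fun t => A t (x t)) l (𝓝 (A₀ x₀)) :=
  (isBoundedBilinearMap_apply.continuous.tendsto (A₀, x₀)).comp (hA.prodMk_nhds hx)

/-- A compactness argument: if the maps `ϖ ∘ A t ∘ ι` send non-zero vectors to multiples of `p t` for
`t ≠ 0` arbitrarily small, then so does the limit map, with a condition on first derivatives. -/
theorem exists_limit_of_frequently {X Z : Type*} [NormedAddCommGroup X] [NormedSpace ℝ X]
    [NormedAddCommGroup Z] [NormedSpace ℝ Z] [FiniteDimensional ℝ V] {A : ℝ → X →L[ℝ] Z}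
    {A' : X →L[ℝ] Z} (hA : HasDerivAt A A' 0) (ϖ : Z →L[ℝ] E) (ι : V →L[ℝ] X) {p : ℝ → E} {p' : E}
    (hp : HasDerivAt p p' 0) (hp0 : p 0 ≠ 0)
    (h : ∃ᶠ t in 𝓝[≠] (0 : ℝ), ∃ v, ∃ c : ℝ, ϖ (A t (ι v)) = c • p t ∧ v ≠ 0) :
    ∃ v, v ≠ 0 ∧ ∃ c : ℝ, ϖ (A 0 (ι v)) = c • p 0 ∧ ∀ β : E →L[ℝ] ℝ,
      (∀ v', β (ϖ (A 0 (ι v'))) = 0) → β (p 0) = 0 → β (ϖ (A' (ι v))) = c * β p' := by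
  obtain ⟨ℓ, hℓ⟩ := SeparatingDual.exists_eq_one (R := ℝ) hp0
  -- An ultrafilter of bad times tending to zero replaces the extraction of a convergent
  -- subsequence.
  obtain ⟨U, hU⟩ : ∃ U : Ultrafilter ℝ, (U : Filter ℝ) ≤ 𝓝[≠] 0 ⊓ 𝓟 {t | ∃ v, ∃ c : ℝ,
      ϖ (A t (ι v)) = c • p t ∧ v ≠ 0} := by
    have : NeBot (𝓝[≠] 0 ⊓ 𝓟 {t | ∃ v, ∃ c : ℝ, ϖ (A t (ι v)) = c • p t ∧ v ≠ 0}) :=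
      Filter.frequently_mem_iff_neBot.1 h
    exact ⟨Ultrafilter.of _, Ultrafilter.of_le _⟩
  have hUn : (U : Filter ℝ) ≤ 𝓝[≠] 0 := hU.trans inf_le_left
  have hU0 : (U : Filter ℝ) ≤ 𝓝 0 := hUn.trans nhdsWithin_le_nhds
  -- Bad vectors are scaled to the unit sphere, so that their limit is non-zero. At the other times
  -- the values are placeholders that `U` ignores.
  have hsel : ∀ t : ℝ, ∃ (v : V) (c : ℝ), (∃ v, ∃ c : ℝ, ϖ (A t (ι v)) = c • p t ∧ v ≠ 0) →
      v ∈ Metric.sphere (0 : V) 1 ∧ ϖ (A t (ι v)) = c • p t := by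
    intro t
    by_cases h : ∃ v, ∃ c : ℝ, ϖ (A t (ι v)) = c • p t ∧ v ≠ 0
    · obtain ⟨v, c, hv, hne⟩ := h
      refine ⟨‖v‖⁻¹ • v, ‖v‖⁻¹ * c, fun _ => ⟨?_, ?_⟩⟩
      · rw [mem_sphere_zero_iff_norm, norm_smul, norm_inv, norm_norm,
          inv_mul_cancel₀ (norm_ne_zero_iff.2 hne)]
      · rw [map_smul, map_smul, map_smul, hv, smul_smul]
    · exact ⟨0, 0, fun h' => absurd h' h⟩
  choose vv c hvc using hsel
  have hUs : ∀ᶠ t in (U : Filter ℝ), vv t ∈ Metric.sphere (0 : V) 1 ∧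
      ϖ (A t (ι (vv t))) = c t • p t := by
    have h1 : ∀ᶠ t in (U : Filter ℝ), ∃ v, ∃ c : ℝ, ϖ (A t (ι v)) = c • p t ∧ v ≠ 0 :=
      (hU.trans inf_le_right) (mem_principal_self _)
    filter_upwards [h1] with t ht using hvc t ht
  have : ProperSpace V := FiniteDimensional.proper ℝ V
  obtain ⟨v, hv, hUv⟩ := (isCompact_sphere (0 : V) 1).ultrafilter_le_nhds (U.map vv) (by
    rw [le_principal_iff]
    exact hUs.mono fun t ht => ht.1)
  have hvv : Tendsto (fun t => ι (vv t)) U (𝓝 (ι v)) := (ι.continuous.tendsto _).comp hUv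
  have hAt : Tendsto A U (𝓝 (A 0)) :=
    (HasDerivAt.continuousAt (F := X →L[ℝ] Z) hA).tendsto.mono_left hU0
  have hpt : Tendsto p U (𝓝 (p 0)) := hp.continuousAt.tendsto.mono_left hU0
  have hAv : Tendsto (fun t : ℝ => ϖ (A t (ι (vv t)))) U (𝓝 (ϖ (A 0 (ι v)))) :=
    (ϖ.continuous.tendsto _).comp (tendsto_clm_apply hAt hvv)
  -- No compactness is available for the coefficients; they converge because `ℓ` recovers them as
  -- quotients with denominator tending to `1`.
  obtain ⟨c₀, hc⟩ : ∃ c₀ : ℝ, Tendsto c U (𝓝 c₀) := by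
    have hne1 : ℓ (p 0) ≠ 0 := by rw [hℓ]; exact one_ne_zero
    have h1 : Tendsto (fun t => ℓ (ϖ (A t (ι (vv t)))) / ℓ (p t)) U
        (𝓝 (ℓ (ϖ (A 0 (ι v))) / ℓ (p 0))) :=
      ((ℓ.continuous.tendsto _).comp hAv).div ((ℓ.continuous.tendsto _).comp hpt) hne1
    have hne : ∀ᶠ t in (U : Filter ℝ), ℓ (p t) ≠ 0 :=
      ((ℓ.continuous.tendsto _).comp hpt).eventually_ne hne1
    refine ⟨_, h1.congr' ?_⟩
    filter_upwards [hUs, hne] with t ht hne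
    rw [ht.2, map_smul, smul_eq_mul, mul_div_cancel_right₀ _ hne]
  have hAc : ϖ (A 0 (ι v)) = c₀ • p 0 := by
    refine tendsto_nhds_unique hAv ((hc.smul hpt).congr' ?_)
    filter_upwards [hUs] with t ht using ht.2.symm
  refine ⟨v, ?_, c₀, hAc, fun β hβA hβp => ?_⟩
  · rintro rfl
    simp at hv
  -- `β` annihilates both zeroth-order terms, so after division by `t` the relation equates
  -- difference quotients, which converge.
  have hslopeA : Tendsto (fun t : ℝ => t⁻¹ • (A t - A 0)) U (𝓝 A') := by
    have := ((hasDerivAt_iff_tendsto_slope (F := X →L[ℝ] Z)).1 hA).mono_left hUn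
    simpa [slope_fun_def] using this
  have hslopeP : Tendsto (fun t : ℝ => t⁻¹ • (p t - p 0)) U (𝓝 p') := by
    have := (hasDerivAt_iff_tendsto_slope.1 hp).mono_left hUn
    simpa [slope_fun_def] using this
  have hlim1 : Tendsto (fun t : ℝ => β (ϖ ((t⁻¹ • (A t - A 0)) (ι (vv t))))) U
      (𝓝 (β (ϖ (A' (ι v))))) :=
    (β.continuous.tendsto _).comp ((ϖ.continuous.tendsto _).comp
      (tendsto_clm_apply hslopeA hvv))
  have hlim2 : Tendsto (fun t : ℝ => c t * β (t⁻¹ • (p t - p 0))) U (𝓝 (c₀ * β p')) :=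
    hc.mul ((β.continuous.tendsto _).comp hslopeP)
  refine tendsto_nhds_unique hlim1 (hlim2.congr' ?_)
  filter_upwards [hUs] with t ht
  simp only [smul_apply, sub_apply, map_smul, map_sub, ht.2, hβA, hβp, smul_eq_mul]
  ring

set_option maxHeartbeats 1000000 in
set_option synthInstance.maxHeartbeats 200000 in
/-- Focal points of a Legendrian family are isolated along a leaf. -/
theorem IsNullModel.eventually_nonfocal [FiniteDimensional ℝ V] (hM : IsNullModel Ω H P)
    {q : V × ℝ → E × (E →L[ℝ] ℝ)} {v₀ : V} (hq : ContDiffAt ℝ 2 q (v₀, 0))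
    (hN : ∀ᶠ z in 𝓝 (v₀, (0 : ℝ)), q z ∈ Ω ∧ H (q z) = 0)
    (hleaf : ∀ᶠ z in 𝓝 (v₀, (0 : ℝ)), ∃ a b : ℝ,
      fderiv ℝ q z (0, 1) = a • phaseSpray H P (q z) + b • phaseEuler (q z))
    (hspray : fderiv ℝ q (v₀, 0) (0, 1) = phaseSpray H P (q (v₀, 0)))
    (hθ : ∀ᶠ z in 𝓝 (v₀, (0 : ℝ)), ∀ v, (q z).2 (fderiv ℝ q z (v, 0)).1 = 0)
    (himm : ∀ v, ∀ a b : ℝ, fderiv ℝ q (v₀, 0) (v, 0)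
      = a • phaseSpray H P (q (v₀, 0)) + b • phaseEuler (q (v₀, 0)) → v = 0) :
    ∀ᶠ t in 𝓝[≠] (0 : ℝ), ∀ v, ∀ c : ℝ,
      (fderiv ℝ q (v₀, t) (v, 0)).1 = c • P (q (v₀, t)) → v = 0 := by
  set z₀ : V × ℝ := (v₀, 0) with hz₀
  set y₀ := q z₀ with hy₀
  obtain ⟨hΩ₀, hH₀⟩ := hN.self_of_nhds
  have hqd : HasFDerivAt q (fderiv ℝ q z₀) z₀ := (hq.differentiableAt (by norm_num)).hasFDerivAt
  have hqdd : HasFDerivAt (fderiv ℝ q) (fderiv ℝ (fderiv ℝ q) z₀) z₀ :=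
    ((hq.fderiv_right (m := 1) (by norm_num)).differentiableAt (by norm_num)).hasFDerivAt
  have hPd : HasFDerivAt P (fderiv ℝ P y₀) y₀ :=
    ((hM.smooth_P.contDiffAt (hM.isOpen.mem_nhds hΩ₀)).differentiableAt (by simp)).hasFDerivAt
  have hPq : HasFDerivAt (fun z => P (q z)) ((fderiv ℝ P y₀).comp (fderiv ℝ q z₀)) z₀ :=
    hPd.comp z₀ hqd
  -- the derivative of `H ∘ q` vanishes
  have hHq : ∀ n, fderiv ℝ H y₀ (fderiv ℝ q z₀ n) = 0 := by
    intro n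
    have h1 : HasFDerivAt (fun z => H (q z)) _ z₀ :=
      (hM.differentiableAt_H hΩ₀).hasFDerivAt.comp z₀ hqd
    have h2 := h1.unique ((hasFDerivAt_const (0 : ℝ) z₀).congr_of_eventuallyEq
      (by filter_upwards [hN] with z hz using hz.2))
    exact DFunLike.congr_fun h2 n
  -- the family is isotropic
  have hiso : ∀ v v', phaseForm (fderiv ℝ q z₀ (v, 0)) (fderiv ℝ q z₀ (v', 0)) = 0 := by
    intro v v'
    have h : ∀ v, (fun z => (q z).2 (fderiv ℝ q z (v, 0)).1) =ᶠ[𝓝 z₀] fun _ => 0 := by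
      intro v
      filter_upwards [hθ] with z hz using hz v
    rw [← fderiv_canonical_sub hq, (h v).fderiv_eq, (h v').fderiv_eq]
    simp
  have hmix := hM.exists_mixed_deriv hq hΩ₀ hH₀ hleaf hspray
  -- curves in the direction of the leaf
  have hline : HasDerivAt (fun t : ℝ => ((v₀, t) : V × ℝ)) ((0 : V), (1 : ℝ)) 0 :=
    (hasDerivAt_const (0 : ℝ) v₀).prodMk (hasDerivAt_id (0 : ℝ))
  have hA : HasDerivAt (fun t : ℝ => fderiv ℝ q (v₀, t)) (fderiv ℝ (fderiv ℝ q) z₀ (0, 1)) 0 :=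
    HasFDerivAt.comp_hasDerivAt (l := fderiv ℝ q) (l' := fderiv ℝ (fderiv ℝ q) z₀)
      (f := fun t : ℝ => ((v₀, t) : V × ℝ)) (0 : ℝ) hqdd hline
  have hPt : HasDerivAt (fun t : ℝ => P (q (v₀, t))) (fderiv ℝ P y₀ (phaseSpray H P y₀)) 0 := by
    have := HasFDerivAt.comp_hasDerivAt (l := fun z => P (q z))
      (f := fun t : ℝ => ((v₀, t) : V × ℝ)) (0 : ℝ) hPq hline
    rw [ContinuousLinearMap.comp_apply, hspray] at this
    exact this
  by_contra hbad
  have hfreq : ∃ᶠ t in 𝓝[≠] (0 : ℝ), ∃ v, ∃ c : ℝ,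
      ContinuousLinearMap.fst ℝ E (E →L[ℝ] ℝ)
        (fderiv ℝ q (v₀, t) (ContinuousLinearMap.inl ℝ V ℝ v)) = c • P (q (v₀, t)) ∧ v ≠ 0 := by
    refine (Filter.not_eventually.1 hbad).mono fun t ht => ?_
    push Not at ht
    exact ht
  obtain ⟨v, hvne, c₀, hAc, hfirst⟩ := exists_limit_of_frequently hA _ _ hPt
    (hM.P_ne y₀ hΩ₀ hH₀) hfreq
  replace hAc : (fderiv ℝ q z₀ (v, 0)).1 = c₀ • P y₀ := hAc
  -- the vertical part
  set β := (fderiv ℝ q z₀ (v, 0) - c₀ • phaseSpray H P y₀).2 with hβ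
  have hβv : fderiv ℝ q z₀ (v, 0) - c₀ • phaseSpray H P y₀ = (0, β) := by
    refine Prod.ext ?_ rfl
    rw [Prod.fst_sub, hAc]
    simp [phaseSpray]
  -- Both `dq v` (isotropy) and `X_G` (because `ω(X_G, ·) = -dH` and the family stays in `{H = 0}`)
  -- are `ω`-orthogonal to the family, hence so is `(0, β)`.
  have hβA : ∀ v', β (fderiv ℝ q z₀ (v', 0)).1 = 0 := by
    intro v'
    have h1 := hiso v v'
    have h2 := hM.phaseForm_spray hΩ₀ (fderiv ℝ q z₀ (v', 0))
    rw [hHq, neg_zero] at h2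
    have h3 : phaseForm (0, β) (fderiv ℝ q z₀ (v', 0)) = 0 := by
      rw [← hβv]
      simp only [phaseForm] at h1 h2 ⊢
      simp only [Prod.snd_sub, Prod.smul_snd, Prod.fst_sub, Prod.smul_fst, sub_apply, map_sub,
        map_smul, smul_apply, smul_eq_mul]
      linear_combination h1 - c₀ * h2
    simpa [phaseForm] using h3
  have hβP : β (P y₀) = 0 := by
    rw [← hM.fderiv_vert y₀ hΩ₀, ← hβv, map_sub, map_smul, hHq, hM.fderiv_spray hΩ₀]
    simp
  have heq : β (fderiv ℝ (fderiv ℝ q) z₀ (0, 1) (v, 0)).1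
      = c₀ * β (fderiv ℝ P y₀ (phaseSpray H P y₀)) := hfirst β hβA hβP
  obtain ⟨μ, hμ⟩ := hmix v
  -- Substituting the mixed derivative into the first-order limit relation removes every term except
  -- the fibre derivative of `P`; for a Lorentz metric this is `g^{-1}(β, β)`.
  have hfin : β (fderiv ℝ P y₀ (0, β)) = 0 := by
    rw [← hβv, map_sub, map_smul, map_sub, map_smul, smul_eq_mul, ← heq, hμ, map_add, map_smul,
      ← hy₀, hβP, smul_zero, zero_add, sub_self]
  obtain ⟨ν, hν⟩ := hM.vert y₀ hΩ₀ hH₀ β hβP hfin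
  refine hvne (himm v c₀ ν ?_)
  rw [sub_eq_iff_eq_add] at hβv
  rw [hβv, add_comm]
  congr 1
  rw [phaseEuler, hν]
  simp

end Leaves

/-! ### Instances on the cotangent bundle -/

section CotangentInstances

variable {M : Type*} [TopologicalSpace M] [ChartedSpace E4 M] [IsManifold 𝓘(ℝ, E4) ∞ M]

instance CotangentBundle.instTopologicalSpace : TopologicalSpace (CotangentBundle M) :=
  inferInstance

instance CotangentBundle.instChartedSpace :
    ChartedSpace (ModelProd E4 (E4 →L[ℝ] ℝ)) (CotangentBundle M) :=
  inferInstance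

instance CotangentBundle.instIsManifoldOne : IsManifold cotangentModel 1 (CotangentBundle M) :=
  inferInstance

instance CotangentBundle.instIsManifold : IsManifold cotangentModel ∞ (CotangentBundle M) :=
  inferInstance

end CotangentInstances

/-! ### Derivatives in charts -/

section Charts

variable {E H M W : Type*} [NormedAddCommGroup E] [NormedSpace ℝ E] [TopologicalSpace H]
  {I : ModelWithCorners ℝ E H} [TopologicalSpace M] [ChartedSpace H M]
  [NormedAddCommGroup W] [NormedSpace ℝ W] {x₀ x : M}

variable (I) in
/-- The derivative at `x` of the chart at `x₀`, with values in the model space. -/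
def chartDeriv (x₀ x : M) : TangentSpace I x →L[ℝ] E :=
  mfderiv I 𝓘(ℝ, E) (extChartAt I x₀) x

theorem chartDeriv_self [IsManifold I 1 M] (X : TangentSpace I x) : chartDeriv I x x X = X := by
  rw [chartDeriv, mfderiv_extChartAt_self]
  rfl

theorem surjective_chartDeriv [IsManifold I 1 M] (hx : x ∈ (extChartAt I x₀).source) :
    Function.Surjective (chartDeriv I x₀ x) := by
  obtain ⟨A, hA⟩ := isInvertible_mfderiv_extChartAt hx
  rw [chartDeriv, ← hA]
  exact A.surjective

theorem injective_chartDeriv [IsManifold I 1 M] (hx : x ∈ (extChartAt I x₀).source) :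
    Function.Injective (chartDeriv I x₀ x) := by
  obtain ⟨A, hA⟩ := isInvertible_mfderiv_extChartAt hx
  rw [chartDeriv, ← hA]
  exact A.injective

variable [I.Boundaryless]

theorem ContMDiffAt.contDiffAt_comp_extChartAt_symm {n : WithTop ℕ∞} [IsManifold I n M] {f : M → W}
    (hf : ContMDiffAt I 𝓘(ℝ, W) n f x) (hx : x ∈ (extChartAt I x₀).source) :
    ContDiffAt ℝ n (f ∘ (extChartAt I x₀).symm) (extChartAt I x₀ x) := by
  rw [← contMDiffAt_iff_contDiffAt]
  refine ContMDiffAt.comp (I' := I) _ ?_ ?_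
  · rwa [(extChartAt I x₀).left_inv hx]
  · exact (contMDiffOn_extChartAt_symm x₀).contMDiffAt
      ((isOpen_extChartAt_target x₀).mem_nhds ((extChartAt I x₀).map_source hx))

theorem mfderiv_eq_fderiv_comp [IsManifold I 1 M] {f : M → W}
    (hf : MDifferentiableAt I 𝓘(ℝ, W) f x) (hx : x ∈ (extChartAt I x₀).source)
    (X : TangentSpace I x) :
    mfderiv I 𝓘(ℝ, W) f x X = fderiv ℝ (f ∘ (extChartAt I x₀).symm) (extChartAt I x₀ x)
      (chartDeriv I x₀ x X) := by
  have hx' : x ∈ (chartAt H x₀).source := by rwa [← extChartAt_source I]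
  have h1 : MDifferentiableAt 𝓘(ℝ, E) 𝓘(ℝ, W) (f ∘ (extChartAt I x₀).symm)
      (extChartAt I x₀ x) := by
    refine MDifferentiableAt.comp (I' := I) _ ?_ ?_
    · rwa [(extChartAt I x₀).left_inv hx]
    · exact ((contMDiffOn_extChartAt_symm (n := 1) x₀).contMDiffAt
        ((isOpen_extChartAt_target x₀).mem_nhds ((extChartAt I x₀).map_source hx))
        ).mdifferentiableAt (by simp)
  have h2 : f =ᶠ[𝓝 x] (f ∘ (extChartAt I x₀).symm) ∘ extChartAt I x₀ := by
    filter_upwards [(isOpen_extChartAt_source x₀).mem_nhds hx] with z hz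
    simp only [Function.comp, (extChartAt I x₀).left_inv hz]
  have h3 := (h1.hasMFDerivAt.comp x
    (mdifferentiableAt_extChartAt hx').hasMFDerivAt).congr_of_eventuallyEq h2
  rw [h3.mfderiv, ← mfderiv_eq_fderiv]
  rfl

end Charts

/-! ### Canonical coordinates of the cotangent bundle -/

section CotangentCharts

variable {M : Type*} [TopologicalSpace M] [ChartedSpace E4 M] [IsManifold 𝓘(ℝ, E4) ∞ M]

theorem cotangent_source (ξ₀ : CotangentBundle M) :
    (extChartAt cotangentModel ξ₀).source = {η | η.1 ∈ (chartAt E4 ξ₀.1).source} := by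
  rw [extChartAt_source]
  ext η
  simp [FiberBundle.chartedSpace_chartAt, hom_trivializationAt_source]
  intro h
  rwa [hom_trivializationAt_apply]

theorem cotangent_chart_fst (ξ₀ η : CotangentBundle M) :
    (extChartAt cotangentModel ξ₀ η).1 = extChartAt 𝓘(ℝ, E4) ξ₀.1 η.1 := by
  simp [extChartAt, hom_chart]

/-- The trivialization of covectors is precomposition with the inverse of the tangent
trivialization, so the pairing of a covector with a vector is independent of the chart. This
determines momentum coordinates without unfolding the bundle. -/
theorem cotangent_chart_snd (ξ₀ η : CotangentBundle M) (hη : η.1 ∈ (chartAt E4 ξ₀.1).source)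
    (v : TangentSpace 𝓘(ℝ, E4) η.1) :
    (extChartAt cotangentModel ξ₀ η).2 (chartDeriv 𝓘(ℝ, E4) ξ₀.1 η.1 v)
      = η.2 v := by
  have h1 : (extChartAt cotangentModel ξ₀ η).2 = ContinuousLinearMap.inCoordinates E4
      (TangentSpace 𝓘(ℝ, E4)) ℝ (Bundle.Trivial M ℝ) ξ₀.1 η.1 ξ₀.1 η.1 η.2 := by
    simp [extChartAt, hom_chart]
  have h2 : chartDeriv 𝓘(ℝ, E4) ξ₀.1 η.1 v = Trivialization.continuousLinearEquivAt ℝ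
      (trivializationAt E4 (TangentSpace 𝓘(ℝ, E4)) ξ₀.1) η.1 (by simpa using hη) v := by
    rw [chartDeriv, ← TangentBundle.continuousLinearMapAt_trivializationAt hη,
      Trivialization.coe_continuousLinearEquivAt_eq]
  rw [h1, h2, ContinuousLinearMap.inCoordinates_eq (by simpa using hη) (by simp)]
  exact congrArg η.2 (ContinuousLinearEquiv.symm_apply_apply _ v)

theorem mdifferentiableAt_proj (ξ : CotangentBundle M) :
    MDifferentiableAt cotangentModel 𝓘(ℝ, E4) (fun η : CotangentBundle M => η.1) ξ :=
  (Bundle.contMDiff_proj (n := 1) _).mdifferentiableAt (by simp)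

theorem chartDeriv_proj (ξ₀ ξ : CotangentBundle M) (hξ : ξ.1 ∈ (chartAt E4 ξ₀.1).source)
    (X : TangentSpace cotangentModel ξ) :
    chartDeriv 𝓘(ℝ, E4) ξ₀.1 ξ.1
      (mfderiv cotangentModel 𝓘(ℝ, E4) (fun η : CotangentBundle M => η.1) ξ X)
      = (chartDeriv cotangentModel ξ₀ ξ X).1 := by
  have hs : ξ ∈ (extChartAt cotangentModel ξ₀).source := by rw [cotangent_source]; exact hξ
  have h1 : MDifferentiableAt cotangentModel 𝓘(ℝ, E4 × (E4 →L[ℝ] ℝ))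
      (extChartAt cotangentModel ξ₀) ξ :=
    mdifferentiableAt_extChartAt (by rwa [← extChartAt_source cotangentModel])
  have h2 : MDifferentiableAt 𝓘(ℝ, E4) 𝓘(ℝ, E4) (extChartAt 𝓘(ℝ, E4) ξ₀.1) ξ.1 :=
    mdifferentiableAt_extChartAt hξ
  have h3 := (ContinuousLinearMap.fst ℝ E4 (E4 →L[ℝ] ℝ)).hasMFDerivAt.comp ξ h1.hasMFDerivAt
  have h4 := h2.hasMFDerivAt.comp ξ (mdifferentiableAt_proj ξ).hasMFDerivAt
  have h5 := hasMFDerivAt_unique h3 (h4.congr_of_eventuallyEq (Eventually.of_forall fun η =>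
    cotangent_chart_fst ξ₀ η))
  exact (DFunLike.congr_fun h5 X).symm

/-- `θ = p_a dx^a` in canonical coordinates. -/
theorem canonicalForm_eq (ξ₀ ξ : CotangentBundle M) (hξ : ξ.1 ∈ (chartAt E4 ξ₀.1).source)
    (X : TangentSpace cotangentModel ξ) :
    SpaceTime.canonicalForm ξ X = (extChartAt cotangentModel ξ₀ ξ).2
      (chartDeriv cotangentModel ξ₀ ξ X).1 := by
  change ξ.2 _ = _
  rw [← cotangent_chart_snd ξ₀ ξ hξ, chartDeriv_proj ξ₀ ξ hξ]

/-- The coordinate changes of the cotangent bundle are symplectic. -/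
theorem phaseForm_mfderiv_extChartAt (ξ₀ ξ : CotangentBundle M)
    (hξ : ξ ∈ (extChartAt cotangentModel ξ₀).source) (X Y : TangentSpace cotangentModel ξ) :
    phaseForm
      (chartDeriv cotangentModel ξ₀ ξ X)
      (chartDeriv cotangentModel ξ₀ ξ Y)
      = SpaceTime.symplecticForm ξ X Y := by
  have hsm : ∀ η ∈ (extChartAt cotangentModel ξ₀).source, ContMDiffAt cotangentModel
      𝓘(ℝ, E4 × (E4 →L[ℝ] ℝ)) ∞ (extChartAt cotangentModel ξ₀) η := fun η hη =>
    contMDiffAt_extChartAt' (by rwa [← extChartAt_source cotangentModel])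
  have hmem : ξ ∈ (extChartAt cotangentModel ξ).source := mem_extChartAt_source ξ
  have hd : ∀ η ∈ (extChartAt cotangentModel ξ₀).source,
      η ∈ (extChartAt cotangentModel ξ).source → ∀ Z : TangentSpace cotangentModel η,
      chartDeriv cotangentModel ξ₀ η Z
        = fderiv ℝ (extChartAt cotangentModel ξ₀ ∘ (extChartAt cotangentModel ξ).symm)
          (extChartAt cotangentModel ξ η) (chartDeriv cotangentModel ξ η Z) := fun η hη hη' Z =>
    mfderiv_eq_fderiv_comp ((hsm η hη).mdifferentiableAt (by simp)) hη' Z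
  have hτ := ((hsm ξ hξ).contDiffAt_comp_extChartAt_symm hmem).of_le two_le_smooth
  -- Both charts write the same intrinsic `θ` as `p_a dx^a`, so the transition map preserves it at
  -- all nearby points, and may be differentiated.
  have hev : ∀ᶠ z in 𝓝 (extChartAt cotangentModel ξ ξ), ∀ Z,
      ((extChartAt cotangentModel ξ₀ ∘ (extChartAt cotangentModel ξ).symm) z).2
        (fderiv ℝ (extChartAt cotangentModel ξ₀ ∘ (extChartAt cotangentModel ξ).symm) z Z).1
      = z.2 Z.1 := by
    have h1 : (extChartAt cotangentModel ξ).target ∩ (extChartAt cotangentModel ξ).symm ⁻¹'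
        (extChartAt cotangentModel ξ₀).source ∈ 𝓝 (extChartAt cotangentModel ξ ξ) := by
      refine inter_mem (extChartAt_target_mem_nhds ξ) ?_
      refine (continuousAt_extChartAt_symm ξ).preimage_mem_nhds ?_
      rw [(extChartAt cotangentModel ξ).left_inv hmem]
      exact (isOpen_extChartAt_source ξ₀).mem_nhds hξ
    filter_upwards [h1] with z hz Z
    obtain ⟨hz1, hz2⟩ := hz
    set η := (extChartAt cotangentModel ξ).symm z with hη
    have hη' : η ∈ (extChartAt cotangentModel ξ).source := (extChartAt cotangentModel ξ).map_target hz1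
    have hzη : extChartAt cotangentModel ξ η = z := (extChartAt cotangentModel ξ).right_inv hz1
    obtain ⟨Z', rfl⟩ := surjective_chartDeriv hη' Z
    have h2 := hd η hz2 hη' Z'
    rw [hzη] at h2
    rw [← h2]
    have h3 := canonicalForm_eq ξ₀ η (by rw [cotangent_source] at hz2; exact hz2) Z'
    have h4 := canonicalForm_eq ξ η (by rw [cotangent_source] at hη'; exact hη') Z'
    rw [h3, hzη] at h4
    exact h4
  have h := phaseForm_fderiv_of_canonical hτ hev X Y
  rw [hd ξ hξ hmem, hd ξ hξ hmem, chartDeriv_self, chartDeriv_self]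
  exact h

end CotangentCharts

namespace SpaceTime

variable {M : Type*} [TopologicalSpace M] [ChartedSpace E4 M] [IsManifold 𝓘(ℝ, E4) ∞ M]
  (𝓜 : SpaceTime M)

/-! ### Lorentz algebra -/

theorem nondegenerate (x : M) {v : TangentSpace 𝓘(ℝ, E4) x} (hv : ∀ w, 𝓜.g x v w = 0) : v = 0 := by
  by_contra hne
  have h1 : 𝓜.g x (𝓜.T x) v = 0 := by rw [𝓜.symm, hv]
  have h2 := 𝓜.lorentzian x v h1 hne
  rw [hv] at h2
  exact lt_irrefl _ h2

/-- Subtracting a multiple of `n` from `v` makes it orthogonal to `T` without changing its square,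
and the metric is positive definite on the complement of `T`. -/
theorem nonneg_of_orthogonal_null (x : M) {n v : TangentSpace 𝓘(ℝ, E4) x} (hn : 𝓜.g x n n = 0)
    (hT : 𝓜.g x n (𝓜.T x) < 0) (hv : 𝓜.g x n v = 0) :
    0 ≤ 𝓜.g x v v ∧ (𝓜.g x v v = 0 → ∃ c : ℝ, v = c • n) := by
  set c := 𝓜.g x (𝓜.T x) v / 𝓜.g x (𝓜.T x) n with hc
  have hTn : 𝓜.g x (𝓜.T x) n ≠ 0 := by rw [𝓜.symm]; exact hT.ne
  have h1 : 𝓜.g x (𝓜.T x) (v - c • n) = 0 := by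
    rw [map_sub, map_smul, smul_eq_mul, hc, div_mul_cancel₀ _ hTn, sub_self]
  have h2 : 𝓜.g x (v - c • n) (v - c • n) = 𝓜.g x v v := by
    have h3 : 𝓜.g x v n = 0 := by rw [𝓜.symm, hv]
    rw [map_sub, map_sub, map_smul, map_smul, sub_apply, sub_apply, smul_apply, smul_apply, hn, hv,
      h3]
    simp
  by_cases h0 : v - c • n = 0
  · refine ⟨?_, fun _ => ⟨c, sub_eq_zero.1 h0⟩⟩
    rw [← h2, h0]; simp
  · have h3 := 𝓜.lorentzian x _ h1 h0
    rw [h2] at h3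
    exact ⟨h3.le, fun h => absurd h h3.ne'⟩

/-- The pairing of a covector with the time orientation. -/
def timePairing (ξ : CotangentBundle M) : ℝ := ξ.2 (𝓜.T ξ.1)

theorem mem_nullBundle_iff (ξ : CotangentBundle M) :
    ξ ∈ 𝓜.nullBundle ↔ 𝓜.hamiltonian ξ = 0 ∧ 𝓜.timePairing ξ < 0 := by
  have h : ∀ v, 𝓜.g ξ.1 (𝓜.sharp ξ.1 ξ.2) v = ξ.2 v := fun v =>
    DFunLike.congr_fun (𝓜.g_sharp ξ.1 ξ.2) v
  simp only [nullBundle, mem_ofPred_eq, FutureCausal, h, timePairing, hamiltonian]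
  refine and_congr_right fun h0 => ?_
  have : ξ.2 (𝓜.sharp ξ.1 ξ.2) = 0 := by linarith
  simp [this]

/-! ### The metric in coordinates -/

/-- The components of the metric in the chart at `x₀`. -/
def coordMetric (x₀ : M) (y : E4) : E4 →L[ℝ] E4 →L[ℝ] ℝ :=
  (trivializationAt (E4 →L[ℝ] E4 →L[ℝ] ℝ)
    (fun x : M => TangentSpace 𝓘(ℝ, E4) x →L[ℝ] TangentSpace 𝓘(ℝ, E4) x →L[ℝ] ℝ) x₀
    (TotalSpace.mk' (E4 →L[ℝ] E4 →L[ℝ] ℝ) ((extChartAt 𝓘(ℝ, E4) x₀).symm y)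
      (𝓜.g ((extChartAt 𝓘(ℝ, E4) x₀).symm y)))).2

set_option synthInstance.maxHeartbeats 400000 in
theorem contDiffOn_coordMetric (x₀ : M) :
    ContDiffOn ℝ ∞ (𝓜.coordMetric x₀) (extChartAt 𝓘(ℝ, E4) x₀).target := by
  have h1 : ContMDiffOn 𝓘(ℝ, E4) (𝓘(ℝ, E4).prod 𝓘(ℝ, E4 →L[ℝ] E4 →L[ℝ] ℝ)) ∞
    (fun x => TotalSpace.mk' (E4 →L[ℝ] E4 →L[ℝ] ℝ)
      (E := fun x : M => TangentSpace 𝓘(ℝ, E4) x →L[ℝ] TangentSpace 𝓘(ℝ, E4) x →L[ℝ] ℝ) x (𝓜.g x))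
      (trivializationAt (E4 →L[ℝ] E4 →L[ℝ] ℝ)
    (fun x : M => TangentSpace 𝓘(ℝ, E4) x →L[ℝ] TangentSpace 𝓘(ℝ, E4) x →L[ℝ] ℝ) x₀).baseSet :=
    𝓜.smooth.contMDiffOn
  rw [Trivialization.contMDiffOn_section_baseSet_iff] at h1
  rw [← contMDiffOn_iff_contDiffOn]
  refine h1.comp (contMDiffOn_extChartAt_symm x₀) ?_
  intro y hy
  have := (extChartAt 𝓘(ℝ, E4) x₀).map_target hy
  rw [extChartAt_source] at this
  simpa using this

set_option synthInstance.maxHeartbeats 400000 in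
theorem coordMetric_apply {x₀ x : M} (hx : x ∈ (chartAt E4 x₀).source)
    (v w : TangentSpace 𝓘(ℝ, E4) x) :
    𝓜.coordMetric x₀ (extChartAt 𝓘(ℝ, E4) x₀ x) (chartDeriv 𝓘(ℝ, E4) x₀ x v)
      (chartDeriv 𝓘(ℝ, E4) x₀ x w) = 𝓜.g x v w := by
  have hT : ∀ v, chartDeriv 𝓘(ℝ, E4) x₀ x v = Trivialization.continuousLinearEquivAt ℝ
      (trivializationAt E4 (TangentSpace 𝓘(ℝ, E4)) x₀) x (by simpa using hx) v := by
    intro v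
    rw [chartDeriv, ← TangentBundle.continuousLinearMapAt_trivializationAt hx,
      Trivialization.coe_continuousLinearEquivAt_eq]
  rw [coordMetric, (extChartAt 𝓘(ℝ, E4) x₀).left_inv (by rwa [extChartAt_source])]
  have hb : x ∈ (trivializationAt (E4 →L[ℝ] ℝ)
      (fun x : M => TangentSpace 𝓘(ℝ, E4) x →L[ℝ] Bundle.Trivial M ℝ x) x₀).baseSet := by
    simpa using hx
  have h1 : ∀ p : TangentSpace 𝓘(ℝ, E4) x →L[ℝ] Bundle.Trivial M ℝ x,
      Trivialization.continuousLinearEquivAt ℝ (trivializationAt (E4 →L[ℝ] ℝ)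
      (fun x : M => TangentSpace 𝓘(ℝ, E4) x →L[ℝ] Bundle.Trivial M ℝ x) x₀) x hb p
      (chartDeriv 𝓘(ℝ, E4) x₀ x w) = p w := by
    intro p
    rw [← cotangent_chart_snd ⟨x₀, 0⟩ ⟨x, p⟩ hx w]
    simp [extChartAt, hom_chart, hom_trivializationAt_apply]
  rw [hom_trivializationAt_apply, hT v]
  dsimp only
  rw [ContinuousLinearMap.inCoordinates_eq (by simpa using hx) hb]
  refine Eq.trans ?_ (h1 (𝓜.g x v))
  refine congrArg (fun p : TangentSpace 𝓘(ℝ, E4) x →L[ℝ] ℝ =>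
    Trivialization.continuousLinearEquivAt ℝ (trivializationAt (E4 →L[ℝ] ℝ)
      (fun x : M => TangentSpace 𝓘(ℝ, E4) x →L[ℝ] Bundle.Trivial M ℝ x) x₀) x hb p
      (chartDeriv 𝓘(ℝ, E4) x₀ x w)) ?_
  exact congrArg (𝓜.g x) (ContinuousLinearEquiv.symm_apply_apply _ v)

theorem coordMetric_injective {x₀ : M} {y : E4} (hy : y ∈ (extChartAt 𝓘(ℝ, E4) x₀).target) :
    Function.Injective (𝓜.coordMetric x₀ y) := by
  rw [injective_iff_map_eq_zero]
  intro u hu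
  have hx := (extChartAt 𝓘(ℝ, E4) x₀).map_target hy
  have hxy := (extChartAt 𝓘(ℝ, E4) x₀).right_inv hy
  set x := (extChartAt 𝓘(ℝ, E4) x₀).symm y
  obtain ⟨v, rfl⟩ := surjective_chartDeriv hx u
  have hv : v = 0 := 𝓜.nondegenerate x fun w => by
    rw [← 𝓜.coordMetric_apply (by rwa [← extChartAt_source 𝓘(ℝ, E4)]), hxy, hu]
    rfl
  rw [hv, map_zero]

theorem exists_coordMetric_equiv {x₀ : M} {y : E4} (hy : y ∈ (extChartAt 𝓘(ℝ, E4) x₀).target) :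
    ∃ B : E4 ≃L[ℝ] (E4 →L[ℝ] ℝ), (B : E4 →L[ℝ] (E4 →L[ℝ] ℝ)) = 𝓜.coordMetric x₀ y := by
  have hdim : Module.finrank ℝ E4 = Module.finrank ℝ (E4 →L[ℝ] ℝ) := by
    rw [← (LinearMap.toContinuousLinearMap (𝕜 := ℝ) (E := E4) (F' := ℝ)).finrank_eq]
    exact Subspace.dual_finrank_eq.symm
  refine ⟨(LinearEquiv.ofInjectiveOfFinrankEq (𝓜.coordMetric x₀ y).toLinearMap
    (𝓜.coordMetric_injective hy) hdim).toContinuousLinearEquiv, ?_⟩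
  ext v; rfl

/-- The vector `g^{ab} p_b` in the chart at `x₀`. -/
def coordSharp (x₀ : M) (y : E4 × (E4 →L[ℝ] ℝ)) : E4 :=
  ContinuousLinearMap.inverse (𝓜.coordMetric x₀ y.1) y.2

theorem coordMetric_coordSharp {x₀ : M} {y : E4 × (E4 →L[ℝ] ℝ)}
    (hy : y.1 ∈ (extChartAt 𝓘(ℝ, E4) x₀).target) :
    𝓜.coordMetric x₀ y.1 (𝓜.coordSharp x₀ y) = y.2 := by
  obtain ⟨B, hB⟩ := 𝓜.exists_coordMetric_equiv hy
  rw [coordSharp, ← hB, ContinuousLinearMap.inverse_equiv]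
  exact B.apply_symm_apply _

theorem cotangent_target {ξ₀ : CotangentBundle M} {y : E4 × (E4 →L[ℝ] ℝ)}
    (hy : y ∈ (extChartAt cotangentModel ξ₀).target) :
    y.1 ∈ (extChartAt 𝓘(ℝ, E4) ξ₀.1).target := by
  have h1 := (extChartAt cotangentModel ξ₀).map_target hy
  rw [← (extChartAt cotangentModel ξ₀).right_inv hy, cotangent_chart_fst]
  rw [cotangent_source] at h1
  exact (extChartAt 𝓘(ℝ, E4) ξ₀.1).map_source (by rw [extChartAt_source]; exact h1)

theorem coordSharp_chart {ξ₀ ξ : CotangentBundle M} (hξ : ξ.1 ∈ (chartAt E4 ξ₀.1).source) :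
    𝓜.coordSharp ξ₀.1 (extChartAt cotangentModel ξ₀ ξ)
      = chartDeriv 𝓘(ℝ, E4) ξ₀.1 ξ.1 (𝓜.sharp ξ.1 ξ.2) := by
  have hy : (extChartAt cotangentModel ξ₀ ξ).1 ∈ (extChartAt 𝓘(ℝ, E4) ξ₀.1).target :=
    cotangent_target ((extChartAt cotangentModel ξ₀).map_source (by rw [cotangent_source]; exact hξ))
  refine 𝓜.coordMetric_injective hy ?_
  rw [𝓜.coordMetric_coordSharp hy]
  ext u
  obtain ⟨w, rfl⟩ := surjective_chartDeriv (I := 𝓘(ℝ, E4)) (x₀ := ξ₀.1) (x := ξ.1)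
    (by rw [extChartAt_source]; exact hξ) u
  rw [cotangent_chart_snd ξ₀ ξ hξ, cotangent_chart_fst, 𝓜.coordMetric_apply hξ, 𝓜.g_sharp]

/-- The Hamiltonian in the canonical coordinates given by the chart at `ξ₀`. -/
def coordHamiltonian (ξ₀ : CotangentBundle M) : E4 × (E4 →L[ℝ] ℝ) → ℝ :=
  𝓜.hamiltonian ∘ (extChartAt cotangentModel ξ₀).symm

theorem coordHamiltonian_eq {ξ₀ : CotangentBundle M} {y : E4 × (E4 →L[ℝ] ℝ)}
    (hy : y ∈ (extChartAt cotangentModel ξ₀).target) :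
    𝓜.coordHamiltonian ξ₀ y = (1 / 2) * y.2 (𝓜.coordSharp ξ₀.1 y) := by
  have h1 := (extChartAt cotangentModel ξ₀).map_target hy
  have h2 := (extChartAt cotangentModel ξ₀).right_inv hy
  rw [coordHamiltonian, Function.comp_apply]
  set ξ := (extChartAt cotangentModel ξ₀).symm y
  rw [cotangent_source] at h1
  rw [← h2, 𝓜.coordSharp_chart h1, cotangent_chart_snd ξ₀ ξ h1, hamiltonian]

theorem contDiffOn_inverse_coordMetric (x₀ : M) :
    ContDiffOn ℝ ∞ (fun y => ContinuousLinearMap.inverse (𝓜.coordMetric x₀ y))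
      (extChartAt 𝓘(ℝ, E4) x₀).target := by
  intro y hy
  obtain ⟨B, hB⟩ := 𝓜.exists_coordMetric_equiv hy
  have h1 : ContDiffAt ℝ ∞ ContinuousLinearMap.inverse (𝓜.coordMetric x₀ y) := by
    rw [← hB]; exact contDiffAt_map_inverse B
  exact h1.comp_contDiffWithinAt y (𝓜.contDiffOn_coordMetric x₀ y hy)

theorem contDiffOn_coordSharp (ξ₀ : CotangentBundle M) :
    ContDiffOn ℝ ∞ (𝓜.coordSharp ξ₀.1) (extChartAt cotangentModel ξ₀).target :=
  ((𝓜.contDiffOn_inverse_coordMetric ξ₀.1).comp contDiffOn_fst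
    fun _ hy => cotangent_target hy).clm_apply contDiffOn_snd

theorem contDiffOn_coordHamiltonian (ξ₀ : CotangentBundle M) :
    ContDiffOn ℝ ∞ (𝓜.coordHamiltonian ξ₀) (extChartAt cotangentModel ξ₀).target := by
  have h : ContDiffOn ℝ ∞ (fun y : E4 × (E4 →L[ℝ] ℝ) => (1 / 2) * y.2 (𝓜.coordSharp ξ₀.1 y))
      (extChartAt cotangentModel ξ₀).target :=
    contDiffOn_const.mul (contDiffOn_snd.clm_apply (𝓜.contDiffOn_coordSharp ξ₀))
  exact h.congr fun y hy => 𝓜.coordHamiltonian_eq hy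

theorem coordMetric_symm {x₀ : M} {y : E4} (hy : y ∈ (extChartAt 𝓘(ℝ, E4) x₀).target) (u w : E4) :
    𝓜.coordMetric x₀ y u w = 𝓜.coordMetric x₀ y w u := by
  have hx := (extChartAt 𝓘(ℝ, E4) x₀).map_target hy
  have hxy := (extChartAt 𝓘(ℝ, E4) x₀).right_inv hy
  set x := (extChartAt 𝓘(ℝ, E4) x₀).symm y
  have hx' : x ∈ (chartAt E4 x₀).source := by rwa [← extChartAt_source 𝓘(ℝ, E4)]
  obtain ⟨v, rfl⟩ := surjective_chartDeriv hx u
  obtain ⟨v', rfl⟩ := surjective_chartDeriv hx w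
  rw [← hxy, 𝓜.coordMetric_apply hx', 𝓜.coordMetric_apply hx', 𝓜.symm]

set_option synthInstance.maxHeartbeats 400000 in
theorem fderiv_coordSharp_vert {ξ₀ : CotangentBundle M} {y : E4 × (E4 →L[ℝ] ℝ)}
    (hy : y ∈ (extChartAt cotangentModel ξ₀).target) (β : E4 →L[ℝ] ℝ) :
    fderiv ℝ (𝓜.coordSharp ξ₀.1) y (0, β) = 𝓜.coordSharp ξ₀.1 (y.1, β) := by
  have h1 : HasFDerivAt (fun y => ContinuousLinearMap.inverse (𝓜.coordMetric ξ₀.1 y)) _ y.1 :=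
    (((𝓜.contDiffOn_inverse_coordMetric ξ₀.1).contDiffAt
      ((isOpen_extChartAt_target ξ₀.1).mem_nhds (cotangent_target hy))).differentiableAt
        (by simp)).hasFDerivAt
  have h2 : HasFDerivAt (𝓜.coordSharp ξ₀.1) _ y :=
    (h1.comp y hasFDerivAt_fst).clm_apply hasFDerivAt_snd
  rw [h2.fderiv]
  simp [coordSharp]

theorem fderiv_coordHamiltonian_vert {ξ₀ : CotangentBundle M} {y : E4 × (E4 →L[ℝ] ℝ)}
    (hy : y ∈ (extChartAt cotangentModel ξ₀).target) (β : E4 →L[ℝ] ℝ) :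
    fderiv ℝ (𝓜.coordHamiltonian ξ₀) y (0, β) = β (𝓜.coordSharp ξ₀.1 y) := by
  have hy1 := cotangent_target hy
  have h1 : HasFDerivAt (𝓜.coordSharp ξ₀.1) (fderiv ℝ (𝓜.coordSharp ξ₀.1) y) y :=
    (((𝓜.contDiffOn_coordSharp ξ₀).contDiffAt
      ((isOpen_extChartAt_target ξ₀).mem_nhds hy)).differentiableAt (by simp)).hasFDerivAt
  have h2 : HasFDerivAt (𝓜.coordHamiltonian ξ₀) _ y :=
    ((hasFDerivAt_snd.clm_apply h1).const_mul (1 / 2)).congr_of_eventuallyEq (by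
      filter_upwards [(isOpen_extChartAt_target ξ₀).mem_nhds hy] with z hz
      using 𝓜.coordHamiltonian_eq hz)
  -- Symmetry of `g^{-1}`: the two terms of the derivative of the quadratic form coincide and absorb
  -- the factor `1/2`.
  have h3 : y.2 (𝓜.coordSharp ξ₀.1 (y.1, β)) = β (𝓜.coordSharp ξ₀.1 y) := by
    conv_lhs => rw [← 𝓜.coordMetric_coordSharp hy1]
    rw [𝓜.coordMetric_symm hy1, 𝓜.coordMetric_coordSharp (y := (y.1, β)) hy1]
  rw [h2.fderiv]
  simp [𝓜.fderiv_coordSharp_vert hy, h3]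
  ring

end SpaceTime

/-! ### Smoothness of the Hamiltonian and the spray, and the null model of a Lorentz metric -/

namespace SpaceTime

variable {M : Type*} [TopologicalSpace M] [ChartedSpace E4 M] [IsManifold 𝓘(ℝ, E4) ∞ M]
  (𝓜 : SpaceTime M)

theorem contMDiff_hamiltonian : ContMDiff cotangentModel 𝓘(ℝ, ℝ) ∞ 𝓜.hamiltonian := by
  intro ξ
  have h1 : ContMDiffAt 𝓘(ℝ, E4 × (E4 →L[ℝ] ℝ)) 𝓘(ℝ, ℝ) ∞ (𝓜.coordHamiltonian ξ)
      (extChartAt cotangentModel ξ ξ) :=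
    ((𝓜.contDiffOn_coordHamiltonian ξ).contDiffAt
      (extChartAt_target_mem_nhds ξ)).contMDiffAt
  refine (ContMDiffAt.comp ξ h1 contMDiffAt_extChartAt).congr_of_eventuallyEq ?_
  filter_upwards [extChartAt_source_mem_nhds (I := cotangentModel) ξ] with η hη
  rw [Function.comp_apply, coordHamiltonian, Function.comp_apply,
    (extChartAt cotangentModel ξ).left_inv hη]

theorem dH_eq {ξ₀ ξ : CotangentBundle M} (hξ : ξ ∈ (extChartAt cotangentModel ξ₀).source)
    (X : TangentSpace cotangentModel ξ) :
    𝓜.dH ξ X = fderiv ℝ (𝓜.coordHamiltonian ξ₀) (extChartAt cotangentModel ξ₀ ξ)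
      (chartDeriv cotangentModel ξ₀ ξ X) :=
  mfderiv_eq_fderiv_comp ((𝓜.contMDiff_hamiltonian ξ).mdifferentiableAt (by simp)) hξ X

/-- The spray is defined at each point in the chart centred there. Since chart changes are
symplectic and `ω` is non-degenerate, the equation `X_G ⌟ ω = -dH` identifies it in any one fixed
chart, where smoothness can be checked. -/
theorem chartDeriv_geodesicSpray {ξ₀ ξ : CotangentBundle M}
    (hξ : ξ ∈ (extChartAt cotangentModel ξ₀).source) :
    chartDeriv cotangentModel ξ₀ ξ (𝓜.geodesicSpray ξ)
      = phaseSpray (𝓜.coordHamiltonian ξ₀) (𝓜.coordSharp ξ₀.1) (extChartAt cotangentModel ξ₀ ξ) := by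
  refine phaseForm_injective fun Y => ?_
  obtain ⟨Y, rfl⟩ := surjective_chartDeriv hξ Y
  rw [phaseForm_phaseSpray (fun β => 𝓜.fderiv_coordHamiltonian_vert
      ((extChartAt cotangentModel ξ₀).map_source hξ) β), ← 𝓜.dH_eq hξ,
    phaseForm_mfderiv_extChartAt ξ₀ ξ hξ]
  linarith [𝓜.geodesicSpray_spec ξ Y]

theorem contMDiff_geodesicSpray :
    ContMDiff cotangentModel cotangentModel.tangent 1
      (fun ξ : CotangentBundle M => (⟨ξ, 𝓜.geodesicSpray ξ⟩ : TangentBundle cotangentModel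
        (CotangentBundle M))) := by
  intro ξ₀
  rw [contMDiffAt_section]
  have h1 : ContDiffOn ℝ 1 (phaseSpray (𝓜.coordHamiltonian ξ₀) (𝓜.coordSharp ξ₀.1))
      (extChartAt cotangentModel ξ₀).target := by
    refine ((𝓜.contDiffOn_coordSharp ξ₀).of_le (by simp)).prodMk ?_
    refine ContDiffOn.neg ?_
    refine ContDiffOn.clm_comp ?_ contDiffOn_const
    exact (𝓜.contDiffOn_coordHamiltonian ξ₀).fderiv_of_isOpen (isOpen_extChartAt_target ξ₀)
      (by rw [one_add_one_eq_two]; exact two_le_smooth)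
  have h2 : ContMDiffAt cotangentModel 𝓘(ℝ, E4 × (E4 →L[ℝ] ℝ)) 1
      (phaseSpray (𝓜.coordHamiltonian ξ₀) (𝓜.coordSharp ξ₀.1) ∘ extChartAt cotangentModel ξ₀) ξ₀ :=
    ContMDiffAt.comp ξ₀ (h1.contDiffAt (extChartAt_target_mem_nhds ξ₀)).contMDiffAt
      contMDiffAt_extChartAt
  refine h2.congr_of_eventuallyEq ?_
  filter_upwards [extChartAt_source_mem_nhds (I := cotangentModel) ξ₀] with ξ hξ
  rw [Function.comp_apply, ← 𝓜.chartDeriv_geodesicSpray hξ, chartDeriv,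
    ← TangentBundle.continuousLinearMapAt_trivializationAt
      (by rwa [← extChartAt_source cotangentModel])]
  rw [Trivialization.continuousLinearMapAt_apply, Trivialization.linearMapAt_apply, if_pos]
  rwa [TangentBundle.trivializationAt_baseSet, ← extChartAt_source cotangentModel]

theorem continuous_timePairing : Continuous 𝓜.timePairing := by
  rw [continuous_iff_continuousAt]
  intro ξ₀
  have h1 : ContinuousAt (fun x : M => (trivializationAt E4 (TangentSpace 𝓘(ℝ, E4)) ξ₀.1
      ⟨x, 𝓜.T x⟩).2) ξ₀.1 := by
    have h := (trivializationAt E4 (TangentSpace 𝓘(ℝ, E4)) ξ₀.1).continuousOn.continuousAt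
      (x := ⟨ξ₀.1, 𝓜.T ξ₀.1⟩) ((trivializationAt E4 (TangentSpace 𝓘(ℝ, E4))
        ξ₀.1).open_source.mem_nhds (by simp))
    exact continuousAt_snd.comp (ContinuousAt.comp
      (f := fun x => (⟨x, 𝓜.T x⟩ : TangentBundle 𝓘(ℝ, E4) M)) h 𝓜.continuous_T.continuousAt)
  have h2 : ContinuousAt (fun ξ : CotangentBundle M => (extChartAt cotangentModel ξ₀ ξ).2
      (trivializationAt E4 (TangentSpace 𝓘(ℝ, E4)) ξ₀.1 ⟨ξ.1, 𝓜.T ξ.1⟩).2) ξ₀ := by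
    refine ContinuousAt.clm_apply ?_ ?_
    · exact continuousAt_snd.comp (continuousAt_extChartAt ξ₀)
    · exact ContinuousAt.comp (f := fun ξ : CotangentBundle M => ξ.1) h1
        (FiberBundle.continuous_proj _ _).continuousAt
  refine h2.congr ?_
  filter_upwards [extChartAt_source_mem_nhds (I := cotangentModel) ξ₀] with ξ hξ
  rw [cotangent_source] at hξ
  rw [timePairing, ← cotangent_chart_snd ξ₀ ξ hξ, chartDeriv,
    ← TangentBundle.continuousLinearMapAt_trivializationAt hξ,
    Trivialization.continuousLinearMapAt_apply, Trivialization.linearMapAt_apply, if_pos]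
  simpa using hξ

/-- The coordinate domain on which covectors are future pointing. -/
def coordDomain (ξ₀ : CotangentBundle M) : Set (E4 × (E4 →L[ℝ] ℝ)) :=
  (extChartAt cotangentModel ξ₀).target ∩
    (extChartAt cotangentModel ξ₀).symm ⁻¹' {ξ | 𝓜.timePairing ξ < 0}

theorem isOpen_coordDomain (ξ₀ : CotangentBundle M) : IsOpen (𝓜.coordDomain ξ₀) :=
  (continuousOn_extChartAt_symm ξ₀).isOpen_inter_preimage (isOpen_extChartAt_target ξ₀)
    (isOpen_Iio.preimage 𝓜.continuous_timePairing)

theorem symm_mem_nullBundle {ξ₀ : CotangentBundle M} {y : E4 × (E4 →L[ℝ] ℝ)}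
    (hy : y ∈ 𝓜.coordDomain ξ₀) (h0 : 𝓜.coordHamiltonian ξ₀ y = 0) :
    (extChartAt cotangentModel ξ₀).symm y ∈ 𝓜.nullBundle :=
  (𝓜.mem_nullBundle_iff _).2 ⟨h0, hy.2⟩

theorem chart_mem_coordDomain {ξ₀ ξ : CotangentBundle M}
    (hξ : ξ ∈ (extChartAt cotangentModel ξ₀).source) (hN : ξ ∈ 𝓜.nullBundle) :
    extChartAt cotangentModel ξ₀ ξ ∈ 𝓜.coordDomain ξ₀ ∧
      𝓜.coordHamiltonian ξ₀ (extChartAt cotangentModel ξ₀ ξ) = 0 := by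
  rw [mem_nullBundle_iff] at hN
  refine ⟨⟨(extChartAt cotangentModel ξ₀).map_source hξ, ?_⟩, ?_⟩
  · rw [mem_preimage, (extChartAt cotangentModel ξ₀).left_inv hξ]
    exact hN.2
  · rw [coordHamiltonian, Function.comp_apply, (extChartAt cotangentModel ξ₀).left_inv hξ]
    exact hN.1

theorem sharp_null {ξ : CotangentBundle M} (hN : ξ ∈ 𝓜.nullBundle) :
    𝓜.g ξ.1 (𝓜.sharp ξ.1 ξ.2) (𝓜.sharp ξ.1 ξ.2) = 0 ∧
      𝓜.g ξ.1 (𝓜.sharp ξ.1 ξ.2) (𝓜.T ξ.1) < 0 := by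
  refine ⟨?_, hN.2.2⟩
  have h := hN.1
  rw [hamiltonian] at h
  rw [𝓜.g_sharp]
  linarith

/-- A negative time pairing keeps covectors off the zero section. The condition `vert` is the
Lorentzian fact that a null vector orthogonal to a future-pointing null vector is a multiple of it,
applied to `β` with its index raised. -/
theorem isNullModel (ξ₀ : CotangentBundle M) :
    IsNullModel (𝓜.coordDomain ξ₀) (𝓜.coordHamiltonian ξ₀) (𝓜.coordSharp ξ₀.1) := by
  have hsnd : ∀ y ∈ 𝓜.coordDomain ξ₀, y.2 ≠ 0 := by
    intro y hy h0
    have h1 := (extChartAt cotangentModel ξ₀).map_target hy.1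
    have h2 := (extChartAt cotangentModel ξ₀).right_inv hy.1
    have h3 : 𝓜.timePairing ((extChartAt cotangentModel ξ₀).symm y) < 0 := hy.2
    rw [cotangent_source] at h1
    rw [timePairing, ← cotangent_chart_snd ξ₀ _ h1, h2, h0] at h3
    exact lt_irrefl _ h3
  refine ⟨𝓜.isOpen_coordDomain ξ₀, (𝓜.contDiffOn_coordHamiltonian ξ₀).mono inter_subset_left,
    (𝓜.contDiffOn_coordSharp ξ₀).mono inter_subset_left,
    fun y hy => 𝓜.fderiv_coordHamiltonian_vert hy.1, ?_, ?_, fun y hy _ => hsnd y hy, ?_⟩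
  · intro y hy h0
    rw [𝓜.coordHamiltonian_eq hy.1] at h0
    linarith
  · intro y hy _ h
    have h1 := 𝓜.coordMetric_coordSharp (cotangent_target hy.1)
    rw [h, map_zero] at h1
    exact hsnd y hy h1.symm
  · intro y hy h0 β hβ hβ'
    have hy1 := cotangent_target hy.1
    rw [𝓜.fderiv_coordSharp_vert hy.1] at hβ'
    have hN := 𝓜.symm_mem_nullBundle hy h0
    have h1 := (extChartAt cotangentModel ξ₀).map_target hy.1
    have h2 := (extChartAt cotangentModel ξ₀).right_inv hy.1
    set ξ := (extChartAt cotangentModel ξ₀).symm y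
    rw [cotangent_source] at h1
    obtain ⟨v, hv⟩ := surjective_chartDeriv (I := 𝓘(ℝ, E4)) (x₀ := ξ₀.1) (x := ξ.1)
      (by rw [extChartAt_source]; exact h1) (𝓜.coordSharp ξ₀.1 (y.1, β))
    have hP := 𝓜.coordSharp_chart h1
    rw [h2] at hP
    have hy1' : y.1 = extChartAt 𝓘(ℝ, E4) ξ₀.1 ξ.1 := by rw [← cotangent_chart_fst, h2]
    have hG : 𝓜.coordMetric ξ₀.1 y.1 (𝓜.coordSharp ξ₀.1 (y.1, β)) = β :=
      𝓜.coordMetric_coordSharp (y := (y.1, β)) hy1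
    have hvv : 𝓜.g ξ.1 v v = 0 := by
      rw [← 𝓜.coordMetric_apply h1, ← hy1', hv, hG, hβ']
    have hnv : 𝓜.g ξ.1 (𝓜.sharp ξ.1 ξ.2) v = 0 := by
      rw [𝓜.symm, ← 𝓜.coordMetric_apply h1, ← hy1', hv, hG, ← hP, hβ]
    obtain ⟨hn, hT⟩ := 𝓜.sharp_null hN
    obtain ⟨c, hc⟩ := (𝓜.nonneg_of_orthogonal_null ξ.1 hn hT hnv).2 hvv
    refine ⟨c, ?_⟩
    rw [← hG, ← hv, hc, map_smul, ← hP, map_smul, 𝓜.coordMetric_coordSharp hy1]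

end SpaceTime

/-- The chain rule for a function along a curve in a manifold. -/
theorem hasDerivWithinAt_comp_curve {E H M W : Type*} [NormedAddCommGroup E] [NormedSpace ℝ E]
    [TopologicalSpace H] {I : ModelWithCorners ℝ E H} [TopologicalSpace M] [ChartedSpace H M]
    [NormedAddCommGroup W] [NormedSpace ℝ W] {f : M → W} {γ : ℝ → M} {S : Set ℝ} {s : ℝ}
    {v : TangentSpace I (γ s)} (hf : MDifferentiableAt I 𝓘(ℝ, W) f (γ s))
    (hγ : HasMFDerivWithinAt 𝓘(ℝ, ℝ) I γ S s ((1 : ℝ →L[ℝ] ℝ).smulRight v)) :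
    HasDerivWithinAt (fun s => f (γ s)) (show W from mfderiv I 𝓘(ℝ, W) f (γ s) v) S s := by
  have h1 := hf.hasMFDerivAt.comp_hasMFDerivWithinAt s hγ
  let L : ℝ →L[ℝ] W := (mfderiv I 𝓘(ℝ, W) f (γ s)).comp ((1 : ℝ →L[ℝ] ℝ).smulRight v)
  have h2 : HasFDerivWithinAt (fun s => f (γ s)) L S s := h1.hasFDerivWithinAt
  have h3 : L 1 = mfderiv I 𝓘(ℝ, W) f (γ s) v :=
    congrArg (mfderiv I 𝓘(ℝ, W) f (γ s)) (one_smul ℝ v)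
  have h4 : HasDerivWithinAt (fun s => f (γ s)) (L 1) S s := h2.hasDerivWithinAt
  rw [h3] at h4
  exact h4

namespace SpaceTime

variable {M : Type*} [TopologicalSpace M] [ChartedSpace E4 M] [IsManifold 𝓘(ℝ, E4) ∞ M]
  (𝓜 : SpaceTime M)

/-! ### The flow of the geodesic spray on null covectors -/

theorem dH_geodesicSpray (ξ : CotangentBundle M) : 𝓜.dH ξ (𝓜.geodesicSpray ξ) = 0 := by
  have h := 𝓜.geodesicSpray_spec ξ (𝓜.geodesicSpray ξ)
  have h1 : symplecticForm ξ (𝓜.geodesicSpray ξ) (𝓜.geodesicSpray ξ) = 0 := sub_self _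
  linarith

theorem snd_eq_zero_of_null {ξ : CotangentBundle M} (hH : 𝓜.hamiltonian ξ = 0)
    (hT : 𝓜.timePairing ξ = 0) : ξ.2 = 0 := by
  have h0 : 𝓜.sharp ξ.1 ξ.2 = 0 := by
    by_contra hne
    have h1 : 𝓜.g ξ.1 (𝓜.T ξ.1) (𝓜.sharp ξ.1 ξ.2) = 0 := by
      rw [𝓜.symm, 𝓜.g_sharp]; exact hT
    have h2 := 𝓜.lorentzian ξ.1 _ h1 hne
    rw [𝓜.g_sharp] at h2
    rw [hamiltonian] at hH
    linarith
  rw [← 𝓜.g_sharp ξ.1 ξ.2, h0, map_zero]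

/-- `H` is quadratic in the momentum, so its differential vanishes on the zero section; these points
are stationary for the flow. -/
theorem geodesicSpray_eq_zero {ξ : CotangentBundle M} (h0 : ξ.2 = 0) : 𝓜.geodesicSpray ξ = 0 := by
  have hmem : ξ ∈ (extChartAt cotangentModel ξ).source := mem_extChartAt_source ξ
  have hy := (extChartAt cotangentModel ξ).map_source hmem
  have hb : ξ.1 ∈ (chartAt E4 ξ.1).source := mem_chart_source E4 ξ.1
  have hy2 : (extChartAt cotangentModel ξ ξ).2 = 0 := by
    ext u
    obtain ⟨w, rfl⟩ := surjective_chartDeriv (I := 𝓘(ℝ, E4)) (x₀ := ξ.1) (x := ξ.1)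
      (mem_extChartAt_source ξ.1) u
    rw [cotangent_chart_snd ξ ξ hb, h0]
    rfl
  have hP : 𝓜.coordSharp ξ.1 (extChartAt cotangentModel ξ ξ) = 0 := by
    rw [coordSharp, hy2, map_zero]
  have hd : fderiv ℝ (𝓜.coordHamiltonian ξ) (extChartAt cotangentModel ξ ξ) = 0 := by
    have h1 : HasFDerivAt (𝓜.coordSharp ξ.1) _ (extChartAt cotangentModel ξ ξ) :=
      (((𝓜.contDiffOn_coordSharp ξ).contDiffAt
        ((isOpen_extChartAt_target ξ).mem_nhds hy)).differentiableAt (by simp)).hasFDerivAt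
    have h2 : HasFDerivAt (𝓜.coordHamiltonian ξ) _ (extChartAt cotangentModel ξ ξ) :=
      ((hasFDerivAt_snd.clm_apply h1).const_mul (1 / 2)).congr_of_eventuallyEq (by
        filter_upwards [(isOpen_extChartAt_target ξ).mem_nhds hy] with z hz
        using 𝓜.coordHamiltonian_eq hz)
    rw [h2.fderiv, hy2, hP]
    ext Z <;> simp
  have h := 𝓜.chartDeriv_geodesicSpray hmem
  rw [chartDeriv_self] at h
  have h3 : phaseSpray (𝓜.coordHamiltonian ξ) (𝓜.coordSharp ξ.1)
      (extChartAt cotangentModel ξ ξ) = 0 := by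
    rw [phaseSpray, hP, hd]
    simp
  rw [h]
  exact h3

variable {γ : ℝ → CotangentBundle M} {a b : ℝ}

theorem hamiltonian_eq_of_integralCurve
    (hγ : IsMIntegralCurveOn (I := cotangentModel) γ 𝓜.geodesicSpray (Icc a b)) {t : ℝ}
    (ht : t ∈ Icc a b) : 𝓜.hamiltonian (γ t) = 𝓜.hamiltonian (γ a) := by
  have hd : ∀ s ∈ Icc a b, HasDerivWithinAt (fun s => 𝓜.hamiltonian (γ s)) 0 (Icc a b) s := by
    intro s hs
    have h3 : HasDerivWithinAt (fun s => 𝓜.hamiltonian (γ s))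
        (𝓜.dH (γ s) (𝓜.geodesicSpray (γ s))) (Icc a b) s :=
      hasDerivWithinAt_comp_curve ((𝓜.contMDiff_hamiltonian (γ s)).mdifferentiableAt (by simp))
        (hγ s hs)
    rwa [𝓜.dH_geodesicSpray] at h3
  refine constant_of_derivWithin_zero (fun s hs => (hd s hs).differentiableWithinAt) ?_ t ht
  intro s hs
  have hab : a < b := hs.1.trans_lt hs.2
  exact (hd s (Ico_subset_Icc_self hs)).derivWithin (uniqueDiffOn_Icc hab s (Ico_subset_Icc_self hs))

/-- `JoinedByFlow` constrains only the end points of an integral curve. In between, the time pairing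
could lose its sign only by vanishing, and a null covector with zero pairing is zero. The zero
section is stationary, so by uniqueness the curve would be stuck there. -/
theorem mem_nullBundle_of_integralCurve
    (hγ : IsMIntegralCurveOn (I := cotangentModel) γ 𝓜.geodesicSpray (Icc a b))
    (ha : γ a ∈ 𝓜.nullBundle) (hb : γ b ∈ 𝓜.nullBundle) {t : ℝ} (ht : t ∈ Icc a b) :
    γ t ∈ 𝓜.nullBundle := by
  rw [mem_nullBundle_iff] at ha hb ⊢
  have hH : ∀ s ∈ Icc a b, 𝓜.hamiltonian (γ s) = 0 := fun s hs => by
    rw [𝓜.hamiltonian_eq_of_integralCurve hγ hs, ha.1]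
  refine ⟨hH t ht, ?_⟩
  have hc : ContinuousOn (fun s => 𝓜.timePairing (γ s)) (Icc a b) :=
    𝓜.continuous_timePairing.comp_continuousOn hγ.continuousOn
  by_contra hlt
  push Not at hlt
  have hat : a ≤ t := ht.1
  obtain ⟨t₀, ht₀, hz⟩ : ∃ t₀ ∈ Icc a t, 𝓜.timePairing (γ t₀) = 0 :=
    intermediate_value_Icc hat (hc.mono (Icc_subset_Icc_right ht.2)) ⟨ha.2.le, hlt⟩
  have ht₀' : t₀ ∈ Ioo a b := by
    refine ⟨lt_of_le_of_ne ht₀.1 ?_, lt_of_le_of_ne (ht₀.2.trans ht.2) ?_⟩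
    · rintro rfl; exact ha.2.ne hz
    · rintro rfl; exact hb.2.ne hz
  have hco : ContinuousOn (fun s => 𝓜.timePairing (γ s)) (Ioo a b) := hc.mono Ioo_subset_Icc_self
  have hopen : ∀ s ∈ Ioo a b, 𝓜.timePairing (γ s) = 0 →
      ∀ᶠ r in 𝓝 s, 𝓜.timePairing (γ r) = 0 := by
    intro s hs hzs
    have h2 := 𝓜.snd_eq_zero_of_null (hH s (Ioo_subset_Icc_self hs)) hzs
    have h3 := 𝓜.geodesicSpray_eq_zero h2
    have h4 : IsMIntegralCurveAt (I := cotangentModel) (fun _ : ℝ => γ s) 𝓜.geodesicSpray s := by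
      refine Eventually.of_forall fun r => ?_
      have := hasMFDerivAt_const (I := 𝓘(ℝ, ℝ)) (I' := cotangentModel) (γ s) r
      have e : (1 : ℝ →L[ℝ] ℝ).smulRight (𝓜.geodesicSpray (γ s)) = 0 := by
        rw [h3]; ext; simp
      change HasMFDerivAt 𝓘(ℝ, ℝ) cotangentModel (fun _ : ℝ => γ s) r
        ((1 : ℝ →L[ℝ] ℝ).smulRight (𝓜.geodesicSpray (γ s)))
      rw [e]
      exact this
    have h5 : IsMIntegralCurveAt (I := cotangentModel) γ 𝓜.geodesicSpray s :=
      hγ.isMIntegralCurveAt (Icc_mem_nhds hs.1 hs.2)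
    have h6 := isMIntegralCurveAt_eventuallyEq_of_contMDiffAt_boundaryless
      (𝓜.contMDiff_geodesicSpray (γ s)) h5 h4 rfl
    filter_upwards [h6] with r hr
    rw [hr, hzs]
  -- The zeros of the pairing form an open and relatively closed non-empty subset of the connected
  -- interval.
  have hsub : Ioo a b ⊆ interior {s | 𝓜.timePairing (γ s) = 0} := by
    refine isPreconnected_Ioo.subset_left_of_subset_union isOpen_interior
      (hco.isOpen_inter_preimage isOpen_Ioo isOpen_compl_singleton (t := {0}ᶜ)) ?_ ?_
      ⟨t₀, ht₀', mem_interior_iff_mem_nhds.2 (hopen t₀ ht₀' hz)⟩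
    · rw [disjoint_left]
      intro s hs hs'
      exact hs'.2 (interior_subset (s := {s | 𝓜.timePairing (γ s) = 0}) hs)
    · intro s hs
      by_cases h : 𝓜.timePairing (γ s) = 0
      · exact Or.inl (mem_interior_iff_mem_nhds.2 (hopen s hs h))
      · exact Or.inr ⟨hs, h⟩
  have hab : a < b := ht₀'.1.trans ht₀'.2
  -- Continuity carries the vanishing to the end point `a`, where the pairing is negative.
  have hlim : Tendsto (fun s => 𝓜.timePairing (γ s)) (𝓝[Ioo a b] a) (𝓝 (𝓜.timePairing (γ a))) :=
    ((hc a (left_mem_Icc.2 hab.le)).mono Ioo_subset_Icc_self).tendsto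
  have hne : (𝓝[Ioo a b] a).NeBot := left_nhdsWithin_Ioo_neBot hab
  have h0 : 𝓜.timePairing (γ a) = 0 := by
    refine tendsto_nhds_unique hlim (tendsto_const_nhds.congr' ?_)
    filter_upwards [self_mem_nhdsWithin] with s hs
    exact (interior_subset (hsub hs)).symm
  exact ha.2.ne h0

theorem toGeodesic_eq_of_integralCurve
    (hγ : IsMIntegralCurveOn (I := cotangentModel) γ 𝓜.geodesicSpray (Icc a b))
    (hab : a ≤ b) (ha : γ a ∈ 𝓜.nullBundle) (hb : γ b ∈ 𝓜.nullBundle) :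
    𝓜.toGeodesic ⟨γ a, ha⟩ = 𝓜.toGeodesic ⟨γ b, hb⟩ :=
  Quot.sound (Or.inr ⟨γ, a, b, hab, rfl, rfl, hγ⟩)

theorem exists_integralCurve {ξ : CotangentBundle M} (hξ : ξ ∈ 𝓜.nullBundle) :
    ∃ γ : ℝ → CotangentBundle M, γ 0 = ξ ∧
      HasMFDerivAt 𝓘(ℝ, ℝ) cotangentModel γ 0 ((1 : ℝ →L[ℝ] ℝ).smulRight (𝓜.geodesicSpray (γ 0))) ∧
      ∀ᶠ t in 𝓝 0, ∃ h : γ t ∈ 𝓜.nullBundle, 𝓜.toGeodesic ⟨γ t, h⟩ = 𝓜.toGeodesic ⟨ξ, hξ⟩ := by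
  obtain ⟨γ, rfl, hγ⟩ := exists_isMIntegralCurveAt_of_contMDiffAt_boundaryless 0
    (𝓜.contMDiff_geodesicSpray ξ)
  refine ⟨γ, rfl, hγ.hasMFDerivAt, ?_⟩
  obtain ⟨ε, hε, hγε⟩ := isMIntegralCurveAt_iff'.1 hγ
  have hT : ∀ᶠ t in 𝓝 (0 : ℝ), 𝓜.timePairing (γ t) < 0 :=
    (𝓜.continuous_timePairing.continuousAt.comp hγ.continuousAt).eventually_lt_const
      ((𝓜.mem_nullBundle_iff _).1 hξ).2
  have hH0 := ((𝓜.mem_nullBundle_iff _).1 hξ).1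
  filter_upwards [hT, Metric.ball_mem_nhds (0 : ℝ) hε] with t ht htε
  rw [Real.ball_eq_Ioo] at htε hγε
  rcases le_total 0 t with h | h
  · have h1 : IsMIntegralCurveOn (I := cotangentModel) γ 𝓜.geodesicSpray (Icc 0 t) :=
      hγε.mono fun s hs => ⟨by linarith [hs.1, htε.1], by linarith [hs.2, htε.2]⟩
    have hN : γ t ∈ 𝓜.nullBundle := (𝓜.mem_nullBundle_iff _).2
      ⟨by rw [𝓜.hamiltonian_eq_of_integralCurve h1 ⟨h, le_rfl⟩, hH0], ht⟩
    exact ⟨hN, (𝓜.toGeodesic_eq_of_integralCurve h1 h hξ hN).symm⟩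
  · have h1 : IsMIntegralCurveOn (I := cotangentModel) γ 𝓜.geodesicSpray (Icc t 0) :=
      hγε.mono fun s hs => ⟨by linarith [hs.1, htε.1], by linarith [hs.2, htε.2]⟩
    have hN : γ t ∈ 𝓜.nullBundle := (𝓜.mem_nullBundle_iff _).2
      ⟨by rw [← 𝓜.hamiltonian_eq_of_integralCurve h1 ⟨h, le_rfl⟩, hH0], ht⟩
    exact ⟨hN, 𝓜.toGeodesic_eq_of_integralCurve h1 h hN hξ⟩

end SpaceTime

namespace SpaceTime

variable {M : Type*} [TopologicalSpace M] [ChartedSpace E4 M] [IsManifold 𝓘(ℝ, E4) ∞ M]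
  (𝓜 : SpaceTime M)

/-! ### Local representatives of charts of the space of null geodesics -/

theorem finrank_null : Module.finrank ℝ E5 + 3 = 2 * Module.finrank ℝ E4 := by simp

theorem smul_mem_nullBundle {ξ : CotangentBundle M} (hξ : ξ ∈ 𝓜.nullBundle) {c : ℝ} (hc : 0 < c) :
    (⟨ξ.1, c • ξ.2⟩ : CotangentBundle M) ∈ 𝓜.nullBundle := by
  rw [mem_nullBundle_iff] at hξ ⊢
  obtain ⟨h1, h2⟩ := hξ
  constructor
  · rw [hamiltonian] at h1 ⊢
    have : 𝓜.sharp ξ.1 (c • ξ.2) = c • 𝓜.sharp ξ.1 ξ.2 := map_smul _ c ξ.2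
    change (1 / 2) * (c • ξ.2) (𝓜.sharp ξ.1 (c • ξ.2)) = 0
    rw [this, map_smul, smul_apply, smul_eq_mul, smul_eq_mul]
    linear_combination c * c * h1
  · exact mul_neg_of_pos_of_neg hc h2

theorem toGeodesic_smul {ξ : CotangentBundle M} (hξ : ξ ∈ 𝓜.nullBundle) {c : ℝ} (hc : 0 < c) :
    𝓜.toGeodesic ⟨_, 𝓜.smul_mem_nullBundle hξ hc⟩ = 𝓜.toGeodesic ⟨ξ, hξ⟩ := by
  have h : 𝓜.JoinedByFlow ⟨ξ, hξ⟩ ⟨_, 𝓜.smul_mem_nullBundle hξ hc⟩ := Or.inl ⟨c, hc, rfl⟩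
  exact (Quot.sound h).symm

theorem cotangent_chart_smul {ξ₀ ξ : CotangentBundle M}
    (hξ : ξ ∈ (extChartAt cotangentModel ξ₀).source) (c : ℝ) :
    extChartAt cotangentModel ξ₀ ⟨ξ.1, c • ξ.2⟩ = ((extChartAt cotangentModel ξ₀ ξ).1,
      c • (extChartAt cotangentModel ξ₀ ξ).2) := by
  rw [cotangent_source] at hξ
  refine Prod.ext ?_ ?_
  · rw [cotangent_chart_fst, cotangent_chart_fst]
  · ext u
    obtain ⟨w, rfl⟩ := surjective_chartDeriv (I := 𝓘(ℝ, E4)) (x₀ := ξ₀.1) (x := ξ.1)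
      (by rw [extChartAt_source]; exact hξ) u
    have h1 := cotangent_chart_snd ξ₀ ⟨ξ.1, c • ξ.2⟩ hξ w
    have h2 := cotangent_chart_snd ξ₀ ξ hξ w
    rw [smul_apply, h2]
    exact h1

/-- The part of the coordinate domain that lies over the open set `W`. -/
def repDomain (ξ₀ : CotangentBundle M) (W : Set (CotangentBundle M)) :
    Set (E4 × (E4 →L[ℝ] ℝ)) :=
  𝓜.coordDomain ξ₀ ∩ ((extChartAt cotangentModel ξ₀).target ∩
    (extChartAt cotangentModel ξ₀).symm ⁻¹' W)

theorem isOpen_repDomain (ξ₀ : CotangentBundle M) {W : Set (CotangentBundle M)} (hW : IsOpen W) :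
    IsOpen (𝓜.repDomain ξ₀ W) :=
  (𝓜.isOpen_coordDomain ξ₀).inter
    ((continuousOn_extChartAt_symm ξ₀).isOpen_inter_preimage (isOpen_extChartAt_target ξ₀) hW)

theorem isNullModel_repDomain (ξ₀ : CotangentBundle M) {W : Set (CotangentBundle M)}
    (hW : IsOpen W) :
    IsNullModel (𝓜.repDomain ξ₀ W) (𝓜.coordHamiltonian ξ₀) (𝓜.coordSharp ξ₀.1) :=
  (𝓜.isNullModel ξ₀).mono inter_subset_left (𝓜.isOpen_repDomain ξ₀ hW)

theorem chart_mem_repDomain {ξ₀ ξ : CotangentBundle M} {W : Set (CotangentBundle M)}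
    (hξ : ξ ∈ (extChartAt cotangentModel ξ₀).source) (hN : ξ ∈ 𝓜.nullBundle) (hW : ξ ∈ W) :
    extChartAt cotangentModel ξ₀ ξ ∈ 𝓜.repDomain ξ₀ W :=
  ⟨(𝓜.chart_mem_coordDomain hξ hN).1, (extChartAt cotangentModel ξ₀).map_source hξ, by
    rwa [mem_preimage, (extChartAt cotangentModel ξ₀).left_inv hξ]⟩

variable {e : 𝓜.NullGeodesics → E5} {F : CotangentBundle M → E5} {W : Set (CotangentBundle M)}

/-- On `N'M` the function `F` depends only on the geodesic, so it is constant along integral curves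
of the spray and along rays in the fibre. Differentiating along these curves gives the two
equations, on `{H = 0}` only. -/
theorem isLeafFunction_of_rep (ξ₀ : CotangentBundle M) (hW : IsOpen W)
    (hF : ContMDiffOn cotangentModel 𝓘(ℝ, E5) ∞ F W)
    (he : ∀ η : 𝓜.nullBundle, (η : CotangentBundle M) ∈ W → F η = e (𝓜.toGeodesic η)) :
    IsLeafFunction (𝓜.repDomain ξ₀ W) (𝓜.coordHamiltonian ξ₀) (𝓜.coordSharp ξ₀.1)
      (F ∘ (extChartAt cotangentModel ξ₀).symm) := by
  have hFy : ∀ y ∈ 𝓜.repDomain ξ₀ W,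
      ContMDiffAt cotangentModel 𝓘(ℝ, E5) ∞ F ((extChartAt cotangentModel ξ₀).symm y) :=
    fun y hy => hF.contMDiffAt (hW.mem_nhds hy.2.2)
  have hsm : ∀ y ∈ 𝓜.repDomain ξ₀ W,
      ContDiffAt ℝ ∞ (F ∘ (extChartAt cotangentModel ξ₀).symm) y := by
    intro y hy
    have h1 := (hFy y hy).contDiffAt_comp_extChartAt_symm
      ((extChartAt cotangentModel ξ₀).map_target hy.1.1)
    rwa [(extChartAt cotangentModel ξ₀).right_inv hy.1.1] at h1
  refine ⟨fun y hy => (hsm y hy).contDiffWithinAt, ?_, ?_⟩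
  · intro y hy h0
    have hs := (extChartAt cotangentModel ξ₀).map_target hy.1.1
    have hyy := (extChartAt cotangentModel ξ₀).right_inv hy.1.1
    have hN := 𝓜.symm_mem_nullBundle hy.1 h0
    have hFd := (hFy y hy).mdifferentiableAt (by simp)
    have hWη : (extChartAt cotangentModel ξ₀).symm y ∈ W := hy.2.2
    set η := (extChartAt cotangentModel ξ₀).symm y with hη
    obtain ⟨γ, hγ0, hγ, hev⟩ := 𝓜.exists_integralCurve hN
    rw [← hγ0] at hFd
    have h1 := hasDerivWithinAt_comp_curve hFd hγ.hasMFDerivWithinAt (S := univ)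
    rw [hasDerivWithinAt_univ] at h1
    have h2 : (fun t => F (γ t)) =ᶠ[𝓝 0] fun _ => F η := by
      have hWev : ∀ᶠ t in 𝓝 (0 : ℝ), γ t ∈ W :=
        hγ.continuousAt.eventually_mem (hW.mem_nhds (by rw [hγ0]; exact hWη))
      filter_upwards [hev, hWev] with t ht htW
      obtain ⟨htN, htγ⟩ := ht
      rw [he ⟨γ t, htN⟩ htW, htγ, he ⟨η, hN⟩ hWη]
    have h3 := h1.unique ((hasDerivAt_const (0 : ℝ) (F η)).congr_of_eventuallyEq h2)
    have h4 := mfderiv_eq_fderiv_comp hFd (x₀ := ξ₀) (by rw [hγ0]; exact hs)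
      (𝓜.geodesicSpray (γ 0))
    rw [𝓜.chartDeriv_geodesicSpray (by rw [hγ0]; exact hs)] at h4
    rw [hγ0, hyy] at h4
    rw [← h4, ← hγ0]
    exact h3
  · intro y hy h0
    have hs := (extChartAt cotangentModel ξ₀).map_target hy.1.1
    have hyy := (extChartAt cotangentModel ξ₀).right_inv hy.1.1
    have hN := 𝓜.symm_mem_nullBundle hy.1 h0
    have hWη : (extChartAt cotangentModel ξ₀).symm y ∈ W := hy.2.2
    set η := (extChartAt cotangentModel ξ₀).symm y with hη
    have hc : HasDerivAt (fun t : ℝ => (y.1, (1 + t) • y.2)) (phaseEuler y) 0 := by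
      have h1 : HasDerivAt (fun t : ℝ => (1 + t) • y.2) ((1 : ℝ) • y.2) 0 :=
        ((hasDerivAt_id (0 : ℝ)).const_add 1).smul_const y.2
      rw [one_smul] at h1
      exact (hasDerivAt_const (0 : ℝ) y.1).prodMk h1
    have hc0 : (fun t : ℝ => (y.1, (1 + t) • y.2)) 0 = y := by simp
    have hFd : HasFDerivAt (F ∘ (extChartAt cotangentModel ξ₀).symm)
        (fderiv ℝ (F ∘ (extChartAt cotangentModel ξ₀).symm) y)
        ((fun t : ℝ => (y.1, (1 + t) • y.2)) 0) := by
      rw [hc0]; exact ((hsm y hy).differentiableAt (by simp)).hasFDerivAt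
    have h1 := hFd.comp_hasDerivAt (0 : ℝ) hc
    have h2 : ((F ∘ (extChartAt cotangentModel ξ₀).symm) ∘ fun t : ℝ => (y.1, (1 + t) • y.2))
        =ᶠ[𝓝 0] fun _ => F η := by
      have hev : ∀ᶠ t in 𝓝 (0 : ℝ), (y.1, (1 + t) • y.2) ∈ 𝓜.repDomain ξ₀ W :=
        hc.continuousAt.eventually_mem
          ((𝓜.isOpen_repDomain ξ₀ hW).mem_nhds (by simpa using hy))
      filter_upwards [hev, lt_mem_nhds (show (-1 : ℝ) < 0 by norm_num)] with t ht ht1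
      have ht0 : 0 < 1 + t := by linarith
      have h3 := cotangent_chart_smul hs (1 + t)
      rw [hyy] at h3
      have hs' : (⟨η.1, (1 + t) • η.2⟩ : CotangentBundle M) ∈
          (extChartAt cotangentModel ξ₀).source := by
        rw [cotangent_source] at hs ⊢; exact hs
      have h4 : (extChartAt cotangentModel ξ₀).symm (y.1, (1 + t) • y.2)
          = ⟨η.1, (1 + t) • η.2⟩ := by
        rw [← h3, (extChartAt cotangentModel ξ₀).left_inv hs']
      have h5 : (extChartAt cotangentModel ξ₀).symm (y.1, (1 + t) • y.2) ∈ W := ht.2.2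
      rw [h4] at h5
      rw [Function.comp_apply, Function.comp_apply, h4,
        he ⟨_, 𝓜.smul_mem_nullBundle hN ht0⟩ h5, 𝓜.toGeodesic_smul hN ht0, he ⟨η, hN⟩ hWη]
    exact h1.unique ((hasDerivAt_const (0 : ℝ) (F η)).congr_of_eventuallyEq h2)

end SpaceTime

namespace SpaceTime

variable {M : Type*} [TopologicalSpace M] [ChartedSpace E4 M] [IsManifold 𝓘(ℝ, E4) ∞ M]
  (𝓜 : SpaceTime M)

/-! ### The contact structure is constant along leaves -/

variable {e : OpenPartialHomeomorph 𝓜.NullGeodesics E5}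

theorem contMDiffAt_of_isLocalRep {ξ : 𝓜.nullBundle} {F : CotangentBundle M → E5}
    (hF : 𝓜.IsLocalRep e ξ F) : ContMDiffAt cotangentModel 𝓘(ℝ, E5) ∞ F ξ := by
  obtain ⟨W, hW, hξW, hFs, -⟩ := hF
  exact hFs.contMDiffAt (hW.mem_nhds hξW)

/-- Representatives are prescribed only on the hypersurface `N'M`, so their derivatives are
comparable only on its tangent space, the kernel of `dH`. -/
theorem mfderiv_eq_of_isLocalRep {ξ : 𝓜.nullBundle} {F F' : CotangentBundle M → E5}
    (hF : 𝓜.IsLocalRep e ξ F) (hF' : 𝓜.IsLocalRep e ξ F')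
    {X : TangentSpace cotangentModel (ξ : CotangentBundle M)} (hX : 𝓜.dH ξ X = 0) :
    (show E5 from mfderiv cotangentModel 𝓘(ℝ, E5) F ξ X)
      = mfderiv cotangentModel 𝓘(ℝ, E5) F' ξ X := by
  have hs : (ξ : CotangentBundle M) ∈ (extChartAt cotangentModel (ξ : CotangentBundle M)).source :=
    mem_extChartAt_source _
  have hc := 𝓜.contMDiffAt_of_isLocalRep hF
  have hc' := 𝓜.contMDiffAt_of_isLocalRep hF'
  have h1 := mfderiv_eq_fderiv_comp (hc.mdifferentiableAt (by simp)) hs X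
  have h2 := mfderiv_eq_fderiv_comp (hc'.mdifferentiableAt (by simp)) hs X
  obtain ⟨W, hW, hξW, hFs, hFe⟩ := hF
  obtain ⟨W', hW', hξW', hFs', hFe'⟩ := hF'
  obtain ⟨hy, hy0⟩ := 𝓜.chart_mem_coordDomain hs ξ.2
  have hM := 𝓜.isNullModel (ξ : CotangentBundle M)
  rw [𝓜.dH_eq hs] at hX
  obtain ⟨β, hβ⟩ := hM.exists_fderiv_eq_one hy hy0
  refine (h1.trans ?_).trans h2.symm
  refine fderiv_eq_of_eq_on_level (hM.smooth_H.contDiffAt (hM.isOpen.mem_nhds hy))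
    (hc.contDiffAt_comp_extChartAt_symm hs) (hc'.contDiffAt_comp_extChartAt_symm hs) hy0
    (fun h => by rw [h] at hβ; simp at hβ) ?_ hX
  filter_upwards [(𝓜.isOpen_repDomain _ (hW.inter hW')).mem_nhds
    (𝓜.chart_mem_repDomain hs ξ.2 ⟨hξW, hξW'⟩)] with z hz hz0
  have hN := 𝓜.symm_mem_nullBundle hz.1 hz0
  rw [Function.comp_apply, Function.comp_apply, hFe ⟨_, hN⟩ hz.2.2.1, hFe' ⟨_, hN⟩ hz.2.2.2]

theorem exists_mfderiv_eq (he : e ∈ 𝓜.atlas) {ξ : 𝓜.nullBundle} (hξ : 𝓜.toGeodesic ξ ∈ e.source)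
    {F : CotangentBundle M → E5} (hF : 𝓜.IsLocalRep e ξ F) (w : E5) :
    ∃ X : TangentSpace cotangentModel (ξ : CotangentBundle M),
      𝓜.dH ξ X = 0 ∧ mfderiv cotangentModel 𝓘(ℝ, E5) F ξ X = w := by
  obtain ⟨F', hF', hs⟩ := he ξ hξ
  obtain ⟨X, hX, hXw⟩ := hs w
  exact ⟨X, hX, (𝓜.mfderiv_eq_of_isLocalRep hF hF' hX).trans hXw⟩

/-- Every local representative gives a chart adapted to the leaves. -/
theorem exists_leafChart_of_rep (he : e ∈ 𝓜.atlas) {ξ : 𝓜.nullBundle}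
    (hξ : 𝓜.toGeodesic ξ ∈ e.source) {F : CotangentBundle M → E5} {W : Set (CotangentBundle M)}
    (hW : IsOpen W) (hξW : (ξ : CotangentBundle M) ∈ W)
    (hF : ContMDiffOn cotangentModel 𝓘(ℝ, E5) ∞ F W)
    (hFe : ∀ η : 𝓜.nullBundle, (η : CotangentBundle M) ∈ W → F η = e (𝓜.toGeodesic η)) :
    ∃ (K : Submodule ℝ (E4 × (E4 →L[ℝ] ℝ)))
      (C : LeafChart (𝓜.repDomain ξ W) (𝓜.coordHamiltonian ξ)
        (𝓜.coordSharp (ξ : CotangentBundle M).1)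
        (F ∘ (extChartAt cotangentModel (ξ : CotangentBundle M)).symm) K),
      extChartAt cotangentModel (ξ : CotangentBundle M) ξ ∈ C.Ω' := by
  have hs : (ξ : CotangentBundle M) ∈ (extChartAt cotangentModel (ξ : CotangentBundle M)).source :=
    mem_extChartAt_source _
  refine exists_leafChart (𝓜.isNullModel_repDomain ξ hW) (𝓜.isLeafFunction_of_rep ξ hW hF hFe)
    finrank_null (𝓜.chart_mem_repDomain hs ξ.2 hξW) (𝓜.chart_mem_coordDomain hs ξ.2).2 ?_
  intro w
  obtain ⟨X, hX, hXw⟩ := 𝓜.exists_mfderiv_eq he hξ ⟨W, hW, hξW, hF, hFe⟩ w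
  refine ⟨chartDeriv cotangentModel (ξ : CotangentBundle M) (ξ : CotangentBundle M) X,
    by rwa [𝓜.dH_eq hs] at hX, ?_⟩
  rw [← hXw]
  exact (mfderiv_eq_fderiv_comp ((hF.contMDiffAt (hW.mem_nhds hξW)).mdifferentiableAt (by simp))
    hs X).symm

/-- `w`, read in the chart `e`, lies in the image at `ξ` of the kernel of `θ`. -/
def IsContactVector (e : OpenPartialHomeomorph 𝓜.NullGeodesics E5) (ξ : 𝓜.nullBundle) (w : E5) :
    Prop :=
  ∃ (F : CotangentBundle M → E5) (X : TangentSpace cotangentModel (ξ : CotangentBundle M)),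
    𝓜.IsLocalRep e ξ F ∧ 𝓜.dH ξ X = 0 ∧ canonicalForm (ξ : CotangentBundle M) X = 0 ∧
      mfderiv cotangentModel 𝓘(ℝ, E5) F ξ X = w

theorem exists_nhds_isContactVector (he : e ∈ 𝓜.atlas) {ξ : 𝓜.nullBundle}
    (hξ : 𝓜.toGeodesic ξ ∈ e.source) {F : CotangentBundle M → E5} (hF : 𝓜.IsLocalRep e ξ F) :
    ∃ U ∈ 𝓝 (ξ : CotangentBundle M), (∀ η : 𝓜.nullBundle, (η : CotangentBundle M) ∈ U →
        𝓜.IsLocalRep e η F) ∧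
      ∀ η₁ η₂ : 𝓜.nullBundle, (η₁ : CotangentBundle M) ∈ U → (η₂ : CotangentBundle M) ∈ U →
        𝓜.toGeodesic η₁ = 𝓜.toGeodesic η₂ →
        ∀ (X₁ : TangentSpace cotangentModel (η₁ : CotangentBundle M))
          (X₂ : TangentSpace cotangentModel (η₂ : CotangentBundle M)),
          𝓜.dH η₁ X₁ = 0 → 𝓜.dH η₂ X₂ = 0 →
          (show E5 from mfderiv cotangentModel 𝓘(ℝ, E5) F η₁ X₁)
            = mfderiv cotangentModel 𝓘(ℝ, E5) F η₂ X₂ →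
          canonicalForm (η₁ : CotangentBundle M) X₁ = 0 →
          canonicalForm (η₂ : CotangentBundle M) X₂ = 0 := by
  obtain ⟨W, hW, hξW, hFs, hFe⟩ := hF
  have hs : (ξ : CotangentBundle M) ∈ (extChartAt cotangentModel (ξ : CotangentBundle M)).source :=
    mem_extChartAt_source _
  obtain ⟨K, C, hC⟩ := 𝓜.exists_leafChart_of_rep he hξ hW hξW hFs hFe
  obtain ⟨U, hU, hU'⟩ := C.exists_nhds_canonical_eq_zero (𝓜.isNullModel_repDomain _ hW)
    (𝓜.isLeafFunction_of_rep _ hW hFs hFe) hC (𝓜.chart_mem_coordDomain hs ξ.2).2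
  refine ⟨(extChartAt cotangentModel (ξ : CotangentBundle M)).source ∩ W ∩
    extChartAt cotangentModel (ξ : CotangentBundle M) ⁻¹' U,
    inter_mem (inter_mem (extChartAt_source_mem_nhds _) (hW.mem_nhds hξW))
      ((continuousAt_extChartAt _).preimage_mem_nhds hU),
    fun η hη => ⟨W, hW, hη.1.2, hFs, hFe⟩, ?_⟩
  intro η₁ η₂ h₁ h₂ hg X₁ X₂ hX₁ hX₂ hw hθ
  have hd : ∀ η : 𝓜.nullBundle, (η : CotangentBundle M) ∈
      (extChartAt cotangentModel (ξ : CotangentBundle M)).source ∩ W →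
      ∀ X : TangentSpace cotangentModel (η : CotangentBundle M),
      (show E5 from mfderiv cotangentModel 𝓘(ℝ, E5) F η X) = fderiv ℝ
        (F ∘ (extChartAt cotangentModel (ξ : CotangentBundle M)).symm)
        (extChartAt cotangentModel (ξ : CotangentBundle M) η)
        (chartDeriv cotangentModel (ξ : CotangentBundle M) (η : CotangentBundle M) X) :=
    fun η hη X => mfderiv_eq_fderiv_comp
      ((hFs.contMDiffAt (hW.mem_nhds hη.2)).mdifferentiableAt (by simp)) hη.1 X
  have hFη : ∀ η : 𝓜.nullBundle, (η : CotangentBundle M) ∈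
      (extChartAt cotangentModel (ξ : CotangentBundle M)).source ∩ W →
      (F ∘ (extChartAt cotangentModel (ξ : CotangentBundle M)).symm)
        (extChartAt cotangentModel (ξ : CotangentBundle M) η) = e (𝓜.toGeodesic η) := by
    intro η hη
    rw [Function.comp_apply, (extChartAt cotangentModel (ξ : CotangentBundle M)).left_inv hη.1,
      hFe η hη.2]
  have hb : ∀ η : 𝓜.nullBundle, (η : CotangentBundle M) ∈
      (extChartAt cotangentModel (ξ : CotangentBundle M)).source → (η : CotangentBundle M).1 ∈
        (chartAt E4 (ξ : CotangentBundle M).1).source := by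
    intro η hη
    rw [cotangent_source] at hη
    exact hη
  rw [canonicalForm_eq ξ _ (hb η₁ h₁.1.1)] at hθ
  rw [canonicalForm_eq ξ _ (hb η₂ h₂.1.1)]
  rw [𝓜.dH_eq h₁.1.1] at hX₁
  rw [𝓜.dH_eq h₂.1.1] at hX₂
  refine hU' _ h₁.2 _ h₂.2 (𝓜.chart_mem_coordDomain h₁.1.1 η₁.2).2
    (𝓜.chart_mem_coordDomain h₂.1.1 η₂.2).2 ?_ _ _ hX₁ hX₂ ?_ hθ
  · rw [hFη η₁ h₁.1, hFη η₂ h₂.1, hg]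
  · rw [← hd η₁ h₁.1, ← hd η₂ h₂.1]
    exact hw

/-- Whether `θ` vanishes on a tangent vector of `N'M` depends only on the projection of the vector,
since lifts of one vector differ by leaf directions. This is the local comparison with both base
points equal. -/
theorem canonicalForm_eq_zero_of_isContactVector (he : e ∈ 𝓜.atlas) {ξ : 𝓜.nullBundle}
    (hξ : 𝓜.toGeodesic ξ ∈ e.source) {F : CotangentBundle M → E5} (hF : 𝓜.IsLocalRep e ξ F)
    {w : E5} (hw : 𝓜.IsContactVector e ξ w)
    {X : TangentSpace cotangentModel (ξ : CotangentBundle M)} (hX : 𝓜.dH ξ X = 0)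
    (hXw : mfderiv cotangentModel 𝓘(ℝ, E5) F ξ X = w) :
    canonicalForm (ξ : CotangentBundle M) X = 0 := by
  obtain ⟨F', X', hF', hX', hθ, hw'⟩ := hw
  obtain ⟨U, hU, -, hU'⟩ := 𝓜.exists_nhds_isContactVector he hξ hF
  refine hU' ξ ξ (mem_of_mem_nhds hU) (mem_of_mem_nhds hU) rfl X' X hX' hX ?_ hθ
  exact ((𝓜.mfderiv_eq_of_isLocalRep hF hF' hX').trans hw').trans hXw.symm

theorem exists_nhds_isContactVector_imp (he : e ∈ 𝓜.atlas) {ξ : 𝓜.nullBundle}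
    (hξ : 𝓜.toGeodesic ξ ∈ e.source) :
    ∃ U ∈ 𝓝 (ξ : CotangentBundle M),
      ∀ η₁ η₂ : 𝓜.nullBundle, (η₁ : CotangentBundle M) ∈ U → (η₂ : CotangentBundle M) ∈ U →
        𝓜.toGeodesic η₁ = 𝓜.toGeodesic η₂ → 𝓜.toGeodesic η₂ ∈ e.source →
        ∀ w, 𝓜.IsContactVector e η₁ w → 𝓜.IsContactVector e η₂ w := by
  obtain ⟨F, hF, -⟩ := he ξ hξ
  obtain ⟨U, hU, hrep, hU'⟩ := 𝓜.exists_nhds_isContactVector he hξ hF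
  refine ⟨U, hU, fun η₁ η₂ h₁ h₂ hg hs w hw => ?_⟩
  obtain ⟨X₁, hX₁, hX₁w⟩ := 𝓜.exists_mfderiv_eq he (hg ▸ hs) (hrep η₁ h₁) w
  obtain ⟨X₂, hX₂, hX₂w⟩ := 𝓜.exists_mfderiv_eq he hs (hrep η₂ h₂) w
  have hθ := 𝓜.canonicalForm_eq_zero_of_isContactVector he (hg ▸ hs) (hrep η₁ h₁) hw hX₁ hX₁w
  exact ⟨F, X₂, hrep η₂ h₂, hX₂,
    hU' η₁ η₂ h₁ h₂ hg X₁ X₂ hX₁ hX₂ (hX₁w.trans hX₂w.symm) hθ, hX₂w⟩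

/-- The local comparison makes the truth value locally constant along a path inside one leaf, and an
interval is connected. -/
theorem isContactVector_iff_of_path (he : e ∈ 𝓜.atlas) {γ : ℝ → CotangentBundle M} {a b : ℝ}
    (hab : a ≤ b) (hγ : ContinuousOn γ (Icc a b)) {g : 𝓜.NullGeodesics} (hg : g ∈ e.source)
    (hN : ∀ t ∈ Icc a b, ∃ h : γ t ∈ 𝓜.nullBundle, 𝓜.toGeodesic ⟨γ t, h⟩ = g) (w : E5)
    (ha : γ a ∈ 𝓜.nullBundle) (hb : γ b ∈ 𝓜.nullBundle) :
    𝓜.IsContactVector e ⟨γ a, ha⟩ w ↔ 𝓜.IsContactVector e ⟨γ b, hb⟩ w := by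
  choose hNm hNg using hN
  let φ : Icc a b → Prop := fun t => 𝓜.IsContactVector e ⟨γ t, hNm t t.2⟩ w
  have hφ : IsLocallyConstant φ := by
    rw [IsLocallyConstant.iff_eventually_eq]
    intro t
    obtain ⟨U, hU, hU'⟩ := 𝓜.exists_nhds_isContactVector_imp he
      (ξ := ⟨γ t, hNm t t.2⟩) (by rw [hNg t t.2]; exact hg)
    have hc : ContinuousAt (fun s : Icc a b => γ s) t :=
      (continuousOn_iff_continuous_domRestrict.1 hγ).continuousAt
    filter_upwards [hc.eventually_mem hU] with s hs
    have hgg : 𝓜.toGeodesic ⟨γ s, hNm s s.2⟩ = 𝓜.toGeodesic ⟨γ t, hNm t t.2⟩ := by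
      exact (hNg s s.2).trans (hNg t t.2).symm
    refine propext ⟨fun h => ?_, fun h => ?_⟩
    · exact hU' _ _ hs (mem_of_mem_nhds hU) hgg (by rw [hNg t t.2]; exact hg) w h
    · exact hU' _ _ (mem_of_mem_nhds hU) hs hgg.symm (by rw [hNg s s.2]; exact hg) w h
  have : PreconnectedSpace (Icc a b) := isPreconnected_iff_preconnectedSpace.1 isPreconnected_Icc
  exact iff_of_eq (hφ.apply_eq_of_preconnectedSpace ⟨a, left_mem_Icc.2 hab⟩ ⟨b, right_mem_Icc.2 hab⟩)

theorem isContactVector_iff_of_joined (he : e ∈ 𝓜.atlas) {ξ η : 𝓜.nullBundle}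
    (h : 𝓜.JoinedByFlow ξ η) (hs : 𝓜.toGeodesic ξ ∈ e.source) (w : E5) :
    𝓜.IsContactVector e ξ w ↔ 𝓜.IsContactVector e η w := by
  rcases h with ⟨c, hc, h⟩ | ⟨γ, a, b, hab, ha, hb, hγ⟩
  · obtain ⟨η, hη⟩ := η
    dsimp only at h
    subst h
    -- The straight segment from `p` to `c p` in the fibre; its scale factor stays positive because
    -- `c > 0`.
    let γ : ℝ → CotangentBundle M := fun t => ⟨ξ.1.1, (1 + t * (c - 1)) • ξ.1.2⟩
    have hpos : ∀ t ∈ Icc (0 : ℝ) 1, 0 < 1 + t * (c - 1) := by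
      intro t ht
      nlinarith [ht.1, ht.2, mul_nonneg ht.1 hc.le]
    have h0 : γ 0 = ξ := by simp [γ]
    have h1 : γ 1 = ⟨ξ.1.1, c • ξ.1.2⟩ := by simp [γ]
    have hcont : Continuous γ := by
      have hs' : ∀ t, γ t ∈ (extChartAt cotangentModel (ξ : CotangentBundle M)).source := by
        intro t
        rw [cotangent_source]
        exact mem_chart_source E4 ξ.1.1
      have hc' : Continuous fun t : ℝ => extChartAt cotangentModel (ξ : CotangentBundle M) (γ t) := by
        have : (fun t : ℝ => extChartAt cotangentModel (ξ : CotangentBundle M) (γ t)) = fun t =>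
            ((extChartAt cotangentModel (ξ : CotangentBundle M) ξ).1,
              (1 + t * (c - 1)) • (extChartAt cotangentModel (ξ : CotangentBundle M) ξ).2) :=
          funext fun t => cotangent_chart_smul (mem_extChartAt_source _) _
        rw [this]
        fun_prop
      have h2 : γ = fun t => (extChartAt cotangentModel (ξ : CotangentBundle M)).symm
          (extChartAt cotangentModel (ξ : CotangentBundle M) (γ t)) :=
        funext fun t => ((extChartAt cotangentModel (ξ : CotangentBundle M)).left_inv (hs' t)).symm
      rw [h2]
      exact (continuousOn_extChartAt_symm _).comp_continuous hc' fun t =>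
        (extChartAt cotangentModel (ξ : CotangentBundle M)).map_source (hs' t)
    have key := 𝓜.isContactVector_iff_of_path he (zero_le_one) hcont.continuousOn hs
      (fun t ht => ⟨𝓜.smul_mem_nullBundle ξ.2 (hpos t ht), 𝓜.toGeodesic_smul ξ.2 (hpos t ht)⟩) w
      (by rw [h0]; exact ξ.2) (by rw [h1]; exact hη)
    convert key using 2
    · exact Subtype.ext h0.symm
    · exact Subtype.ext h1.symm
  · have haN : γ a ∈ 𝓜.nullBundle := by rw [ha]; exact ξ.2
    have hbN : γ b ∈ 𝓜.nullBundle := by rw [hb]; exact η.2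
    have hξ : (⟨γ a, haN⟩ : 𝓜.nullBundle) = ξ := Subtype.ext ha
    have hη : (⟨γ b, hbN⟩ : 𝓜.nullBundle) = η := Subtype.ext hb
    rw [← hξ] at hs ⊢
    rw [← hη]
    refine 𝓜.isContactVector_iff_of_path he hab hγ.continuousOn hs (fun t ht => ?_) w haN hbN
    have htN := 𝓜.mem_nullBundle_of_integralCurve hγ haN hbN ht
    exact ⟨htN, (𝓜.toGeodesic_eq_of_integralCurve (hγ.mono (Icc_subset_Icc_right ht.2)) ht.1 haN
      htN).symm⟩

/-- Equality in the quotient is a finite chain of flow steps in either direction. The result makes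
`contactPlane`, a union over all covectors of the geodesic, computable at any one of them. -/
theorem isContactVector_iff_of_toGeodesic_eq (he : e ∈ 𝓜.atlas) {ξ η : 𝓜.nullBundle}
    (h : 𝓜.toGeodesic ξ = 𝓜.toGeodesic η) (hs : 𝓜.toGeodesic ξ ∈ e.source) (w : E5) :
    𝓜.IsContactVector e ξ w ↔ 𝓜.IsContactVector e η w := by
  have hE := Quot.eqvGen_exact h
  clear h
  induction hE with
  | rel x y h => exact 𝓜.isContactVector_iff_of_joined he h hs w
  | refl x => rfl
  | symm x y h ih =>
    have hxy : 𝓜.toGeodesic x = 𝓜.toGeodesic y := Quot.eqvGen_sound h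
    exact (ih (hxy ▸ hs)).symm
  | trans x y z h h' ih ih' =>
    have hxy : 𝓜.toGeodesic x = 𝓜.toGeodesic y := Quot.eqvGen_sound h
    exact (ih hs).trans (ih' (hxy ▸ hs))

/-- A tangent vector of `N'M` that projects into the contact plane is annihilated by `θ`. -/
theorem canonicalForm_eq_zero_of_mem_contactPlane (he : e ∈ 𝓜.atlas) {ξ : 𝓜.nullBundle}
    (hξ : 𝓜.toGeodesic ξ ∈ e.source) {F : CotangentBundle M → E5} (hF : 𝓜.IsLocalRep e ξ F)
    {X : TangentSpace cotangentModel (ξ : CotangentBundle M)} (hX : 𝓜.dH ξ X = 0)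
    (hXw : mfderiv cotangentModel 𝓘(ℝ, E5) F ξ X ∈ 𝓜.contactPlane e (𝓜.toGeodesic ξ)) :
    canonicalForm (ξ : CotangentBundle M) X = 0 := by
  obtain ⟨η, F', X', hη, hF', hX', hθ, hw⟩ := hXw
  have h1 : 𝓜.IsContactVector e η (mfderiv cotangentModel 𝓘(ℝ, E5) F ξ X) :=
    ⟨F', X', hF', hX', hθ, hw⟩
  have h2 := (𝓜.isContactVector_iff_of_toGeodesic_eq he hη (hη ▸ hξ) _).1 h1
  exact 𝓜.canonicalForm_eq_zero_of_isContactVector he hξ hF h2 hX rfl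

end SpaceTime

/-! ### Sweeping a family of leaves along the Hamiltonian field -/

section Sweep

variable {E V W K : Type*} [NormedAddCommGroup E] [NormedSpace ℝ E]
  [NormedAddCommGroup V] [NormedSpace ℝ V] [NormedAddCommGroup W] [NormedSpace ℝ W]
  [NormedAddCommGroup K] [NormedSpace ℝ K]
  {Ω : Set (E × (E →L[ℝ] ℝ))} {H : E × (E →L[ℝ] ℝ) → ℝ} {P : E × (E →L[ℝ] ℝ) → E}
  {F : E × (E →L[ℝ] ℝ) → W} {y : E × (E →L[ℝ] ℝ)}

namespace LeafChart

/-- The coordinates in a leaf chart of the family of points obtained from the family `ψ` of leaves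
by moving with constant speed along the leaves. -/
def sweepArg (C : LeafChart Ω H P F K) (ψ : V → W) (y : E × (E →L[ℝ] ℝ)) (z : V × ℝ) : W × K :=
  (ψ z.1, C.pr y + z.2 • C.pr (phaseSpray H P y))

/-- The family of points of `{H = 0}` on the leaves `ψ` that starts at `y`, and moves in the
direction of the Hamiltonian field there. -/
def sweep (C : LeafChart Ω H P F K) (ψ : V → W) (y : E × (E →L[ℝ] ℝ)) (z : V × ℝ) :
    E × (E →L[ℝ] ℝ) :=
  C.Q (C.sweepArg ψ y z)

variable (C : LeafChart Ω H P F K) {ψ : V → W}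

theorem contDiffAt_sweepArg {n : WithTop ℕ∞} {z : V × ℝ} (hψ : ContDiffAt ℝ n ψ z.1) :
    ContDiffAt ℝ n (C.sweepArg ψ y) z :=
  (hψ.comp z contDiffAt_fst).prodMk (contDiffAt_const.add (contDiffAt_snd.smul contDiffAt_const))

theorem contDiffAt_sweep {n : WithTop ℕ∞} (hn : n ≤ ∞) {z : V × ℝ} (hψ : ContDiffAt ℝ n ψ z.1)
    (hz : C.sweepArg ψ y z ∈ C.O) : ContDiffAt ℝ n (C.sweep ψ y) z :=
  ((C.smooth.contDiffAt (C.isOpen_O.mem_nhds hz)).of_le hn).comp z (C.contDiffAt_sweepArg hψ)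

theorem fderiv_sweep {z : V × ℝ} (hψ : DifferentiableAt ℝ ψ z.1) (hz : C.sweepArg ψ y z ∈ C.O)
    (n : V × ℝ) : fderiv ℝ (C.sweep ψ y) z n = fderiv ℝ C.Q (C.sweepArg ψ y z)
      (fderiv ℝ ψ z.1 n.1, n.2 • C.pr (phaseSpray H P y)) := by
  have h1 : HasFDerivAt C.Q (fderiv ℝ C.Q (C.sweepArg ψ y z)) (C.sweepArg ψ y z) :=
    ((C.smooth.contDiffAt (C.isOpen_O.mem_nhds hz)).differentiableAt (by simp)).hasFDerivAt
  have h2 : HasFDerivAt (fun z : V × ℝ => C.pr y + z.2 • C.pr (phaseSpray H P y)) _ z :=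
    ((ContinuousLinearMap.snd ℝ V ℝ).hasFDerivAt.smul_const
      (C.pr (phaseSpray H P y))).const_add (C.pr y)
  have h3 : HasFDerivAt (C.sweepArg ψ y) _ z :=
    (hψ.hasFDerivAt.comp z hasFDerivAt_fst).prodMk h2
  have h4 : HasFDerivAt (C.sweep ψ y) _ z := h1.comp z h3
  rw [h4.fderiv]
  rfl

variable {v₀ : V}

theorem sweepArg_self {V : Type*} {ψ : V → W} {v₀ : V} (hψ₀ : ψ v₀ = F y) : C.sweepArg ψ y (v₀, 0) = (F y, C.pr y) := by
  simp [sweepArg, hψ₀]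

theorem eventually_sweepArg_mem (hy : y ∈ C.Ω') (h0 : H y = 0) (hψ : ContinuousAt ψ v₀)
    (hψ₀ : ψ v₀ = F y) : ∀ᶠ z in 𝓝 (v₀, (0 : ℝ)), C.sweepArg ψ y z ∈ C.O := by
  have hc : ContinuousAt (C.sweepArg ψ y) (v₀, (0 : ℝ)) :=
    (ContinuousAt.comp (x := (v₀, (0 : ℝ))) (g := ψ) hψ continuousAt_fst).prodMk (by fun_prop)
  refine hc.eventually_mem (C.isOpen_O.mem_nhds ?_)
  rw [C.sweepArg_self hψ₀]
  exact C.mem_O y hy h0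

/-- A Legendre family of leaves has no focal points near a given point of a leaf, apart from the
point itself. -/
theorem eventually_nonfocal [FiniteDimensional ℝ V] [FiniteDimensional ℝ E]
    (hM : IsNullModel Ω H P) (hF : IsLeafFunction Ω H P F) (hy : y ∈ C.Ω') (h0 : H y = 0)
    (hψ : ContDiffAt ℝ ∞ ψ v₀) (hψ₀ : ψ v₀ = F y)
    (hθ : ∀ᶠ z in 𝓝 (v₀, (0 : ℝ)), ∀ v,
      (C.sweep ψ y z).2 (fderiv ℝ (C.sweep ψ y) z (v, 0)).1 = 0)
    (himm : ∀ v, fderiv ℝ ψ v₀ v = 0 → v = 0) :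
    ∀ᶠ t in 𝓝[≠] (0 : ℝ), ∀ᶠ v in 𝓝 v₀, ∀ w, ∀ c : ℝ,
      (fderiv ℝ (C.sweep ψ y) (v, t) (w, 0)).1 = c • P (C.sweep ψ y (v, t)) → w = 0 := by
  have hψ2 : ContDiffAt ℝ 2 ψ v₀ := hψ.of_le two_le_smooth
  have hO := C.eventually_sweepArg_mem hy h0 hψ.continuousAt hψ₀
  have hψev : ∀ᶠ z in 𝓝 (v₀, (0 : ℝ)), ContDiffAt ℝ 2 ψ z.1 :=
    continuousAt_fst.eventually (hψ2.eventually (by simp))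
  have hself : C.sweep ψ y (v₀, 0) = y := by
    rw [sweep, C.sweepArg_self hψ₀, C.Q_eq y hy h0]
  have h1 := hM.eventually_nonfocal
    (C.contDiffAt_sweep two_le_smooth hψ2 hO.self_of_nhds) (by
      filter_upwards [hO] with z hz
      exact ⟨C.subset (C.Q_mem _ hz), C.H_Q _ hz⟩) (by
      filter_upwards [hO, hψev] with z hz hψz
      rw [C.fderiv_sweep (hψz.differentiableAt (by norm_num)) hz, map_zero]
      exact C.fderiv_leaf _ hz _) (by
      -- The speed `C.pr (phaseSpray H P y)` was chosen for this: since `dF` kills `X_G`, the chart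
      -- recovers `X_G` from its leaf coordinate alone.
      rw [C.fderiv_sweep (hψ.differentiableAt (by simp)) hO.self_of_nhds, hself,
        C.sweepArg_self hψ₀, map_zero, one_smul]
      have := C.fderiv_Q y hy h0 (phaseSpray H P y) (hM.fderiv_spray (C.subset hy))
      rwa [hF.spray y (C.subset hy) h0] at this) hθ (by
      intro v a b hab
      refine himm v ?_
      rw [C.fderiv_sweep (hψ.differentiableAt (by simp)) hO.self_of_nhds] at hab
      have h2 := C.fderiv_F _ hO.self_of_nhds (fderiv ℝ ψ v₀ v, (0 : ℝ) • C.pr (phaseSpray H P y))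
      rw [hab] at h2
      change fderiv ℝ F (C.sweep ψ y (v₀, 0)) _ = _ at h2
      rw [hself, map_add, map_smul, map_smul, hF.spray y (C.subset hy) h0,
        hF.euler y (C.subset hy) h0, smul_zero, smul_zero, add_zero] at h2
      exact h2.symm)
  have ht : Tendsto (fun t : ℝ => (v₀, t)) (𝓝[≠] 0) (𝓝 (v₀, 0)) :=
    (tendsto_const_nhds.prodMk_nhds tendsto_id).mono_left nhdsWithin_le_nhds
  filter_upwards [h1, ht.eventually hO, ht.eventually hψev] with t h1 hOt hψt
  have hΩ := C.subset (C.Q_mem _ hOt)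
  have hs := C.contDiffAt_sweep two_le_smooth hψt hOt
  have hd : ContinuousAt (fderiv ℝ (C.sweep ψ y)) (v₀, t) :=
    (hs.fderiv_right (m := 1) (by norm_num)).continuousAt
  have hP : ContinuousAt P (C.sweep ψ y (v₀, t)) :=
    (hM.smooth_P.contDiffAt (hM.isOpen.mem_nhds hΩ)).continuousAt
  have hl : ContinuousAt (fun v : V => (v, t)) v₀ := by fun_prop
  -- With `P ≠ 0`, non-focality is injectivity of `(w, c) ↦ df w - c P`, an open condition on a
  -- continuously varying linear map.
  let L : V → V × ℝ →L[ℝ] E := fun v =>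
    ((ContinuousLinearMap.fst ℝ E (E →L[ℝ] ℝ)).comp ((fderiv ℝ (C.sweep ψ y) (v, t)).comp
      (ContinuousLinearMap.inl ℝ V ℝ))).comp (ContinuousLinearMap.fst ℝ V ℝ)
    - (ContinuousLinearMap.snd ℝ V ℝ).smulRight (P (C.sweep ψ y (v, t)))
  have hLc : ContinuousAt L v₀ := by
    have h2 : ContinuousAt (fun v => fderiv ℝ (C.sweep ψ y) (v, t)) v₀ :=
      ContinuousAt.comp (x := v₀) (f := fun v : V => (v, t)) hd hl
    have h3 : ContinuousAt (fun v => C.sweep ψ y (v, t)) v₀ :=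
      ContinuousAt.comp (x := v₀) (f := fun v : V => (v, t)) hs.continuousAt hl
    have h4 : ContinuousAt (fun v => P (C.sweep ψ y (v, t))) v₀ :=
      ContinuousAt.comp (x := v₀) (f := fun v : V => C.sweep ψ y (v, t)) hP h3
    refine ContinuousAt.sub ?_ ?_
    · exact (continuousAt_const.clm_comp (h2.clm_comp continuousAt_const)).clm_comp
        continuousAt_const
    · exact ((ContinuousLinearMap.smulRightL ℝ (V × ℝ) E
        (ContinuousLinearMap.snd ℝ V ℝ)).continuous.continuousAt).comp h4
  have hL0 : Function.Injective (L v₀) := by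
    rw [injective_iff_map_eq_zero]
    rintro ⟨w, c⟩ hwc
    have h2 : (fderiv ℝ (C.sweep ψ y) (v₀, t) (w, 0)).1 = c • P (C.sweep ψ y (v₀, t)) :=
      sub_eq_zero.1 hwc
    have hw := h1 w c h2
    subst hw
    have h3 : c • P (C.sweep ψ y (v₀, t)) = 0 := by
      rw [← h2]
      have : ((0 : V), (0 : ℝ)) = 0 := rfl
      rw [this, map_zero]; rfl
    rw [(smul_eq_zero.1 h3).resolve_right (hM.P_ne _ hΩ (C.H_Q _ hOt))]
    rfl
  filter_upwards [hLc.eventually_mem (ContinuousLinearMap.isOpen_injective.mem_nhds hL0)]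
    with v hv w c hwc
  have h2 : L v (w, c) = 0 := sub_eq_zero.2 hwc
  have h3 : (w, c) = (0 : V × ℝ) := hv (h2.trans (map_zero _).symm)
  exact congrArg Prod.fst h3

end LeafChart

end Sweep

namespace SpaceTime

variable {M : Type*} [TopologicalSpace M] [ChartedSpace E4 M] [IsManifold 𝓘(ℝ, E4) ∞ M]
  (𝓜 : SpaceTime M) {e : OpenPartialHomeomorph 𝓜.NullGeodesics E5}
  {S : Type*} [TopologicalSpace S] [ChartedSpace (EuclideanSpace ℝ (Fin 2)) S]

/-! ### Families of null covectors -/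

section Family

variable {k : S → CotangentBundle M} {s : S}

theorem mfderiv_proj_comp (hk : MDifferentiableAt (𝓡 2) cotangentModel k s)
    (v : TangentSpace (𝓡 2) s) :
    mfderiv (𝓡 2) 𝓘(ℝ, E4) (fun u => (k u).1) s v
      = mfderiv cotangentModel 𝓘(ℝ, E4) (fun η : CotangentBundle M => η.1) (k s)
        (mfderiv (𝓡 2) cotangentModel k s v) := by
  have h := mfderiv_comp s (mdifferentiableAt_proj (k s)) hk
  exact DFunLike.congr_fun h v

/-- The covector is `g(k^♯, ·)`, so vanishing of `θ` along the lift is precisely normality of the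
null vector to the projected surface. -/
theorem canonicalForm_mfderiv (hk : MDifferentiableAt (𝓡 2) cotangentModel k s)
    (v : TangentSpace (𝓡 2) s) :
    canonicalForm (k s) (mfderiv (𝓡 2) cotangentModel k s v)
      = 𝓜.g (k s).1 (𝓜.sharp (k s).1 (k s).2)
        (mfderiv (𝓡 2) 𝓘(ℝ, E4) (fun u => (k u).1) s v) := by
  rw [𝓜.g_sharp, mfderiv_proj_comp hk]
  rfl

theorem dH_mfderiv (hk : MDifferentiableAt (𝓡 2) cotangentModel k s)
    (hN : ∀ᶠ u in 𝓝 s, k u ∈ 𝓜.nullBundle) (v : TangentSpace (𝓡 2) s) :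
    𝓜.dH (k s) (mfderiv (𝓡 2) cotangentModel k s v) = 0 := by
  have h := mfderiv_comp s ((𝓜.contMDiff_hamiltonian (k s)).mdifferentiableAt (by simp)) hk
  have h1 : 𝓜.hamiltonian ∘ k =ᶠ[𝓝 s] fun _ => (0 : ℝ) := by
    filter_upwards [hN] with u hu using hu.1
  rw [h1.mfderiv_eq, mfderiv_const] at h
  exact (DFunLike.congr_fun h v).symm

theorem mfderiv_comp_rep {σ : S → 𝓜.NullGeodesics}
    (hk : MDifferentiableAt (𝓡 2) cotangentModel k s)
    (hN : ∀ᶠ u in 𝓝 s, ∃ h : k u ∈ 𝓜.nullBundle, 𝓜.toGeodesic ⟨k u, h⟩ = σ u)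
    {h : k s ∈ 𝓜.nullBundle} {F : CotangentBundle M → E5} (hF : 𝓜.IsLocalRep e ⟨k s, h⟩ F)
    (v : TangentSpace (𝓡 2) s) :
    (show E5 from mfderiv (𝓡 2) 𝓘(ℝ, E5) (fun u => e (σ u)) s v)
      = mfderiv cotangentModel 𝓘(ℝ, E5) F (k s) (mfderiv (𝓡 2) cotangentModel k s v) := by
  have h1 := mfderiv_comp s ((𝓜.contMDiffAt_of_isLocalRep hF).mdifferentiableAt (by simp)) hk
  obtain ⟨W, hW, hkW, -, hFe⟩ := hF
  have h2 : (fun u => e (σ u)) =ᶠ[𝓝 s] F ∘ k := by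
    filter_upwards [hN, hk.continuousAt.eventually_mem (hW.mem_nhds hkW)] with u ⟨hu, hσ⟩ huW
    rw [Function.comp_apply, hFe ⟨k u, hu⟩ huW, hσ]
  rw [h2.mfderiv_eq]
  exact DFunLike.congr_fun h1 v

end Family

/-- A tangent vector of `N'M` that projects to zero in the space of null geodesics projects to a
multiple of the null vector. -/
theorem exists_mfderiv_proj_eq (he : e ∈ 𝓜.atlas) {ξ : 𝓜.nullBundle}
    (hξ : 𝓜.toGeodesic ξ ∈ e.source) {F : CotangentBundle M → E5} (hF : 𝓜.IsLocalRep e ξ F)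
    {X : TangentSpace cotangentModel (ξ : CotangentBundle M)} (hX : 𝓜.dH ξ X = 0)
    (hX0 : (show E5 from mfderiv cotangentModel 𝓘(ℝ, E5) F ξ X) = 0) :
    ∃ c : ℝ, mfderiv cotangentModel 𝓘(ℝ, E4) (fun η : CotangentBundle M => η.1) ξ X
      = c • 𝓜.sharp (ξ : CotangentBundle M).1 (ξ : CotangentBundle M).2 := by
  have hs : (ξ : CotangentBundle M) ∈ (extChartAt cotangentModel (ξ : CotangentBundle M)).source :=
    mem_extChartAt_source _
  have hb := mem_chart_source E4 (ξ : CotangentBundle M).1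
  have hd := fun X => mfderiv_eq_fderiv_comp
    ((𝓜.contMDiffAt_of_isLocalRep hF).mdifferentiableAt (by simp)) hs X
  have hsurj := 𝓜.exists_mfderiv_eq he hξ hF
  obtain ⟨W, hW, hξW, hFs, hFe⟩ := hF
  have hM := 𝓜.isNullModel_repDomain (ξ : CotangentBundle M) hW
  have hy := 𝓜.chart_mem_repDomain hs ξ.2 hξW
  have hy0 := (𝓜.chart_mem_coordDomain hs ξ.2).2
  rw [𝓜.dH_eq hs] at hX
  obtain ⟨a, b, hab⟩ := hM.exists_eq_add (𝓜.isLeafFunction_of_rep _ hW hFs hFe) finrank_null hy hy0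
    (hM.surjective_prod hy hy0 fun w => by
      obtain ⟨Y, hY, hYw⟩ := hsurj w
      rw [𝓜.dH_eq hs] at hY
      exact ⟨_, hY, (hd Y).symm.trans hYw⟩) ((hd X).symm.trans hX0) hX
  refine ⟨a, injective_chartDeriv (I := 𝓘(ℝ, E4)) (x₀ := (ξ : CotangentBundle M).1)
    (mem_extChartAt_source _) ?_⟩
  rw [chartDeriv_proj _ _ hb, hab, map_smul, ← 𝓜.coordSharp_chart hb]
  simp [phaseSpray, phaseEuler]

/-- A wave-front is a Legendre submanifold. -/
theorem IsWaveFront.isLegendre [IsManifold (𝓡 2) ∞ S] {σ : S → 𝓜.NullGeodesics}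
    (hσ : 𝓜.IsSmoothFamily σ) (h : 𝓜.IsWaveFront σ) : 𝓜.IsLegendre σ := by
  refine ⟨hσ, fun s e he hs => ?_⟩
  obtain ⟨U, hU, hsU, k, hks, hk⟩ := h s
  have hkd : MDifferentiableAt (𝓡 2) cotangentModel k s :=
    (hks.contMDiffAt (hU.mem_nhds hsU)).mdifferentiableAt (by simp)
  have hev : ∀ᶠ u in 𝓝 s, ∃ h : k u ∈ 𝓜.nullBundle, 𝓜.toGeodesic ⟨k u, h⟩ = σ u := by
    filter_upwards [hU.mem_nhds hsU] with u hu using (hk u hu).2.2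
  obtain ⟨hpos, horth, hN, hσs⟩ := hk s hsU
  have hξ : 𝓜.toGeodesic ⟨k s, hN⟩ ∈ e.source := by rwa [hσs]
  obtain ⟨F, hF, -⟩ := he _ hξ
  have hH := 𝓜.dH_mfderiv hkd (hev.mono fun u hu => hu.1)
  have hd := 𝓜.mfderiv_comp_rep hkd hev hF
  constructor
  · refine (injective_iff_map_eq_zero
      (mfderiv (𝓡 2) 𝓘(ℝ, E5) (fun s' => e (σ s')) s)).2 fun v hv => ?_
    by_contra hne
    -- A kernel vector moves the base point along the null direction only, so its image would have
    -- length zero.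
    obtain ⟨c, hc⟩ := 𝓜.exists_mfderiv_proj_eq he hξ hF (hH v) ((hd v).symm.trans hv)
    have h1 := hpos v hne
    rw [mfderiv_proj_comp hkd] at h1
    have h2 := (𝓜.sharp_null hN).1
    change mfderiv cotangentModel 𝓘(ℝ, E4) (fun η : CotangentBundle M => η.1) (k s) _ = _ at hc
    rw [hc, map_smul, map_smul, smul_apply] at h1
    change 0 < c • c • 𝓜.g (k s).1 (𝓜.sharp (k s).1 (k s).2) (𝓜.sharp (k s).1 (k s).2) at h1
    rw [h2] at h1
    simp at h1
  · intro v
    exact ⟨⟨k s, hN⟩, F, mfderiv (𝓡 2) cotangentModel k s v, hσs, hF, hH v,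
      (𝓜.canonicalForm_mfderiv hkd v).trans (horth v), (hd v).symm⟩

end SpaceTime

namespace SpaceTime

variable {M : Type*} [TopologicalSpace M] [ChartedSpace E4 M] [IsManifold 𝓘(ℝ, E4) ∞ M]
  (𝓜 : SpaceTime M) {e : OpenPartialHomeomorph 𝓜.NullGeodesics E5}

/-! ### Lifting families of null geodesics -/

/-- A local representative can be restricted to an open set over which the chart is defined. -/
theorem exists_rep_source (he : e ∈ 𝓜.atlas) {ξ : 𝓜.nullBundle}
    (hξ : 𝓜.toGeodesic ξ ∈ e.source) :
    ∃ (F : CotangentBundle M → E5) (W : Set (CotangentBundle M)),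
      IsOpen W ∧ (ξ : CotangentBundle M) ∈ W ∧ ContMDiffOn cotangentModel 𝓘(ℝ, E5) ∞ F W ∧
      (∀ η : 𝓜.nullBundle, (η : CotangentBundle M) ∈ W → F η = e (𝓜.toGeodesic η)) ∧
      ∀ η : 𝓜.nullBundle, (η : CotangentBundle M) ∈ W → 𝓜.toGeodesic η ∈ e.source := by
  obtain ⟨F, ⟨W, hW, hξW, hFs, hFe⟩, -⟩ := he ξ hξ
  have hc : Continuous 𝓜.toGeodesic := continuous_quot_mk
  obtain ⟨W', hW', hWW⟩ := isOpen_induced_iff.1 (e.open_source.preimage hc)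
  have hmem : ∀ η : 𝓜.nullBundle, (η : CotangentBundle M) ∈ W' ↔ 𝓜.toGeodesic η ∈ e.source :=
    fun η => by rw [← mem_preimage, ← mem_preimage, hWW]
  exact ⟨F, W ∩ W', hW.inter hW', ⟨hξW, (hmem ξ).2 hξ⟩, hFs.mono inter_subset_left,
    fun η hη => hFe η hη.1, fun η hη => (hmem η).1 hη.2⟩

section Lift

variable {ξ : CotangentBundle M} {F : CotangentBundle M → E5} {W : Set (CotangentBundle M)}
  {K : Type*} [NormedAddCommGroup K] [NormedSpace ℝ K]
  (C : LeafChart (𝓜.repDomain ξ W) (𝓜.coordHamiltonian ξ) (𝓜.coordSharp ξ.1)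
    (F ∘ (extChartAt cotangentModel ξ).symm) K)

theorem lift_mem {z : E5 × K} (hz : z ∈ C.O) :
    C.Q z ∈ (extChartAt cotangentModel ξ).target ∧
      (extChartAt cotangentModel ξ).symm (C.Q z) ∈ 𝓜.nullBundle ∧
      (extChartAt cotangentModel ξ).symm (C.Q z) ∈ W :=
  have h := C.subset (C.Q_mem z hz)
  ⟨h.1.1, 𝓜.symm_mem_nullBundle h.1 (C.H_Q z hz), h.2.2⟩

theorem toGeodesic_lift
    (hFe : ∀ η : 𝓜.nullBundle, (η : CotangentBundle M) ∈ W → F η = e (𝓜.toGeodesic η))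
    (hsrc : ∀ η : 𝓜.nullBundle, (η : CotangentBundle M) ∈ W → 𝓜.toGeodesic η ∈ e.source)
    {z : E5 × K} (hz : z ∈ C.O) {g : 𝓜.NullGeodesics} (hg : g ∈ e.source) (hgz : z.1 = e g) :
    𝓜.toGeodesic ⟨_, (𝓜.lift_mem C hz).2.1⟩ = g := by
  refine e.injOn (hsrc _ (𝓜.lift_mem C hz).2.2) hg ?_
  rw [← hFe _ (𝓜.lift_mem C hz).2.2, ← hgz]
  exact C.F_Q z hz

variable {S : Type*} [TopologicalSpace S] [ChartedSpace (EuclideanSpace ℝ (Fin 2)) S]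

theorem contMDiffAt_lift {s : S} {a : S → E5 × K}
    (ha : ContMDiffAt (𝓡 2) 𝓘(ℝ, E5 × K) ∞ a s) (hs : a s ∈ C.O) :
    ContMDiffAt (𝓡 2) cotangentModel ∞
      (fun u => (extChartAt cotangentModel ξ).symm (C.Q (a u))) s := by
  have h1 : ContMDiffAt 𝓘(ℝ, E5 × K) 𝓘(ℝ, E4 × (E4 →L[ℝ] ℝ)) ∞ C.Q (a s) :=
    (C.smooth.contDiffAt (C.isOpen_O.mem_nhds hs)).contMDiffAt
  have h2 : ContMDiffAt 𝓘(ℝ, E4 × (E4 →L[ℝ] ℝ)) cotangentModel ∞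
      (extChartAt cotangentModel ξ).symm (C.Q (a s)) :=
    (contMDiffOn_extChartAt_symm ξ).contMDiffAt
      ((isOpen_extChartAt_target ξ).mem_nhds (𝓜.lift_mem C hs).1)
  exact h2.comp s (h1.comp s ha)

end Lift

variable {S : Type*} [TopologicalSpace S] [ChartedSpace (EuclideanSpace ℝ (Fin 2)) S]
  {σ : S → 𝓜.NullGeodesics}

variable {𝓜} in
/-- A smooth family is smooth in every chart of the space of null geodesics. -/
theorem IsSmoothFamily.contMDiffAt (hσ : 𝓜.IsSmoothFamily σ) (he : e ∈ 𝓜.atlas) {s : S}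
    (hs : σ s ∈ e.source) : ContMDiffAt (𝓡 2) 𝓘(ℝ, E5) ∞ (fun u => e (σ u)) s := by
  obtain ⟨e', he', hs', hes⟩ := hσ.2 s
  obtain ⟨ξ, hξ⟩ : ∃ ξ, 𝓜.toGeodesic ξ = σ s := Quot.exists_rep (σ s)
  rw [← hξ] at hs hs'
  obtain ⟨F, W, hW, hξW, hFs, hFe, hsrc⟩ := 𝓜.exists_rep_source he' hs'
  obtain ⟨K, C, hC⟩ := 𝓜.exists_leafChart_of_rep he' hs' hW hξW hFs hFe
  have hξs : (ξ : CotangentBundle M) ∈ (extChartAt cotangentModel (ξ : CotangentBundle M)).source :=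
    mem_extChartAt_source _
  have hy0 := (𝓜.chart_mem_coordDomain hξs ξ.2).2
  set y := extChartAt cotangentModel (ξ : CotangentBundle M) ξ with hy
  -- Smoothness is known in one chart `e'`. Holding the leaf coordinate fixed lifts the family
  -- smoothly to `N'M`, and a representative of `e` composed with the lift gives smoothness in `e`.
  let a : S → E5 × K := fun u => (e' (σ u), C.pr y)
  have ha : ContMDiffAt (𝓡 2) 𝓘(ℝ, E5 × K) ∞ a s := hes.prodMk_space contMDiffAt_const
  have has : a s = ((F ∘ (extChartAt cotangentModel (ξ : CotangentBundle M)).symm) y, C.pr y) := by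
    simp only [a]
    rw [Function.comp_apply, hy, (extChartAt cotangentModel (ξ : CotangentBundle M)).left_inv hξs,
      hFe ξ hξW, hξ]
  have haO : a s ∈ C.O := has ▸ C.mem_O y hC hy0
  have hk := 𝓜.contMDiffAt_lift C ha haO
  set k : S → CotangentBundle M :=
    fun u => (extChartAt cotangentModel (ξ : CotangentBundle M)).symm (C.Q (a u)) with hkdef
  have hks : k s = ξ := by
    rw [hkdef]
    simp only
    rw [has, C.Q_eq y hC hy0, hy, (extChartAt cotangentModel (ξ : CotangentBundle M)).left_inv hξs]
  obtain ⟨F', ⟨W', hW', hξW', hFs', hFe'⟩, -⟩ := he ξ hs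
  have h1 : (fun u => e (σ u)) =ᶠ[𝓝 s] F' ∘ k := by
    filter_upwards [ha.continuousAt.eventually_mem (C.isOpen_O.mem_nhds haO),
      hσ.1.continuousAt.eventually_mem (e'.open_source.mem_nhds (hξ ▸ hs')),
      hk.continuousAt.eventually_mem (hW'.mem_nhds (by rw [hks]; exact hξW'))] with u huO hue huW
    have h2 := 𝓜.toGeodesic_lift C hFe hsrc huO hue rfl
    rw [Function.comp_apply, hFe' ⟨k u, (𝓜.lift_mem C huO).2.1⟩ huW]
    exact congrArg e h2.symm
  refine ContMDiffAt.congr_of_eventuallyEq (ContMDiffAt.comp s ?_ hk) h1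
  rw [hks]
  exact hFs'.contMDiffAt (hW'.mem_nhds hξW')

end SpaceTime

namespace SpaceTime

variable {M : Type*} [TopologicalSpace M] [ChartedSpace E4 M] [IsManifold 𝓘(ℝ, E4) ∞ M]
  (𝓜 : SpaceTime M) {e : OpenPartialHomeomorph 𝓜.NullGeodesics E5}
  {S : Type*} [TopologicalSpace S] [ChartedSpace (EuclideanSpace ℝ (Fin 2)) S]
  {σ : S → 𝓜.NullGeodesics}

/-! ### Legendre families are wave-fronts -/

/-- The family `σ` in the chart `e` and the chart of `S` at `s₀`. -/
def localFamily (e : OpenPartialHomeomorph 𝓜.NullGeodesics E5) (σ : S → 𝓜.NullGeodesics) (s₀ : S) :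
    EuclideanSpace ℝ (Fin 2) → E5 :=
  (fun u => e (σ u)) ∘ (extChartAt (𝓡 2) s₀).symm

section SweepLift

variable {s₀ u : S} {ξ : CotangentBundle M} {F : CotangentBundle M → E5}
  {W : Set (CotangentBundle M)} {K : Type*} [NormedAddCommGroup K] [NormedSpace ℝ K]
  (C : LeafChart (𝓜.repDomain ξ W) (𝓜.coordHamiltonian ξ) (𝓜.coordSharp ξ.1)
    (F ∘ (extChartAt cotangentModel ξ).symm) K) {y : E4 × (E4 →L[ℝ] ℝ)} {t : ℝ}

/-- The family of null covectors obtained by sweeping the family `σ` for time `t`. -/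
def sweepLift (e : OpenPartialHomeomorph 𝓜.NullGeodesics E5) (σ : S → 𝓜.NullGeodesics) (s₀ : S)
    (y : E4 × (E4 →L[ℝ] ℝ)) (t : ℝ) (u : S) : CotangentBundle M :=
  (extChartAt cotangentModel ξ).symm
    (C.sweep (𝓜.localFamily e σ s₀) y (extChartAt (𝓡 2) s₀ u, t))

theorem chart_sweepLift
    (huO : C.sweepArg (𝓜.localFamily e σ s₀) y (extChartAt (𝓡 2) s₀ u, t) ∈ C.O) :
    extChartAt cotangentModel ξ (𝓜.sweepLift C e σ s₀ y t u)
      = C.sweep (𝓜.localFamily e σ s₀) y (extChartAt (𝓡 2) s₀ u, t) :=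
  (extChartAt cotangentModel ξ).right_inv (𝓜.lift_mem C huO).1

theorem sweepLift_mem_source
    (huO : C.sweepArg (𝓜.localFamily e σ s₀) y (extChartAt (𝓡 2) s₀ u, t) ∈ C.O) :
    𝓜.sweepLift C e σ s₀ y t u ∈ (extChartAt cotangentModel ξ).source :=
  (extChartAt cotangentModel ξ).map_target (𝓜.lift_mem C huO).1

theorem toGeodesic_sweepLift
    (hFe : ∀ η : 𝓜.nullBundle, (η : CotangentBundle M) ∈ W → F η = e (𝓜.toGeodesic η))
    (hsrc : ∀ η : 𝓜.nullBundle, (η : CotangentBundle M) ∈ W → 𝓜.toGeodesic η ∈ e.source)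
    (hu : u ∈ (extChartAt (𝓡 2) s₀).source) (hue : σ u ∈ e.source)
    (huO : C.sweepArg (𝓜.localFamily e σ s₀) y (extChartAt (𝓡 2) s₀ u, t) ∈ C.O) :
    ∃ h : 𝓜.sweepLift C e σ s₀ y t u ∈ 𝓜.nullBundle, 𝓜.toGeodesic ⟨_, h⟩ = σ u := by
  refine ⟨(𝓜.lift_mem C huO).2.1, 𝓜.toGeodesic_lift C hFe hsrc huO hue ?_⟩
  simp only [LeafChart.sweepArg, localFamily, Function.comp_apply]
  rw [(extChartAt (𝓡 2) s₀).left_inv hu]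

variable [IsManifold (𝓡 2) ∞ S]

theorem contDiffAt_localFamily (hσ : 𝓜.IsSmoothFamily σ) (he : e ∈ 𝓜.atlas)
    (hu : u ∈ (extChartAt (𝓡 2) s₀).source) (hue : σ u ∈ e.source) :
    ContDiffAt ℝ ∞ (𝓜.localFamily e σ s₀) (extChartAt (𝓡 2) s₀ u) :=
  (hσ.contMDiffAt he hue).contDiffAt_comp_extChartAt_symm hu

theorem contMDiffAt_sweepArg (hσ : 𝓜.IsSmoothFamily σ) (he : e ∈ 𝓜.atlas)
    (hu : u ∈ (extChartAt (𝓡 2) s₀).source) (hue : σ u ∈ e.source) :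
    ContMDiffAt (𝓡 2) 𝓘(ℝ, E5 × K) ∞ (fun u' =>
      C.sweepArg (𝓜.localFamily e σ s₀) y (extChartAt (𝓡 2) s₀ u', t)) u := by
  have h1 : ContMDiffAt 𝓘(ℝ, EuclideanSpace ℝ (Fin 2) × ℝ) 𝓘(ℝ, E5 × K) ∞
      (C.sweepArg (𝓜.localFamily e σ s₀) y) (extChartAt (𝓡 2) s₀ u, t) :=
    (C.contDiffAt_sweepArg (𝓜.contDiffAt_localFamily hσ he hu hue)).contMDiffAt
  have h2 : ContMDiffAt (𝓡 2) 𝓘(ℝ, EuclideanSpace ℝ (Fin 2)) ∞ (extChartAt (𝓡 2) s₀) u :=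
    contMDiffAt_extChartAt' (by rwa [← extChartAt_source (𝓡 2)])
  exact h1.comp u (h2.prodMk_space contMDiffAt_const)

theorem contMDiffAt_sweepLift (hσ : 𝓜.IsSmoothFamily σ) (he : e ∈ 𝓜.atlas)
    (hu : u ∈ (extChartAt (𝓡 2) s₀).source) (hue : σ u ∈ e.source)
    (huO : C.sweepArg (𝓜.localFamily e σ s₀) y (extChartAt (𝓡 2) s₀ u, t) ∈ C.O) :
    ContMDiffAt (𝓡 2) cotangentModel ∞ (𝓜.sweepLift C e σ s₀ y t) u :=
  𝓜.contMDiffAt_lift C (𝓜.contMDiffAt_sweepArg C hσ he hu hue) huO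

theorem eventually_sweepLift (hσ : 𝓜.IsSmoothFamily σ) (he : e ∈ 𝓜.atlas)
    (hu : u ∈ (extChartAt (𝓡 2) s₀).source) (hue : σ u ∈ e.source)
    (huO : C.sweepArg (𝓜.localFamily e σ s₀) y (extChartAt (𝓡 2) s₀ u, t) ∈ C.O) :
    ∀ᶠ u' in 𝓝 u, u' ∈ (extChartAt (𝓡 2) s₀).source ∧ σ u' ∈ e.source ∧
      C.sweepArg (𝓜.localFamily e σ s₀) y (extChartAt (𝓡 2) s₀ u', t) ∈ C.O :=
  Filter.Eventually.and ((isOpen_extChartAt_source s₀).mem_nhds hu)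
    ((hσ.1.continuousAt.eventually_mem (e.open_source.mem_nhds hue)).and
      ((𝓜.contMDiffAt_sweepArg C hσ he hu hue).continuousAt.eventually_mem
        (C.isOpen_O.mem_nhds huO)))

theorem chartDeriv_sweepLift (hσ : 𝓜.IsSmoothFamily σ) (he : e ∈ 𝓜.atlas)
    (hu : u ∈ (extChartAt (𝓡 2) s₀).source) (hue : σ u ∈ e.source)
    (huO : C.sweepArg (𝓜.localFamily e σ s₀) y (extChartAt (𝓡 2) s₀ u, t) ∈ C.O)
    (w : TangentSpace (𝓡 2) u) :
    chartDeriv cotangentModel ξ (𝓜.sweepLift C e σ s₀ y t u)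
        (mfderiv (𝓡 2) cotangentModel (𝓜.sweepLift C e σ s₀ y t) u w)
      = fderiv ℝ (C.sweep (𝓜.localFamily e σ s₀) y) (extChartAt (𝓡 2) s₀ u, t)
        (chartDeriv (𝓡 2) s₀ u w, 0) := by
  have hk : MDifferentiableAt (𝓡 2) cotangentModel (𝓜.sweepLift C e σ s₀ y t) u :=
    (𝓜.contMDiffAt_sweepLift C hσ he hu hue huO).mdifferentiableAt (by simp)
  have h1 := mfderiv_comp u (mdifferentiableAt_extChartAt (I := cotangentModel) (x := ξ) (by
    rw [← extChartAt_source cotangentModel]; exact 𝓜.sweepLift_mem_source C huO)) hk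
  have hq : HasFDerivAt (C.sweep (𝓜.localFamily e σ s₀) y)
      (fderiv ℝ (C.sweep (𝓜.localFamily e σ s₀) y) (extChartAt (𝓡 2) s₀ u, t))
      (extChartAt (𝓡 2) s₀ u, t) :=
    ((C.contDiffAt_sweep le_rfl (𝓜.contDiffAt_localFamily hσ he hu hue) huO).differentiableAt
      (by simp)).hasFDerivAt
  have hl : HasFDerivAt (fun v : EuclideanSpace ℝ (Fin 2) => (v, t))
      (ContinuousLinearMap.inl ℝ _ ℝ) (extChartAt (𝓡 2) s₀ u) := hasFDerivAt_prodMk_left _ _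
  have h2 : HasFDerivAt (fun v => C.sweep (𝓜.localFamily e σ s₀) y (v, t)) _
      (extChartAt (𝓡 2) s₀ u) := hq.comp (f := fun v => (v, t)) (extChartAt (𝓡 2) s₀ u) hl
  have h3 : MDifferentiableAt (𝓡 2) 𝓘(ℝ, EuclideanSpace ℝ (Fin 2)) (extChartAt (𝓡 2) s₀) u :=
    mdifferentiableAt_extChartAt (by rwa [← extChartAt_source (𝓡 2)])
  have h4 := h2.hasMFDerivAt.comp u h3.hasMFDerivAt
  have h5 : extChartAt cotangentModel ξ ∘ 𝓜.sweepLift C e σ s₀ y t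
      =ᶠ[𝓝 u] (fun v => C.sweep (𝓜.localFamily e σ s₀) y (v, t)) ∘ extChartAt (𝓡 2) s₀ := by
    filter_upwards [𝓜.eventually_sweepLift C hσ he hu hue huO] with u' hu'
    exact 𝓜.chart_sweepLift C hu'.2.2
  rw [h5.mfderiv_eq, h4.mfderiv] at h1
  exact (DFunLike.congr_fun h1 w).symm

end SweepLift

variable [IsManifold (𝓡 2) ∞ S]

set_option maxHeartbeats 1000000 in
variable {𝓜} in
/-- A Legendre submanifold is a wave-front. -/
theorem IsLegendre.isWaveFront (h : 𝓜.IsLegendre σ) : 𝓜.IsWaveFront σ := by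
  intro s₀
  have hσ := h.1
  obtain ⟨e, he, hs₀, -⟩ := hσ.2 s₀
  obtain ⟨ξ, hξ⟩ : ∃ ξ, 𝓜.toGeodesic ξ = σ s₀ := Quot.exists_rep (σ s₀)
  obtain ⟨F, W, hW, hξW, hFs, hFe, hsrc⟩ := 𝓜.exists_rep_source he (hξ ▸ hs₀)
  obtain ⟨K, C, hC⟩ := 𝓜.exists_leafChart_of_rep he (hξ ▸ hs₀) hW hξW hFs hFe
  have hξs : (ξ : CotangentBundle M) ∈ (extChartAt cotangentModel (ξ : CotangentBundle M)).source :=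
    mem_extChartAt_source _
  have hs : s₀ ∈ (extChartAt (𝓡 2) s₀).source := mem_extChartAt_source _
  have hy0 := (𝓜.chart_mem_coordDomain hξs ξ.2).2
  set y := extChartAt cotangentModel (ξ : CotangentBundle M) ξ with hy
  have hψ := 𝓜.contDiffAt_localFamily hσ he hs hs₀
  have hψ₀ : 𝓜.localFamily e σ s₀ (extChartAt (𝓡 2) s₀ s₀)
      = (F ∘ (extChartAt cotangentModel (ξ : CotangentBundle M)).symm) y := by
    rw [localFamily, Function.comp_apply, Function.comp_apply, (extChartAt (𝓡 2) s₀).left_inv hs,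
      hy, (extChartAt cotangentModel (ξ : CotangentBundle M)).left_inv hξs, hFe ξ hξW, hξ]
  have hO := C.eventually_sweepArg_mem hC hy0 hψ.continuousAt hψ₀
  have hk : ∀ u ∈ (extChartAt (𝓡 2) s₀).source, σ u ∈ e.source → ∀ t : ℝ,
      C.sweepArg (𝓜.localFamily e σ s₀) y (extChartAt (𝓡 2) s₀ u, t) ∈ C.O →
      MDifferentiableAt (𝓡 2) cotangentModel (𝓜.sweepLift C e σ s₀ y t) u ∧
      ∃ hN : 𝓜.sweepLift C e σ s₀ y t u ∈ 𝓜.nullBundle, 𝓜.toGeodesic ⟨_, hN⟩ = σ u ∧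
      ∀ w, canonicalForm (𝓜.sweepLift C e σ s₀ y t u)
        (mfderiv (𝓡 2) cotangentModel (𝓜.sweepLift C e σ s₀ y t) u w) = 0 := by
    intro u hu hue t huO
    have hkd : MDifferentiableAt (𝓡 2) cotangentModel (𝓜.sweepLift C e σ s₀ y t) u :=
      (𝓜.contMDiffAt_sweepLift C hσ he hu hue huO).mdifferentiableAt (by simp)
    have hev : ∀ᶠ u' in 𝓝 u, ∃ h : 𝓜.sweepLift C e σ s₀ y t u' ∈ 𝓜.nullBundle,
        𝓜.toGeodesic ⟨_, h⟩ = σ u' := by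
      filter_upwards [𝓜.eventually_sweepLift C hσ he hu hue huO] with u' hu'
      exact 𝓜.toGeodesic_sweepLift C hFe hsrc hu'.1 hu'.2.1 hu'.2.2
    obtain ⟨hN, hg⟩ := hev.self_of_nhds
    refine ⟨hkd, hN, hg, fun w => ?_⟩
    have hrep : 𝓜.IsLocalRep e ⟨_, hN⟩ F := ⟨W, hW, (𝓜.lift_mem C huO).2.2, hFs, hFe⟩
    -- The Legendre condition may be witnessed at a remote covector of the geodesic; constancy along
    -- leaves transfers it to the swept lift.
    refine 𝓜.canonicalForm_eq_zero_of_mem_contactPlane he (by rwa [hg]) hrep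
      (𝓜.dH_mfderiv hkd (hev.mono fun u hu => hu.1) w) ?_
    have h1 := 𝓜.mfderiv_comp_rep hkd hev hrep w
    have h2 := (h.2 u e he hue).2 w
    rw [hg]
    exact h1 ▸ h2
  have hθ : ∀ᶠ z in 𝓝 (extChartAt (𝓡 2) s₀ s₀, (0 : ℝ)), ∀ v,
      (C.sweep (𝓜.localFamily e σ s₀) y z).2
        (fderiv ℝ (C.sweep (𝓜.localFamily e σ s₀) y) z (v, 0)).1 = 0 := by
    have h1 : ∀ᶠ v in 𝓝 (extChartAt (𝓡 2) s₀ s₀), v ∈ (extChartAt (𝓡 2) s₀).target ∧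
        σ ((extChartAt (𝓡 2) s₀).symm v) ∈ e.source := by
      refine Filter.Eventually.and (extChartAt_target_mem_nhds s₀) ?_
      refine (hσ.1.continuousAt.comp (continuousAt_extChartAt_symm s₀)).eventually_mem
        (e.open_source.mem_nhds ?_)
      rwa [Function.comp_apply, (extChartAt (𝓡 2) s₀).left_inv hs]
    filter_upwards [hO, continuousAt_fst.eventually h1] with z hzO ⟨hzt, hze⟩ v
    obtain ⟨v₁, t⟩ := z
    have hu := (extChartAt (𝓡 2) s₀).map_target hzt
    have huv := (extChartAt (𝓡 2) s₀).right_inv hzt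
    dsimp only at hu huv hze
    rw [← huv] at hzO ⊢
    set u := (extChartAt (𝓡 2) s₀).symm v₁
    obtain ⟨w, rfl⟩ := surjective_chartDeriv hu v
    obtain ⟨-, hN, -, hcan⟩ := hk u hu hze t hzO
    have h2 := hcan w
    have hb := 𝓜.sweepLift_mem_source C hzO
    rw [cotangent_source] at hb
    rw [canonicalForm_eq (ξ : CotangentBundle M) _ hb, 𝓜.chartDeriv_sweepLift C hσ he hu hze hzO,
      𝓜.chart_sweepLift C hzO] at h2
    exact h2
  have himm : ∀ v, fderiv ℝ (𝓜.localFamily e σ s₀) (extChartAt (𝓡 2) s₀ s₀) v = 0 → v = 0 := by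
    intro v hv
    obtain ⟨w, rfl⟩ := surjective_chartDeriv hs v
    have h1 := mfderiv_eq_fderiv_comp ((hσ.contMDiffAt he hs₀).mdifferentiableAt (by simp)) hs w
    have h2 := (injective_iff_map_eq_zero
      (mfderiv (𝓡 2) 𝓘(ℝ, E5) (fun s' => e (σ s')) s₀)).1 (h.2 s₀ e he hs₀).1 w (h1.trans hv)
    rw [h2, map_zero]
  have hfocal := C.eventually_nonfocal (𝓜.isNullModel_repDomain _ hW)
    (𝓜.isLeafFunction_of_rep _ hW hFs hFe) hC hy0 hψ hψ₀ hθ himm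
  have ht : Tendsto (fun t : ℝ => (extChartAt (𝓡 2) s₀ s₀, t)) (𝓝[≠] 0)
      (𝓝 (extChartAt (𝓡 2) s₀ s₀, 0)) :=
    (tendsto_const_nhds.prodMk_nhds tendsto_id).mono_left nhdsWithin_le_nhds
  -- The surface is taken at a small non-zero time, since the lift at time zero may be focal.
  obtain ⟨t, hft, hOt⟩ := (hfocal.and (ht.eventually hO)).exists
  have hev := (𝓜.eventually_sweepLift C hσ he hs hs₀ hOt).and
    ((continuousAt_extChartAt s₀).eventually hft)
  obtain ⟨U, hU, hUo, hsU⟩ := eventually_nhds_iff.1 hev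
  refine ⟨U, hUo, hsU, 𝓜.sweepLift C e σ s₀ y t, ?_, ?_⟩
  · intro u huU
    obtain ⟨⟨hu, hue, huO⟩, -⟩ := hU u huU
    exact (𝓜.contMDiffAt_sweepLift C hσ he hu hue huO).contMDiffWithinAt
  · intro u huU
    obtain ⟨⟨hu, hue, huO⟩, hfoc⟩ := hU u huU
    obtain ⟨hkd, hN, hg, hcan⟩ := hk u hu hue t huO
    have horth := fun w => (𝓜.canonicalForm_mfderiv hkd w).symm.trans (hcan w)
    refine ⟨fun w hw => ?_, horth, hN, hg⟩
    obtain ⟨hnull, htime⟩ := 𝓜.sharp_null hN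
    obtain ⟨hnn, hzero⟩ := 𝓜.nonneg_of_orthogonal_null _ hnull htime (horth w)
    -- Orthogonality to the null vector already gives a non-negative square; equality makes the
    -- image a multiple of `k^♯`, which non-focality excludes for `w ≠ 0`.
    refine hnn.lt_of_ne' fun h0 => hw ?_
    obtain ⟨c, hc⟩ := hzero h0
    have hb := 𝓜.sweepLift_mem_source C huO
    rw [cotangent_source] at hb
    rw [mfderiv_proj_comp hkd] at hc
    have h1 := (chartDeriv_proj (ξ : CotangentBundle M) _ hb
      (mfderiv (𝓡 2) cotangentModel (𝓜.sweepLift C e σ s₀ y t) u w)).trans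
      (congrArg Prod.fst (𝓜.chartDeriv_sweepLift C hσ he hu hue huO w))
    have h2 := 𝓜.coordSharp_chart hb
    rw [𝓜.chart_sweepLift C huO] at h2
    rw [hc, map_smul, ← h2] at h1
    have h3 := hfoc _ c h1.symm
    exact (injective_iff_map_eq_zero (chartDeriv (𝓡 2) s₀ u)).1 (injective_chartDeriv hu) w h3

end SpaceTime

end

/-! ### The equivalence of the Legendre and wave-front conditions -/

theorem mainTheorem6 {M : Type*} [TopologicalSpace M] [T2Space M] [SecondCountableTopology M]
    [ChartedSpace E4 M] [IsManifold 𝓘(ℝ, E4) ∞ M]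
    (𝓜 : SpaceTime M) (h𝓜 : 𝓜.StronglyCausal)
    {S : Type*} [TopologicalSpace S] [ChartedSpace (EuclideanSpace ℝ (Fin 2)) S]
    [IsManifold (𝓡 2) ∞ S]
    (σ : S → 𝓜.NullGeodesics) (hσ : 𝓜.IsSmoothFamily σ) :
    𝓜.IsLegendre σ ↔ 𝓜.IsWaveFront σ := by
  exact ⟨fun h => h.isWaveFront, fun h => h.isLegendre 𝓜 hσ⟩
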